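/- **Setting.** Let $K\in\mathbb N$, $n_i\ge 1$, $0\le m_i\le n_i$ ($i=1,\dots,K$), $h>0$, $t_k=kh$. A parameter vector $\theta_i=(a_{i,1},\dots,a_{i,n_i},b_{i,0},\dots,b_{i,m_i})$ describes the submodel $G_i(p,\theta_i)=B_i(p)/A_i(p)$ with $A_i(p)=1+a_{i,1}p+\dots+a_{i,n_i}p^{n_i}$ and $B_i(p)=b_{i,0}+\dots+b_{i,m_i}p^{m_i}$; call $\theta_i$ a *model* if $a_{i,n_i}\ne0$, all zeros of $A_i$ lie in the open left half-plane, and $A_i,B_i$ are coprime. The true parameters $\beta^*=(\theta_1^*,\dots,\theta_K^*)$ are models, and the data are $u_1(t_k),\dots,u_K(t_k)$ and $y(t_k)=\sum_i G_i(p,\theta_i^*)u_i(t_k)+v(t_k)$, $k=1,\dots,N$. Here $G(p)w(t_k)$ is the output at time $t_k$ of the continuous-time filter $G$ (acting on the infinite past) driven by the zero-order-hold signal with samples $w(t_j)$. The inputs and the disturbance are real, square integrable and jointly stationary and ergodic; $v$ has mean zero, and each $u_i(t_k)$ is independent of each $v(t_s)$. A signal $w$ is persistently exciting of order no less than $r$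 if the $r\times r$ matrix $\big(\mathbb E[w(t_a)w(t_b)]\big)_{0\le a,b<r}$ is positive definite. One of two setups holds. * **MISO:** $\mathbb E[u_i(t_k)u_j(t_l)]=0$ for all $k,l$ and $i\ne j$, and $u_i$ is persistently exciting of order no less than $\max(2n_i,\;n_i+m_i+1)$ for each $i$. * **Additive SISO:** all $u_i$ are equal, $m_i=n_i$ for at most one $i$, and the common input is persistently exciting of order no less than $\max\big(2\sum_i n_i,\;\sum_i(n_i+m_i+1)\big)$. **Algorithm.** For data size $N$, a run of block coordinate descent is a sequence of joint estimates $\beta^l=(\theta_1^l,\dots,\theta_K^l)$ such that, for all $l$ and $i$, $\theta_i^{l+1}=\lim_{s\to\infty}\theta_{i,s}^{l+1}$, where the $\theta_{i,s}^{l+1}$ are obtained, from some $\theta_{i,0}^{l+1}$, by one of the following iterations (the same throughout). With the residual output $\tilde y_i=y-\sum_{j<i}G_j(p,\theta_j^{l+1})u_j-\sum_{j>i}G_j(p,\theta_j^{l})u_j$, with $A,B$ the polynomials of $\theta=\theta_{i,s}^{l+1}$, and with $$\hat\varphi=\Big[\tfrac{-pB}{A^2}u_i,\dots,\tfrac{-p^{n_i}B}{A^2}u_i,\tfrac1Au_i,\dots,\tfrac{p^{m_i}}{A}u_i\Big]^\top,\qquad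 \varphi=\Big[\tfrac{-p}{A}\tilde y_i,\dots,\tfrac{-p^{n_i}}{A}\tilde y_i,\tfrac1Au_i,\dots,\tfrac{p^{m_i}}{A}u_i\Big]^\top,$$ they are (all signals evaluated at $t_k$) * Gauss–Newton (GN): $\theta_{i,s+1}^{l+1}=\big[\tfrac1N\sum_{k=1}^N\hat\varphi\hat\varphi^\top\big]^{-1}\tfrac1N\sum_{k=1}^N\hat\varphi\,\big(\tilde y_i-\tfrac BAu_i+\tfrac B{A^2}u_i\big)$; * SRIVC: $\theta_{i,s+1}^{l+1}=\big[\tfrac1N\sum_{k=1}^N\hat\varphi\varphi^\top\big]^{-1}\tfrac1N\sum_{k=1}^N\hat\varphi\,\tfrac1A\tilde y_i$. It is required that all $\theta_{i,s}^{l+1}$ and $\theta_i^l$ are models and that the inverted matrices are non-singular for all large $s$. For a given data record, $\bar\beta$ is a *converging point* (of the chosen method) if there are $\beta_N\to\bar\beta$ ($N\to\infty$) such that, for all large $N$, $\beta_N$ consists of models and is the limit as $l\to\infty$ of a run on the first $N$ samples. **Theorem.** Let $\mathcal D$ be the set of tuples $(A_1,\dots,A_K)$ of stable denominators of degrees $n_1,\dots,n_K$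 with $2\pi/h>2|\mathrm{Im}\,z|$ for every zero $z$ of $\prod_jA_j$, identified with a subset of $\mathbb R^{n_1+\dots+n_K}$ through the coefficients. There is an open set $\mathcal G$ of pairs (system denominators, model denominators), depending only on $h$, the $n_i,m_i$ and the signals (not on the numerators or the method), such that $(\mathcal D\times\mathcal D)\setminus\mathcal G$ is a Lebesgue null set, $\{A\in\mathcal D:(A,A)\notin\mathcal G\}$ is a Lebesgue null set, and the following holds for all true parameters $\beta^*$ with denominators $A^*\in\mathcal D$ and for both methods, almost surely: 1. if $\bar\beta$ consists of models with denominators $\bar A\in\mathcal D$, $(A^*,\bar A)\in\mathcal G$, and $\bar\beta$ is a converging point, then $\bar\beta=\beta^*$; 2. if $(A^*,A^*)\in\mathcal G$ (thus for almost every $A^*\in\mathcal D$), then $\beta^*$ is a converging point; for SRIVC this is claimed when the expected matrices $\mathbb E[\hat\varphi\varphi^\top]$ at the true parameters are non-singular for every $i$. -/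

import Mathlib

open MeasureTheory ProbabilityTheory Filter Topology Polynomial

noncomputable section

namespace BlockDescent

/-! ### Filtering of held signals by proper rational transfer functions -/

/-- The expansion of `B(p) / A(p)` in powers of `1 / p` (for `deg B ≤ deg A`): the coefficient of
index `j` multiplies `p⁻ʲ`. -/
def expansionAtInfinity (B A : ℝ[X]) : PowerSeries ℝ :=
  (B.reflect A.natDegree : PowerSeries ℝ) * (A.reverse : PowerSeries ℝ)⁻¹

/-- The direct feedthrough `lim_{p → ∞} B(p) / A(p)`. -/
def feedthrough (B A : ℝ[X]) : ℝ :=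
  PowerSeries.coeff 0 (expansionAtInfinity B A)

/-- The impulse response of the strictly proper part of `B(p) / A(p)`, i.e. the termwise inverse
Laplace transform `∑ j, c_{j+1} tʲ / j!` of `∑ j, c_{j+1} p^{-(j+1)}` (an entire function). -/
def impulseResponse (B A : ℝ[X]) (t : ℝ) : ℝ :=
  ∑' j : ℕ, PowerSeries.coeff (j + 1) (expansionAtInfinity B A) * t ^ j / (j.factorial : ℝ)

/-- `(B(p) / A(p)) x(t)` for a continuous-time signal `x`. -/
def filterCT (B A : ℝ[X]) (x : ℝ → ℝ) (t : ℝ) : ℝ :=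
  feedthrough B A * x t + ∫ s in Set.Ioi (0 : ℝ), impulseResponse B A s * x (t - s)

/-- Zero-order hold with sampling period `h`: equal to `w k` on `[k h, (k + 1) h)`. -/
def hold (h : ℝ) (w : ℤ → ℝ) (t : ℝ) : ℝ := w ⌊t / h⌋

/-- `(B(p) / A(p)) w(t_k)` with `t_k = k h`, for a signal `w` with zero-order hold behaviour. -/
def filt (h : ℝ) (B A : ℝ[X]) (w : ℤ → ℝ) (k : ℤ) : ℝ :=
  filterCT B A (hold h w) (k * h)

/-! ### Models -/

/-- A parameter vector `(a_1, …, a_n, b_0, …, b_m)` of one subsystem. -/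
abbrev Param (n m : ℕ) : Type := Fin n ⊕ Fin (m + 1) → ℝ

/-- The joint parameter vector of all subsystems. -/
abbrev JointParam {K : ℕ} (n m : Fin K → ℕ) : Type := ∀ i, Param (n i) (m i)

/-- The denominator coefficients of all subsystems. -/
abbrev Denominators {K : ℕ} (n : Fin K → ℕ) : Type := ∀ i, Fin (n i) → ℝ

/-- `1 + a_1 p + ⋯ + a_n pⁿ`. -/
def denPoly {n : ℕ} (a : Fin n → ℝ) : ℝ[X] := 1 + ∑ r : Fin n, C (a r) * X ^ (r.val + 1)

/-- The denominator coefficients of a parameter vector. -/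
def den {n m : ℕ} (θ : Param n m) : Fin n → ℝ := fun r => θ (Sum.inl r)

/-- The denominator coefficients of a joint parameter vector. -/
def dens {K : ℕ} {n m : Fin K → ℕ} (β : JointParam n m) : Denominators n := fun i => den (β i)

/-- The denominator polynomial `A(p)`. -/
def polyA {n m : ℕ} (θ : Param n m) : ℝ[X] := denPoly (den θ)

/-- The numerator polynomial `B(p) = b_0 + b_1 p + ⋯ + b_m pᵐ`. -/
def polyB {n m : ℕ} (θ : Param n m) : ℝ[X] :=
  ∑ r : Fin (m + 1), C (θ (Sum.inr r)) * X ^ r.val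

/-- All complex zeros lie in the open left half-plane. -/
def IsStable (A : ℝ[X]) : Prop := ∀ z : ℂ, aeval z A = 0 → z.re < 0

/-- The sampling (angular) frequency `2 π / h` is more than twice the imaginary part of
every zero. -/
def IsSampledFast (h : ℝ) (A : ℝ[X]) : Prop :=
  ∀ z : ℂ, aeval z A = 0 → 2 * |z.im| < 2 * Real.pi / h

/-- A model of the prescribed order (`a_n ≠ 0`) that is stable, with coprime numerator and
denominator. -/
def IsModel {n m : ℕ} (θ : Param n m) : Prop :=
  (polyA θ).natDegree = n ∧ IsStable (polyA θ) ∧ IsCoprime (polyA θ) (polyB θ)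

/-- The denominators of the prescribed orders that are stable and meet the sampling condition. -/
def denRegion {K : ℕ} (h : ℝ) (n : Fin K → ℕ) : Set (Denominators n) :=
  {a | ∀ i, (denPoly (a i)).natDegree = n i ∧ IsStable (denPoly (a i)) ∧
    IsSampledFast h (denPoly (a i))}

/-! ### Signals and experimental setups -/

section Signals

variable {Ω : Type*} [MeasurableSpace Ω] {K : ℕ}

/-- The sample path of the inputs and of the disturbance. -/
def path (u : Fin K → ℤ → Ω → ℝ) (v : ℤ → Ω → ℝ) (ω : Ω) : ℤ → (Fin K → ℝ) × ℝ :=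
  fun k => (fun i => u i k ω, v k ω)

/-- The inputs and the disturbance are jointly (strictly) stationary and ergodic: the time shift
preserves the law of their sample path and is ergodic for it. -/
def IsStationaryErgodic (P : Measure Ω) (u : Fin K → ℤ → Ω → ℝ) (v : ℤ → Ω → ℝ) : Prop :=
  Ergodic (fun (x : ℤ → (Fin K → ℝ) × ℝ) (k : ℤ) => x (k + 1)) (P.map (path u v))

/-- Persistence of excitation of order (no less than) `r`: the `r × r` covariance matrix of
consecutive samples is positive definite. -/
def IsPersistentlyExciting (P : Measure Ω) (w : ℤ → Ω → ℝ) (r : ℕ) : Prop :=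
  (Matrix.of fun a b : Fin r => ∫ ω, w (a.val : ℤ) ω * w (b.val : ℤ) ω ∂P).PosDef

/-- The MISO setup: mutually uncorrelated inputs; the input `u_i` is persistently exciting of
order at least `2 n_i` and at least the number `n_i + m_i + 1` of parameters of the subsystem (the
latter is larger, namely `2 n_i + 1`, only if `m_i = n_i`). -/
def IsMISO (P : Measure Ω) (n m : Fin K → ℕ) (u : Fin K → ℤ → Ω → ℝ) : Prop :=
  (∀ i j, i ≠ j → ∀ k l, ∫ ω, u i k ω * u j l ω ∂P = 0) ∧
  ∀ i, IsPersistentlyExciting P (u i) (max (2 * n i) (n i + m i + 1))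

/-- The additive SISO setup: equal inputs, at most one biproper subsystem; the common input is
persistently exciting of order at least `2 ∑ n_i` and at least the total number
`∑ (n_i + m_i + 1)` of parameters (the latter is larger, namely `2 ∑ n_i + 1`, only if one
subsystem is biproper and `m_i = n_i - 1` for all the others). -/
def IsAdditiveSISO (P : Measure Ω) (n m : Fin K → ℕ) (u : Fin K → ℤ → Ω → ℝ) : Prop :=
  (∀ i j k, u i k = u j k) ∧
  (∀ i j, m i = n i → m j = n j → i = j) ∧
  ∀ i, IsPersistentlyExciting P (u i) (max (2 * ∑ j, n j) (∑ j, (n j + m j + 1)))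

end Signals

/-! ### Gauss-Newton and SRIVC iterations -/

/-- The two methods for computing the descent step. -/
inductive Method : Type
  | gaussNewton
  | srivc

section Iterations

variable {n m : ℕ}

/-- The output `G(p, θ) w(t_k)` of one submodel. -/
def modelOutput (h : ℝ) (θ : Param n m) (w : ℤ → ℝ) (k : ℤ) : ℝ :=
  filt h (polyB θ) (polyA θ) w k

/-- The gradient `φ̂_f(t_k, θ)` of the submodel output, also the instrument vector. -/
def instrument (h : ℝ) (θ : Param n m) (w : ℤ → ℝ) (k : ℤ) : Param n m :=
  Sum.elim (fun r => filt h (-(X ^ (r.val + 1) * polyB θ)) (polyA θ ^ 2) w k)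
    (fun r => filt h (X ^ r.val) (polyA θ) w k)

/-- The filtered regressor `φ_f(t_k, θ)` formed from the residual output `yt` and the
input `w`. -/
def regressor (h : ℝ) (θ : Param n m) (w yt : ℤ → ℝ) (k : ℤ) : Param n m :=
  Sum.elim (fun r => filt h (-(X ^ (r.val + 1))) (polyA θ) yt k)
    (fun r => filt h (X ^ r.val) (polyA θ) w k)

/-- The right factor of the (modified) normal matrix: `φ̂_f` for Gauss-Newton and `φ_f` for
SRIVC. -/
def rightFactor (meth : Method) (h : ℝ) (θ : Param n m) (w yt : ℤ → ℝ) (k : ℤ) : Param n m :=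
  match meth with
  | Method.gaussNewton => instrument h θ w k
  | Method.srivc => regressor h θ w yt k

/-- The scalar signal on the right-hand side: `e + (B / A²) u` for Gauss-Newton, where
`e = ỹ - (B / A) u`, and `ỹ_f = (1 / A) ỹ` for SRIVC. -/
def target (meth : Method) (h : ℝ) (θ : Param n m) (w yt : ℤ → ℝ) (k : ℤ) : ℝ :=
  match meth with
  | Method.gaussNewton =>
      (yt k - modelOutput h θ w k) + filt h (polyB θ) (polyA θ ^ 2) w k
  | Method.srivc => filt h 1 (polyA θ) yt k

/-- The (modified) normal matrix of the `N` samples `k = 1, …, N`. -/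
def normalMatrix (meth : Method) (h : ℝ) (N : ℕ) (θ : Param n m) (w yt : ℤ → ℝ) :
    Matrix (Fin n ⊕ Fin (m + 1)) (Fin n ⊕ Fin (m + 1)) ℝ :=
  (1 / (N : ℝ)) • ∑ k ∈ Finset.Icc (1 : ℤ) N,
    Matrix.vecMulVec (instrument h θ w k) (rightFactor meth h θ w yt k)

/-- The right-hand side vector of the iterations. -/
def normalVector (meth : Method) (h : ℝ) (N : ℕ) (θ : Param n m) (w yt : ℤ → ℝ) : Param n m :=
  (1 / (N : ℝ)) • ∑ k ∈ Finset.Icc (1 : ℤ) N, target meth h θ w yt k • instrument h θ w k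

/-- One Gauss-Newton or SRIVC iteration. -/
def innerStep (meth : Method) (h : ℝ) (N : ℕ) (θ : Param n m) (w yt : ℤ → ℝ) : Param n m :=
  (normalMatrix meth h N θ w yt)⁻¹.mulVec (normalVector meth h N θ w yt)

end Iterations

/-! ### Block coordinate descent -/

section Descent

variable {K : ℕ} {n m : Fin K → ℕ}

/-- The noise-free output `∑ i, G_i(p) u_i(t_k)` plus the disturbance. -/
def output (h : ℝ) (β : JointParam n m) (u : Fin K → ℤ → ℝ) (v : ℤ → ℝ) (k : ℤ) : ℝ :=
  ∑ i, modelOutput h (β i) (u i) k + v k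

/-- The residual output `ỹ_i`: the output minus the outputs of all submodels other than `i`. -/
def residualOutput (h : ℝ) (β : JointParam n m) (i : Fin K) (u : Fin K → ℤ → ℝ) (y : ℤ → ℝ)
    (k : ℤ) : ℝ :=
  y k - ∑ j ∈ Finset.univ.erase i, modelOutput h (β j) (u j) k

/-- The submodels in force while submodel `i` is updated: already updated ones come first (the
entry `i` itself is irrelevant). -/
def mixed (i : Fin K) (βnew βold : JointParam n m) : JointParam n m :=
  fun j => if j < i then βnew j else βold j

/-- A run of block coordinate descent on the `N` samples, with the inner iterations performed until
convergence: `β l` is the joint estimate at descent iteration `l`, and `θ l i s` is the `s`-th inner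
iterate for submodel `i`, with limit `β (l + 1) i`. All estimates are models (stable and coprime),
and the inverted matrices are non-singular for all large `s`. -/
structure IsRun (meth : Method) (h : ℝ) (N : ℕ) (u : Fin K → ℤ → ℝ) (y : ℤ → ℝ)
    (β : ℕ → JointParam n m) (θ : ℕ → (i : Fin K) → ℕ → Param (n i) (m i)) : Prop where
  model : ∀ l i, IsModel (β l i)
  inner_model : ∀ l i s, IsModel (θ l i s)
  inner_step : ∀ l i s, θ l i (s + 1) =
    innerStep meth h N (θ l i s) (u i) (residualOutput h (mixed i (β (l + 1)) (β l)) i u y)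
  nonsingular : ∀ l i, ∀ᶠ s in atTop,
    (normalMatrix meth h N (θ l i s) (u i)
      (residualOutput h (mixed i (β (l + 1)) (β l)) i u y)).det ≠ 0
  inner_limit : ∀ l i, Tendsto (θ l i) atTop (𝓝 (β (l + 1) i))

/-- `b` is a (stable, coprime) limit, as `l → ∞`, of a run on `N` samples. -/
def IsDescentLimit (meth : Method) (h : ℝ) (N : ℕ) (u : Fin K → ℤ → ℝ) (y : ℤ → ℝ)
    (b : JointParam n m) : Prop :=
  (∀ i, IsModel (b i)) ∧
  ∃ (β : ℕ → JointParam n m) (θ : ℕ → (i : Fin K) → ℕ → Param (n i) (m i)),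
    IsRun meth h N u y β θ ∧ Tendsto β atTop (𝓝 b)

/-- `b` is a limit, as `N → ∞`, of descent limits on `N` samples of the given data record. -/
def IsConvergingPoint (meth : Method) (h : ℝ) (u : Fin K → ℤ → ℝ) (y : ℤ → ℝ)
    (b : JointParam n m) : Prop :=
  ∃ bN : ℕ → JointParam n m,
    (∀ᶠ N in atTop, IsDescentLimit meth h N u y (bN N)) ∧ Tendsto bN atTop (𝓝 b)

/-- The expected (modified) normal matrix of submodel `i` at the true parameters `βs`. -/
def expectedNormalMatrix {Ω : Type*} [MeasurableSpace Ω] (P : Measure Ω) (meth : Method) (h : ℝ)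
    (u : Fin K → ℤ → Ω → ℝ) (v : ℤ → Ω → ℝ) (βs : JointParam n m) (i : Fin K) :
    Matrix (Fin (n i) ⊕ Fin (m i + 1)) (Fin (n i) ⊕ Fin (m i + 1)) ℝ :=
  Matrix.of fun a b => ∫ ω,
    instrument h (βs i) (fun k => u i k ω) 0 a *
      rightFactor meth h (βs i) (fun k => u i k ω)
        (residualOutput h βs i (fun j k => u j k ω)
          (output h βs (fun j k => u j k ω) fun k => v k ω)) 0 b ∂P

end Descent

end BlockDescent

end

/-! Both methods have the same fixed points. If an inner limit is inserted into its own normal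
equations, the target minus the right factor applied to the parameters is the prediction error
(`target_sub_sum_rightFactor`). Hence every limit of a descent run is a zero of the score, the
empirical mean of gradient times prediction error (`IsDescentLimit.score_eq_zero`). Conversely, a
zero of the score with nonsingular normal matrices is the limit of a constant run
(`isDescentLimit_of_score_eq_zero`). What remains is asymptotic statistics of the score and of the
quadratic loss.

Analytic framework. A stable transfer function is regarded as an element of the Banach algebra of
continuous functions on a circle in the left half-plane that encloses its poles. The output of the
sampled filter is then a continuous linear functional of this element (`filt_eq_response`), with
coefficients given by contour integrals that decay geometrically. Continuity, differentiability and
analyticity in the parameters become facts about inversion in a Banach algebra, and correlations of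
filtered inputs become continuous bilinear forms (`SignalLaw.exists_correlation`).

Uniqueness. Birkhoff's theorem with a domination argument gives locally uniform laws of large
numbers (`SignalLaw.ae_typicalPath`), so at a converging point the expected score vanishes. The
noise drops out by independence. Coprimality makes the gradient of `B / A` span all numerators of
degree at most `n + m` over `A ^ 2` (`IsModel.exists_sylvester_eq`), while the model error has
numerators of the same degrees over the products `A* A`. The vanishing score thus says that
`crossMatrix` annihilates the coefficients of the model error. The good set consists of the pairs
for which this matrix is nonsingular, and there the model equals the true one.

Genericity. The determinant of `crossMatrix` is real analytic on a connected open set, so its zeros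
form a null set once it is nonzero somewhere. A suitable point is found on the diagonal, where the
matrix is a Gram matrix, and with one multiple real pole per subsystem. There it is nonsingular
exactly when the filtered inputs are linearly independent (`SignalLaw.exists_separated`). A
polynomial with zeros `exp (h w)` turns a filtered input into a finite combination of input samples,
which persistence of excitation controls. For a common input this is combined with partial
fractions. If a subsystem is biproper and the excitation order is only twice the sum of the orders,
one sample is missing; then some subsystem has relative degree at least two, and moving the pole of
the biproper subsystem next to the pole of that one gains the missing condition.

Existence. The expected loss is the mean square of the model error plus the noise variance, so on a
small ball around the true parameters it has a unique minimum there. Minimizers of the empirical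
loss on the ball therefore converge to the true parameters, are eventually interior, and so are
zeros of the score (`TypicalPath.isConvergingPoint`). -/

noncomputable section

namespace BlockDescent

/-! ### The expansion at infinity -/

theorem coeff_zero_expansionAtInfinity (B A : ℝ[X]) :
    PowerSeries.coeff 0 (expansionAtInfinity B A) = B.coeff A.natDegree / A.leadingCoeff := by
  rw [expansionAtInfinity, PowerSeries.coeff_zero_eq_constantCoeff_apply, map_mul,
    PowerSeries.constantCoeff_inv]
  simp [coeff_reflect, div_eq_mul_inv]

/-- The numerator of `p (B / A - d)`, with `d` the value of `B / A` at infinity. -/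
def shiftNum (A B : ℝ[X]) : ℝ[X] :=
  X * (B - C (B.coeff A.natDegree / A.leadingCoeff) * A)

theorem natDegree_shiftNum_le {A B : ℝ[X]} (hA : A ≠ 0) (hB : B.natDegree ≤ A.natDegree) :
    (shiftNum A B).natDegree ≤ A.natDegree := by
  have hlc : A.leadingCoeff ≠ 0 := leadingCoeff_ne_zero.2 hA
  rw [natDegree_le_iff_coeff_eq_zero]
  intro N hN
  obtain ⟨k, rfl⟩ : ∃ k, N = k + 1 := ⟨N - 1, by omega⟩
  rw [shiftNum, coeff_X_mul, coeff_sub, coeff_C_mul]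
  rcases (show A.natDegree = k ∨ A.natDegree < k by omega) with rfl | h
  · rw [coeff_natDegree, div_mul_cancel₀ _ hlc, sub_self]
  · rw [coeff_eq_zero_of_natDegree_lt h, coeff_eq_zero_of_natDegree_lt (hB.trans_lt h)]
    simp

/-- Removing the value at infinity and multiplying by `p` shifts the series in `1 / p` by one place.
Every coefficient can therefore be reached, by induction, as a value at infinity. -/
theorem coeff_succ_expansionAtInfinity {A B : ℝ[X]} (hA : A ≠ 0)
    (hB : B.natDegree ≤ A.natDegree) (j : ℕ) :
    PowerSeries.coeff (j + 1) (expansionAtInfinity B A) =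
      PowerSeries.coeff j (expansionAtInfinity (shiftNum A B) A) := by
  set d := B.coeff A.natDegree / A.leadingCoeff with hd
  have hlc : A.leadingCoeff ≠ 0 := leadingCoeff_ne_zero.2 hA
  have key : (X : ℝ[X]) * (shiftNum A B).reflect A.natDegree =
      B.reflect A.natDegree - C d * A.reverse := by
    ext k
    have hrev : A.reverse = A.reflect A.natDegree := rfl
    rw [hrev, ← reflect_C_mul, ← reflect_sub]
    rcases k with _ | k
    · rw [coeff_X_mul_zero, coeff_reflect, revAt_zero, coeff_sub, coeff_C_mul, coeff_natDegree, hd,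
        div_mul_cancel₀ _ hlc, sub_self]
    · rw [coeff_X_mul, coeff_reflect, coeff_reflect]
      rcases lt_trichotomy k A.natDegree with h | h | h
      · rw [revAt_le h.le, revAt_le (show k + 1 ≤ _ from h), shiftNum,
          show A.natDegree - k = (A.natDegree - (k + 1)) + 1 by omega, coeff_X_mul]
      · rw [revAt_le h.le, h, Nat.sub_self, shiftNum, coeff_X_mul_zero,
          revAt_eq_self_of_lt (Nat.lt_succ_self _), coeff_sub, coeff_C_mul,
          coeff_eq_zero_of_natDegree_lt (Nat.lt_succ_self _),
          coeff_eq_zero_of_natDegree_lt (hB.trans_lt (Nat.lt_succ_self _))]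
        simp
      · rw [revAt_eq_self_of_lt h, revAt_eq_self_of_lt (h.trans (Nat.lt_succ_self _)), coeff_sub,
          coeff_C_mul, coeff_eq_zero_of_natDegree_lt (h.trans (Nat.lt_succ_self _)),
          coeff_eq_zero_of_natDegree_lt (hB.trans_lt (h.trans (Nat.lt_succ_self _))),
          coeff_eq_zero_of_natDegree_lt ((natDegree_shiftNum_le hA hB).trans_lt h)]
        simp
  have hinv : (A.reverse : PowerSeries ℝ) * (A.reverse : PowerSeries ℝ)⁻¹ = 1 := by
    apply PowerSeries.mul_inv_cancel
    simpa [← PowerSeries.coeff_zero_eq_constantCoeff_apply] using hA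
  have key' : (PowerSeries.X : PowerSeries ℝ) * expansionAtInfinity (shiftNum A B) A =
      expansionAtInfinity B A - PowerSeries.C d := by
    have := congrArg (fun P : ℝ[X] => (P : PowerSeries ℝ)) key
    simp only [coe_mul, coe_X, coe_sub, coe_C] at this
    rw [expansionAtInfinity, expansionAtInfinity, ← mul_assoc, this, sub_mul, mul_assoc, hinv,
      mul_one]
  have := congrArg (PowerSeries.coeff (j + 1)) key'
  rw [PowerSeries.coeff_succ_X_mul, map_sub, PowerSeries.coeff_C] at this
  simpa using this.symm

/-! ### Circles exhausting the left half-plane -/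

/-- The centre of the `m`-th circle. -/
def ctr (m : ℕ) : ℂ := ((-((m : ℝ) + 2) : ℝ) : ℂ)

/-- The radius of the `m`-th circle. -/
def rad (m : ℕ) : ℝ := ((m : ℝ) + 2) - 1 / ((m : ℝ) + 2)

theorem rad_pos (m : ℕ) : 0 < rad m := by
  have h2 : (2 : ℝ) ≤ (m : ℝ) + 2 := by linarith [(Nat.cast_nonneg m : (0:ℝ) ≤ m)]
  have : 1 / ((m : ℝ) + 2) ≤ 1 / 2 := one_div_le_one_div_of_le (by norm_num) h2
  unfold rad
  linarith

theorem re_le_of_mem_closedBall {m : ℕ} {z : ℂ} (hz : z ∈ Metric.closedBall (ctr m) (rad m)) :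
    z.re ≤ -(1 / ((m : ℝ) + 2)) := by
  rw [mem_closedBall_iff_norm] at hz
  have h := (Complex.abs_re_le_norm (z - ctr m)).trans hz
  have h' := (le_abs_self _).trans h
  simp only [Complex.sub_re, ctr, Complex.ofReal_re, rad] at h'
  linarith

theorem re_neg_of_mem_closedBall {m : ℕ} {z : ℂ} (hz : z ∈ Metric.closedBall (ctr m) (rad m)) :
    z.re < 0 :=
  (re_le_of_mem_closedBall hz).trans_lt (by rw [neg_lt_zero]; positivity)

theorem ne_zero_of_mem_closedBall {m : ℕ} {z : ℂ} (hz : z ∈ Metric.closedBall (ctr m) (rad m)) :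
    z ≠ 0 := by
  rintro rfl
  simpa using re_neg_of_mem_closedBall hz

/-- After squaring, membership reads `‖z‖² + 2 (m + 2) Re z < -2 + (m + 2)⁻²`, and the term with `Re
z < 0` wins for large `m`. The circles thus exhaust the half-plane while keeping a positive distance
from the imaginary axis. -/
theorem eventually_mem_ball {z : ℂ} (hz : z.re < 0) :
    ∀ᶠ m : ℕ in atTop, z ∈ Metric.ball (ctr m) (rad m) := by
  have ht : Tendsto (fun m : ℕ => (-2 * z.re) * (m : ℝ)) atTop atTop :=
    tendsto_natCast_atTop_atTop.const_mul_atTop (by linarith)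
  filter_upwards [ht.eventually_ge_atTop (‖z‖ ^ 2 + 2)] with m hm
  rw [mem_ball_iff_norm]
  have hpos : (0 : ℝ) < (m : ℝ) + 2 := by positivity
  refine lt_of_pow_lt_pow_left₀ 2 (rad_pos m).le ?_
  have e1 : ‖z - ctr m‖ ^ 2 = ‖z‖ ^ 2 + 2 * ((m : ℝ) + 2) * z.re + ((m : ℝ) + 2) ^ 2 := by
    rw [← Complex.normSq_eq_norm_sq, ← Complex.normSq_eq_norm_sq, Complex.normSq_apply,
      Complex.normSq_apply]
    simp only [Complex.sub_re, Complex.sub_im, ctr, Complex.ofReal_re, Complex.ofReal_im]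
    ring
  have e2 : rad m ^ 2 = ((m : ℝ) + 2) ^ 2 - 2 + (1 / ((m : ℝ) + 2)) ^ 2 := by
    unfold rad
    field_simp
    ring
  rw [e1, e2]
  have : 0 < (1 / ((m : ℝ) + 2)) ^ 2 := by positivity
  nlinarith

/-- All zeros of the nonzero polynomial `A` lie inside the `m`-th circle. -/
def HasZerosIn (m : ℕ) (A : ℝ[X]) : Prop :=
  A ≠ 0 ∧ ∀ z : ℂ, aeval z A = 0 → z ∈ Metric.ball (ctr m) (rad m)

theorem HasZerosIn.mul {m : ℕ} {A A' : ℝ[X]} (h : HasZerosIn m A) (h' : HasZerosIn m A') :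
    HasZerosIn m (A * A') :=
  ⟨mul_ne_zero h.1 h'.1, fun z hz => by
    rw [map_mul] at hz
    rcases mul_eq_zero.1 hz with hz | hz
    exacts [h.2 z hz, h'.2 z hz]⟩

theorem HasZerosIn.pow {m : ℕ} {A : ℝ[X]} (h : HasZerosIn m A) (k : ℕ) : HasZerosIn m (A ^ k) :=
  ⟨pow_ne_zero _ h.1, fun z hz => h.2 z (by
    rw [map_pow] at hz
    exact eq_zero_of_pow_eq_zero hz)⟩

theorem IsStable.eventually_hasZerosIn {A : ℝ[X]} (h0 : A ≠ 0) (h : IsStable A) :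
    ∀ᶠ m : ℕ in atTop, HasZerosIn m A := by
  have : ∀ᶠ m : ℕ in atTop, ∀ z ∈ (A.map (algebraMap ℝ ℂ)).roots.toFinset,
      z ∈ Metric.ball (ctr m) (rad m) := by
    rw [Filter.eventually_all_finset]
    intro z hz
    refine eventually_mem_ball (h z ?_)
    rw [Multiset.mem_toFinset, mem_roots', IsRoot, eval_map_algebraMap] at hz
    exact hz.2
  filter_upwards [this] with m hm
  refine ⟨h0, fun z hz => hm z ?_⟩
  rw [Multiset.mem_toFinset, mem_roots', IsRoot, eval_map_algebraMap]
  exact ⟨(Polynomial.map_ne_zero_iff (algebraMap ℝ ℂ).injective).2 h0, hz⟩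

/-! ### Transfer functions as elements of a Banach algebra of functions on a circle -/

/-- The continuous functions on the `m`-th circle. -/
abbrev CircleFun (m : ℕ) : Type := C(Metric.sphere (ctr m) (rad m), ℂ)

/-- The identity function of the `m`-th circle. -/
def idFun (m : ℕ) : CircleFun m := ⟨Subtype.val, continuous_subtype_val⟩

@[simp] theorem idFun_apply (m : ℕ) (z : Metric.sphere (ctr m) (rad m)) : idFun m z = z := rfl

theorem aeval_idFun_apply (m : ℕ) (A : ℝ[X]) (z : Metric.sphere (ctr m) (rad m)) :
    (aeval (idFun m) A : CircleFun m) z = aeval (z : ℂ) A := by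
  induction A using Polynomial.induction_on' with
  | add p q hp hq => simp [hp, hq]
  | monomial n a => simp [aeval_monomial, Algebra.algebraMap_eq_smul_one]

/-- The transfer function `B / A` on the `m`-th circle. -/
def transfer (m : ℕ) (B A : ℝ[X]) : CircleFun m :=
  aeval (idFun m) B * Ring.inverse (aeval (idFun m) A)

theorem HasZerosIn.ne_zero_on {m : ℕ} {A : ℝ[X]} (h : HasZerosIn m A) {z : ℂ}
    (hz : z ∈ Metric.sphere (ctr m) (rad m)) : aeval z A ≠ 0 := fun h0 => by
  have h1 := h.2 z h0
  rw [Metric.mem_ball] at h1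
  exact h1.ne hz

theorem HasZerosIn.isUnit {m : ℕ} {A : ℝ[X]} (h : HasZerosIn m A) :
    IsUnit (aeval (idFun m) A : CircleFun m) := by
  rw [ContinuousMap.isUnit_iff_forall_ne_zero]
  intro z
  rw [aeval_idFun_apply]
  exact h.ne_zero_on z.2

theorem transfer_apply {m : ℕ} {A : ℝ[X]} (hA : HasZerosIn m A) (B : ℝ[X])
    (z : Metric.sphere (ctr m) (rad m)) :
    transfer m B A z = aeval (z : ℂ) B / aeval (z : ℂ) A := by
  have h := congrArg (fun f : CircleFun m => f z) (Ring.mul_inverse_cancel _ hA.isUnit)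
  simp only [ContinuousMap.mul_apply, aeval_idFun_apply, ContinuousMap.one_apply] at h
  rw [transfer, ContinuousMap.mul_apply, aeval_idFun_apply, div_eq_mul_inv,
    eq_inv_of_mul_eq_one_right h]

/-- The contour integral `(2 π i)⁻¹ ∮ f` over the `m`-th circle. -/
def contour (m : ℕ) (f : CircleFun m) : ℂ :=
  (2 * Real.pi * Complex.I)⁻¹ * ∫ θ in (0 : ℝ)..2 * Real.pi,
    deriv (circleMap (ctr m) (rad m)) θ *
      f ⟨circleMap (ctr m) (rad m) θ, circleMap_mem_sphere _ (rad_pos m).le θ⟩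

theorem contour_eq {m : ℕ} {f : CircleFun m} {F : ℂ → ℂ}
    (h : ∀ z : Metric.sphere (ctr m) (rad m), f z = F z) :
    contour m f = (2 * Real.pi * Complex.I)⁻¹ * ∮ z in C(ctr m, rad m), F z := by
  simp only [contour, circleIntegral, h, smul_eq_mul]

theorem continuous_contour_integrand {m : ℕ} (f : CircleFun m) : Continuous fun θ : ℝ =>
    deriv (circleMap (ctr m) (rad m)) θ *
      f ⟨circleMap (ctr m) (rad m) θ, circleMap_mem_sphere _ (rad_pos m).le θ⟩ := by
  simp only [deriv_circleMap]
  have : Continuous fun θ : ℝ => (⟨circleMap (ctr m) (rad m) θ,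
      circleMap_mem_sphere _ (rad_pos m).le θ⟩ : Metric.sphere (ctr m) (rad m)) :=
    (continuous_circleMap _ _).subtype_mk _
  have h1 := continuous_circleMap 0 (rad m)
  fun_prop

theorem norm_contour_le {m : ℕ} (f : CircleFun m) : ‖contour m f‖ ≤ rad m * ‖f‖ := by
  have h := intervalIntegral.norm_integral_le_of_norm_le_const (a := (0 : ℝ)) (b := 2 * Real.pi)
    (C := rad m * ‖f‖) (f := fun θ => deriv (circleMap (ctr m) (rad m)) θ *
      f ⟨circleMap (ctr m) (rad m) θ, circleMap_mem_sphere _ (rad_pos m).le θ⟩) (by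
      intro θ _
      rw [norm_mul, deriv_circleMap]
      refine mul_le_mul (by simp [abs_of_pos (rad_pos m)]) (f.norm_coe_le_norm _) (norm_nonneg _)
        (rad_pos m).le)
  rw [contour, norm_mul]
  have hpi : ‖(2 * Real.pi * Complex.I : ℂ)⁻¹‖ = (2 * Real.pi)⁻¹ := by
    simp [abs_of_pos Real.pi_pos]
  rw [hpi]
  calc _ ≤ (2 * Real.pi)⁻¹ * (rad m * ‖f‖ * |2 * Real.pi - 0|) := by gcongr
    _ = rad m * ‖f‖ := by
      rw [sub_zero, abs_of_pos (by positivity)]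
      field_simp

/-- `contour` as a continuous linear functional. -/
def contourL (m : ℕ) : CircleFun m →L[ℂ] ℂ :=
  LinearMap.mkContinuous
    { toFun := contour m
      map_add' := fun f g => by
        simp only [contour, ContinuousMap.add_apply, mul_add]
        rw [← mul_add, intervalIntegral.integral_add]
        exacts [(continuous_contour_integrand f).intervalIntegrable _ _,
          (continuous_contour_integrand g).intervalIntegrable _ _]
      map_smul' := fun c f => by
        have : (∫ θ in (0 : ℝ)..2 * Real.pi, deriv (circleMap (ctr m) (rad m)) θ *
            (c * f ⟨circleMap (ctr m) (rad m) θ, circleMap_mem_sphere _ (rad_pos m).le θ⟩)) =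
            c * ∫ θ in (0 : ℝ)..2 * Real.pi, deriv (circleMap (ctr m) (rad m)) θ *
              f ⟨circleMap (ctr m) (rad m) θ, circleMap_mem_sphere _ (rad_pos m).le θ⟩ := by
          rw [← intervalIntegral.integral_const_mul]
          exact intervalIntegral.integral_congr fun θ _ => mul_left_comm _ _ _
        simp only [contour, ContinuousMap.smul_apply, smul_eq_mul, RingHom.id_apply]
        rw [this, mul_left_comm] }
    (rad m) norm_contour_le

@[simp] theorem contourL_apply (m : ℕ) (f : CircleFun m) : contourL m f = contour m f := rfl

theorem contour_eq_zero {m : ℕ} {f : CircleFun m} {F : ℂ → ℂ}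
    (hF : DifferentiableOn ℂ F {z | z.re < 0})
    (h : ∀ z : Metric.sphere (ctr m) (rad m), f z = F z) : contour m f = 0 := by
  have hopen : IsOpen {z : ℂ | z.re < 0} := isOpen_lt Complex.continuous_re continuous_const
  have hsub : Metric.closedBall (ctr m) (rad m) ⊆ {z : ℂ | z.re < 0} :=
    fun z hz => re_neg_of_mem_closedBall hz
  rw [contour_eq h, Complex.circleIntegral_eq_zero_of_differentiable_on_off_countable
    (rad_pos m).le Set.countable_empty (hF.continuousOn.mono hsub), mul_zero]
  exact fun z hz => hF.differentiableAt (hopen.mem_nhds (hsub (Metric.ball_subset_closedBall hz.1)))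

theorem contour_eq_value {m : ℕ} {f : CircleFun m} {F : ℂ → ℂ} {w : ℂ}
    (hw : w ∈ Metric.ball (ctr m) (rad m)) (hF : DifferentiableOn ℂ F {z | z.re < 0})
    (h : ∀ z : Metric.sphere (ctr m) (rad m), f z = F z / (z - w)) : contour m f = F w := by
  have hopen : IsOpen {z : ℂ | z.re < 0} := isOpen_lt Complex.continuous_re continuous_const
  have hsub : Metric.closedBall (ctr m) (rad m) ⊆ {z : ℂ | z.re < 0} :=
    fun z hz => re_neg_of_mem_closedBall hz
  rw [contour_eq (F := fun z => F z / (z - w)) h,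
    Complex.circleIntegral_div_sub_of_differentiable_on_off_countable Set.countable_empty hw
      (hF.continuousOn.mono hsub), ← mul_assoc, inv_mul_cancel₀, one_mul]
  · simp [Real.pi_ne_zero]
  · exact fun z hz =>
      hF.differentiableAt (hopen.mem_nhds (hsub (Metric.ball_subset_closedBall hz.1)))

/-! ### Contour integrals evaluated at infinity -/

theorem tendsto_aeval_div_aeval {A B : ℝ[X]} (hA : A ≠ 0) (hB : B.natDegree ≤ A.natDegree) :
    Tendsto (fun z : ℂ => aeval z B / aeval z A) (Bornology.cobounded ℂ)
      (𝓝 ((B.coeff A.natDegree / A.leadingCoeff : ℝ) : ℂ)) := by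
  have hlim : Tendsto (fun z : ℂ => aeval z⁻¹ (B.reflect A.natDegree) /
      aeval z⁻¹ (A.reflect A.natDegree)) (Bornology.cobounded ℂ)
      (𝓝 (aeval (0 : ℂ) (B.reflect A.natDegree) / aeval (0 : ℂ) (A.reflect A.natDegree))) := by
    have hc : ∀ P : ℝ[X], Tendsto (fun z : ℂ => aeval z⁻¹ P) (Bornology.cobounded ℂ)
        (𝓝 (aeval (0 : ℂ) P)) := fun P =>
      ((Polynomial.continuous_aeval P).tendsto 0).comp tendsto_inv₀_cobounded
    refine (hc _).div (hc _) ?_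
    simp [← coeff_zero_eq_aeval_zero', coeff_reflect, hA]
  have hval : aeval (0 : ℂ) (B.reflect A.natDegree) / aeval (0 : ℂ) (A.reflect A.natDegree) =
      ((B.coeff A.natDegree / A.leadingCoeff : ℝ) : ℂ) := by
    simp [← coeff_zero_eq_aeval_zero', coeff_reflect]
  rw [hval] at hlim
  refine hlim.congr' ?_
  have : ∀ᶠ z : ℂ in Bornology.cobounded ℂ, z ≠ 0 :=
    Bornology.eventually_ne_cobounded 0
  filter_upwards [this] with z hz
  let _ : Invertible z := invertibleOfNonzero hz
  have e : ∀ P : ℝ[X], P.natDegree ≤ A.natDegree →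
      aeval z⁻¹ (P.reflect A.natDegree) * z ^ A.natDegree = aeval z P := by
    intro P hP
    have := eval₂_reflect_mul_pow (algebraMap ℝ ℂ) z A.natDegree P hP
    rwa [invOf_eq_inv] at this
  rw [← e B hB, ← e A le_rfl, mul_div_mul_right _ _ (pow_ne_zero _ hz)]

/-- Outside the circle `F` is holomorphic, so the integrals of `F z / (z - c)` over all larger
concentric circles agree. On a distant circle `F` is uniformly close to `l`, and the constant `l`
integrates to itself. -/
theorem contour_eq_limit {m : ℕ} {f : CircleFun m} {F : ℂ → ℂ} {l : ℂ}
    (hF : ∀ z ∉ Metric.ball (ctr m) (rad m), DifferentiableAt ℂ F z)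
    (hl : Tendsto F (Bornology.cobounded ℂ) (𝓝 l))
    (h : ∀ z : Metric.sphere (ctr m) (rad m), f z = (z - ctr m)⁻¹ * F z) : contour m f = l := by
  set c := ctr m
  set r := rad m
  have hr : 0 < r := rad_pos m
  have hconst : ∀ R, r ≤ R → (∮ z in C(c, R), (z - c)⁻¹ • F z) = ∮ z in C(c, r), (z - c)⁻¹ • F z :=
    fun R hR => Complex.circleIntegral_sub_center_inv_smul_eq_of_differentiable_on_annulus_off_countable
      hr hR Set.countable_empty
      (fun z hz => (hF z hz.2).continuousAt.continuousWithinAt)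
      (fun z hz => hF z fun h => hz.1.2 (Metric.ball_subset_closedBall h))
  rw [contour_eq (F := fun z => (z - c)⁻¹ * F z) h]
  refine eq_of_forall_dist_le fun ε hε => ?_
  have hev : ∀ᶠ z in Bornology.cobounded ℂ, dist (F z) l < ε := hl (Metric.ball_mem_nhds _ hε)
  obtain ⟨R0, -, hR0⟩ := (Filter.HasBasis.eventually_iff
    (Metric.hasBasis_cobounded_compl_closedBall c)).1 hev
  set R := max r (R0 + 1)
  have hRr : r ≤ R := le_max_left _ _
  have hRpos : 0 < R := hr.trans_le hRr
  have hout : ∀ z ∈ Metric.sphere c R, dist (F z) l < ε := by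
    intro z hz
    apply hR0
    simp only [Set.mem_compl_iff, Metric.mem_closedBall, not_le]
    rw [Metric.mem_sphere] at hz
    rw [hz]
    exact (lt_add_one _).trans_le (le_max_right _ _)
  have hcont : ContinuousOn F (Metric.sphere c R) := fun z hz => (hF z (by
    rw [Metric.mem_sphere] at hz
    simp only [Metric.mem_ball, hz, not_lt]
    exact hRr)).continuousAt.continuousWithinAt
  have hinv : ContinuousOn (fun z : ℂ => (z - c)⁻¹) (Metric.sphere c R) := by
    refine ContinuousOn.inv₀ (by fun_prop) fun z hz => ?_
    rw [sub_ne_zero]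
    rintro rfl
    simp at hz
    exact hRpos.ne hz
  have hint := Complex.circleIntegral_sub_center_inv_smul_of_differentiable_on_off_countable (E := ℂ)
    (f := fun _ => l) (c := c) hRpos Set.countable_empty continuousOn_const
    (fun _ _ => differentiableAt_const _)
  have e1 : (2 * Real.pi * Complex.I)⁻¹ * (∮ z in C(c, r), (z - c)⁻¹ * F z) - l =
      (2 * Real.pi * Complex.I)⁻¹ • ∮ z in C(c, R), (z - c)⁻¹ • (F z - l) := by
    have : (∮ z in C(c, R), (z - c)⁻¹ • (F z - l)) =
        (∮ z in C(c, R), (z - c)⁻¹ • F z) - ∮ z in C(c, R), (z - c)⁻¹ • l := by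
      rw [← circleIntegral.integral_sub]
      · simp only [smul_sub]
      · exact (hinv.smul hcont).circleIntegrable hRpos.le
      · exact (hinv.smul continuousOn_const).circleIntegrable hRpos.le
    rw [this, hconst R hRr, hint]
    simp only [smul_eq_mul]
    rw [mul_sub, inv_mul_cancel_left₀ (by simp [Real.pi_ne_zero])]
  rw [dist_eq_norm, e1]
  refine (circleIntegral.norm_two_pi_i_inv_smul_integral_le_of_norm_le_const hRpos.le
    (C := ε / R) ?_).trans (by rw [mul_div_cancel₀ _ hRpos.ne'])
  intro z hz
  rw [norm_smul, norm_inv, ← dist_eq_norm, ← dist_eq_norm, Metric.mem_sphere.1 hz, div_eq_inv_mul]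
  gcongr
  exact (hout z hz).le

/-- `(z - c)⁻¹` on the `m`-th circle, with `c` its centre. -/
def ctrInv (m : ℕ) : CircleFun m :=
  ⟨fun z => ((z : ℂ) - ctr m)⁻¹, by
    refine Continuous.inv₀ (by fun_prop) fun z h => ?_
    have hz := z.2
    rw [sub_eq_zero.1 h] at hz
    simp at hz
    exact (rad_pos m).ne hz⟩

/-- `z⁻¹` on the `m`-th circle. -/
def idInv (m : ℕ) : CircleFun m :=
  ⟨fun z => (z : ℂ)⁻¹, continuous_subtype_val.inv₀ fun z =>
    ne_zero_of_mem_closedBall (Metric.sphere_subset_closedBall z.2)⟩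

/-- `exp (t z)` on the `m`-th circle. -/
def expFun (m : ℕ) (t : ℝ) : CircleFun m := NormedSpace.exp (t • idFun m)

theorem expFun_apply (m : ℕ) (t : ℝ) (z : Metric.sphere (ctr m) (rad m)) :
    expFun m t z = Complex.exp (t * z) := by
  have h := NormedSpace.map_exp (ContinuousMap.evalAlgHom ℂ ℂ z)
    (continuous_eval_const z) (t • idFun m)
  rw [Complex.exp_eq_exp_ℂ]
  simpa [expFun] using h

theorem norm_expFun_le (m : ℕ) {t : ℝ} (ht : 0 ≤ t) :
    ‖expFun m t‖ ≤ Real.exp (-(t / ((m : ℝ) + 2))) := by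
  rw [ContinuousMap.norm_le _ (Real.exp_pos _).le]
  intro z
  rw [expFun_apply, Complex.norm_exp, Real.exp_le_exp, Complex.re_ofReal_mul]
  have h := re_le_of_mem_closedBall (Metric.sphere_subset_closedBall z.2)
  have := mul_le_mul_of_nonneg_left h ht
  rwa [mul_neg, mul_one_div] at this

theorem contour_ctrInv_mul_transfer {m : ℕ} {A B : ℝ[X]} (hA : HasZerosIn m A)
    (hB : B.natDegree ≤ A.natDegree) :
    contour m (ctrInv m * transfer m B A) = ((B.coeff A.natDegree / A.leadingCoeff : ℝ) : ℂ) := by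
  refine contour_eq_limit (F := fun z => aeval z B / aeval z A) ?_
    (tendsto_aeval_div_aeval hA.1 hB) ?_
  · intro z hz
    exact (Polynomial.differentiable_aeval B).differentiableAt.div
      (Polynomial.differentiable_aeval A).differentiableAt fun h0 => hz (hA.2 z h0)
  · intro z
    rw [ContinuousMap.mul_apply, transfer_apply hA]
    rfl

/-- The value `d` at infinity contributes the polynomial `d z ^ k`, which integrates to zero. What
is left of a positive power `z ^ (k + 1)` is the transfer function with numerator `shiftNum` times
`z ^ k`, which the induction handles. -/
theorem contour_transfer_mul_pow {m : ℕ} {A : ℝ[X]} (hA : HasZerosIn m A) (k : ℕ) :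
    ∀ {B : ℝ[X]}, B.natDegree ≤ A.natDegree → contour m (transfer m B A * idFun m ^ k) =
      ((PowerSeries.coeff (k + 1) (expansionAtInfinity B A) : ℝ) : ℂ) := by
  have hpoly : ∀ (d : ℂ) (k : ℕ), contour m (d • idFun m ^ k) = 0 := fun d k =>
    contour_eq_zero (F := fun z => d * z ^ k) (by fun_prop) fun z => by simp
  induction k with
  | zero =>
    intro B hB
    set d := B.coeff A.natDegree / A.leadingCoeff
    -- The integrand is `(z - c)⁻¹` times `(z - c) (B / A - d)`. Of the latter, `z (B / A - d)`
    -- tends to the coefficient of index one, while `c (B / A - d)` tends to zero.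
    have hlim : Tendsto (fun z : ℂ => aeval z (shiftNum A B) / aeval z A -
        ctr m * (aeval z B / aeval z A - d)) (Bornology.cobounded ℂ)
        (𝓝 ((PowerSeries.coeff 1 (expansionAtInfinity B A) : ℝ) : ℂ)) := by
      have h1 := tendsto_aeval_div_aeval hA.1 (natDegree_shiftNum_le hA.1 hB)
      have h2 := tendsto_aeval_div_aeval hA.1 hB
      have := h1.sub ((h2.sub_const (d : ℂ)).const_mul (ctr m))
      rw [sub_self, mul_zero, sub_zero] at this
      rw [coeff_succ_expansionAtInfinity hA.1 hB 0, coeff_zero_expansionAtInfinity]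
      exact this
    have e : transfer m B A * idFun m ^ 0 = (transfer m B A - (d : ℂ) • idFun m ^ 0) +
        (d : ℂ) • idFun m ^ 0 := by simp
    rw [e, ← contourL_apply, map_add, contourL_apply, contourL_apply, hpoly, add_zero]
    refine contour_eq_limit ?_ hlim ?_
    · intro z hz
      have hne : aeval z A ≠ 0 := fun h0 => hz (hA.2 z h0)
      have h1 := (Polynomial.differentiable_aeval (𝕜 := ℂ) A).differentiableAt (x := z)
      have h2 := (Polynomial.differentiable_aeval (𝕜 := ℂ) B).differentiableAt (x := z)
      have h3 := (Polynomial.differentiable_aeval (𝕜 := ℂ) (shiftNum A B)).differentiableAt (x := z)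
      exact (h3.div h1 hne).sub (((h2.div h1 hne).sub_const _).const_mul _)
    · intro z
      have hne := hA.ne_zero_on z.2
      have hc : (z : ℂ) - ctr m ≠ 0 := fun h => by
        have hz := z.2
        rw [sub_eq_zero.1 h] at hz
        simp at hz
        exact (rad_pos m).ne hz
      simp only [ContinuousMap.sub_apply, transfer_apply hA, ContinuousMap.smul_apply, pow_zero,
        ContinuousMap.one_apply, shiftNum, map_mul, map_sub, aeval_X, aeval_C, smul_eq_mul, mul_one,
        Complex.coe_algebraMap]
      change _ - (d : ℂ) = _ * ((z : ℂ) * (_ - (d : ℂ) * _) / _ - _)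
      field_simp
  | succ k ih =>
    intro B hB
    set d := B.coeff A.natDegree / A.leadingCoeff
    have e : transfer m B A * idFun m ^ (k + 1) =
        transfer m (shiftNum A B) A * idFun m ^ k + (d : ℂ) • idFun m ^ (k + 1) := by
      ext z
      have hne := hA.ne_zero_on z.2
      simp only [ContinuousMap.add_apply, ContinuousMap.mul_apply, transfer_apply hA,
        ContinuousMap.smul_apply, ContinuousMap.pow_apply, shiftNum, map_mul, map_sub, aeval_X,
        aeval_C, smul_eq_mul, Complex.coe_algebraMap, idFun_apply]
      change _ = (z : ℂ) * (_ - (d : ℂ) * _) / _ * _ + _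
      field_simp
      ring
    rw [e, ← contourL_apply, map_add, contourL_apply, contourL_apply, hpoly, add_zero,
      ih (natDegree_shiftNum_le hA.1 hB), coeff_succ_expansionAtInfinity hA.1 hB (k + 1)]

/-- The exponential series converges in the Banach algebra, so the continuous functional may be
applied term by term. This is the inverse Laplace transform over a closed contour. -/
theorem contour_transfer_mul_expFun {m : ℕ} {A B : ℝ[X]} (hA : HasZerosIn m A)
    (hB : B.natDegree ≤ A.natDegree) (t : ℝ) :
    contour m (transfer m B A * expFun m t) = (impulseResponse B A t : ℂ) := by
  have h := NormedSpace.exp_series_hasSum_exp' (𝕂 := ℂ) (t • idFun m)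
  have h2 := h.mapL ((contourL m).comp (ContinuousLinearMap.mul ℂ (CircleFun m) (transfer m B A)))
  have h3 : HasSum (fun j : ℕ => ((PowerSeries.coeff (j + 1) (expansionAtInfinity B A) * t ^ j /
      (j.factorial : ℝ) : ℝ) : ℂ)) (contour m (transfer m B A * expFun m t)) := by
    have hc : ∀ j, ((contourL m).comp (ContinuousLinearMap.mul ℂ (CircleFun m) (transfer m B A)))
        ((j.factorial : ℂ)⁻¹ • (t • idFun m) ^ j) =
        ((PowerSeries.coeff (j + 1) (expansionAtInfinity B A) * t ^ j /
          (j.factorial : ℝ) : ℝ) : ℂ) := fun j => by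
      have e : transfer m B A * ((j.factorial : ℂ)⁻¹ • (t • idFun m) ^ j) =
          ((j.factorial : ℂ)⁻¹ * (t : ℂ) ^ j) • (transfer m B A * idFun m ^ j) := by
        ext z
        simp [mul_pow]
        ring
      rw [ContinuousLinearMap.comp_apply, ContinuousLinearMap.mul_apply', e, map_smul,
        contourL_apply, contour_transfer_mul_pow hA j hB, smul_eq_mul]
      push_cast
      ring
    simp only [hc] at h2
    exact h2
  rw [impulseResponse]
  have h4 := h3.tsum_eq
  rw [← Complex.ofReal_tsum] at h4
  exact h4.symm

/-- Division by `z`, harmless since the circle avoids the origin, provides a primitive in `t`. -/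
theorem hasDerivAt_contour_mul_expFun (m : ℕ) (f : CircleFun m) (t : ℝ) :
    HasDerivAt (fun t => contour m (f * idInv m * expFun m t)) (contour m (f * expFun m t)) t := by
  have h := hasDerivAt_exp_smul_const (𝕂 := ℝ) (idFun m) t
  have h2 := (((contourL m).restrictScalars ℝ).comp
    (ContinuousLinearMap.mul ℝ (CircleFun m) (f * idInv m))).hasFDerivAt.comp_hasDerivAt t h
  refine h2.congr_deriv ?_
  simp only [ContinuousLinearMap.comp_apply, ContinuousLinearMap.mul_apply',
    ContinuousLinearMap.coe_restrictScalars', contourL_apply]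
  congr 1
  ext z
  have hz : (z : ℂ) ≠ 0 := ne_zero_of_mem_closedBall (Metric.sphere_subset_closedBall z.2)
  simp only [ContinuousMap.mul_apply, idFun_apply, idInv, ContinuousMap.coe_mk, expFun]
  field_simp

/-! ### Coefficients of the sampled filters -/

/-- The kernels of the contour integrals giving the coefficients of the sampled filters. -/
def kern (m : ℕ) (h : ℝ) : ℕ → CircleFun m
  | 0 => ctrInv m
  | j + 1 => idInv m * (expFun m h - 1) * expFun m (j * h)

/-- The `j`-th coefficient of the sampled filter with transfer function `f`. -/
def coef (m : ℕ) (h : ℝ) (j : ℕ) : CircleFun m →L[ℝ] ℝ :=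
  Complex.reCLM.comp (((contourL m).restrictScalars ℝ).comp
    (ContinuousLinearMap.mul ℝ (CircleFun m) (kern m h j)))

theorem coef_apply (m : ℕ) (h : ℝ) (j : ℕ) (f : CircleFun m) :
    coef m h j f = (contour m (kern m h j * f)).re := rfl

theorem ofReal_coef_zero {m : ℕ} (h : ℝ) {A B : ℝ[X]} (hA : HasZerosIn m A)
    (hB : B.natDegree ≤ A.natDegree) :
    (coef m h 0 (transfer m B A) : ℂ) = contour m (kern m h 0 * transfer m B A) ∧
      coef m h 0 (transfer m B A) = feedthrough B A := by
  have e := contour_ctrInv_mul_transfer hA hB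
  rw [coef_apply]
  change ((contour m (ctrInv m * _)).re : ℂ) = contour m (ctrInv m * _) ∧ (contour m (ctrInv m * _)).re = _
  rw [e, Complex.ofReal_re, feedthrough, coeff_zero_expansionAtInfinity]
  exact ⟨rfl, rfl⟩

/-- The kernel `z⁻¹ (exp (h z) - 1) exp (j h z)` is the integral of `exp (s z)` over one hold
interval. The first claim records that the contour integral is real, so that the real part in `coef`
loses nothing. -/
theorem ofReal_coef_succ {m : ℕ} (h : ℝ) {A B : ℝ[X]} (hA : HasZerosIn m A)
    (hB : B.natDegree ≤ A.natDegree) (j : ℕ) :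
    (coef m h (j + 1) (transfer m B A) : ℂ) = contour m (kern m h (j + 1) * transfer m B A) ∧
      coef m h (j + 1) (transfer m B A) =
        ∫ s in (j * h : ℝ)..((j + 1 : ℕ) * h : ℝ), impulseResponse B A s := by
  have hint : ∫ s in (j * h : ℝ)..((j + 1 : ℕ) * h : ℝ), contour m (transfer m B A * expFun m s) =
      contour m (kern m h (j + 1) * transfer m B A) := by
    rw [intervalIntegral.integral_eq_sub_of_hasDerivAt
      (fun t _ => hasDerivAt_contour_mul_expFun m (transfer m B A) t)]
    · rw [← contourL_apply, ← contourL_apply, ← map_sub, contourL_apply]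
      congr 1
      ext z
      simp only [kern, ContinuousMap.sub_apply, ContinuousMap.mul_apply, ContinuousMap.one_apply,
        expFun_apply]
      have : Complex.exp (((j + 1 : ℕ) * h : ℝ) * z) =
          Complex.exp (h * z) * Complex.exp ((j * h : ℝ) * z) := by
        rw [← Complex.exp_add]
        congr 1
        push_cast
        ring
      rw [this]
      ring
    · have : Continuous fun t => contour m (transfer m B A * expFun m t) := by
        refine continuous_iff_continuousAt.2 fun t => ?_
        have h1 := (hasDerivAt_exp_smul_const (𝕂 := ℝ) (idFun m) t).continuousAt
        exact ((contourL m).continuous.continuousAt).comp (continuousAt_const.mul h1)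
      exact this.intervalIntegrable _ _
  simp only [contour_transfer_mul_expFun hA hB] at hint
  rw [intervalIntegral.integral_ofReal] at hint
  rw [coef_apply, ← hint, Complex.ofReal_re]
  exact ⟨rfl, rfl⟩

theorem ofReal_coef {m : ℕ} (h : ℝ) {A B : ℝ[X]} (hA : HasZerosIn m A)
    (hB : B.natDegree ≤ A.natDegree) (j : ℕ) :
    (coef m h j (transfer m B A) : ℂ) = contour m (kern m h j * transfer m B A) := by
  rcases j with _ | j
  exacts [(ofReal_coef_zero h hA hB).1, (ofReal_coef_succ h hA hB j).1]

/-- The decay rate per sample of the filters with poles inside the `m`-th circle. -/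
def decay (m : ℕ) (h : ℝ) : ℝ := Real.exp (-(h / ((m : ℝ) + 2)))

theorem decay_pos (m : ℕ) (h : ℝ) : 0 < decay m h := Real.exp_pos _

theorem decay_lt_one (m : ℕ) {h : ℝ} (hh : 0 < h) : decay m h < 1 := by
  rw [decay, Real.exp_lt_one_iff, neg_lt_zero]
  positivity

theorem norm_expFun_nat_mul_le (m : ℕ) {h : ℝ} (hh : 0 < h) (j : ℕ) :
    ‖expFun m (j * h)‖ ≤ decay m h ^ j := by
  refine (norm_expFun_le m (by positivity)).trans_eq ?_
  rw [decay, ← Real.exp_nat_mul]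
  congr 1
  ring

/-- On the circle `Re z ≤ -1 / (m + 2)`, so `exp (j h z)` decays geometrically, uniformly in `z`.
Dividing by `decay` in the constant compensates for the kernel of index `j + 1` carrying only the
exponent `j`. -/
theorem exists_abs_coef_le (m : ℕ) {h : ℝ} (hh : 0 < h) :
    ∃ c, 0 ≤ c ∧ ∀ j f, |coef m h j f| ≤ c * decay m h ^ j * ‖f‖ := by
  have hd := decay_pos m h
  have hr := (rad_pos m).le
  have hk : ∀ j, ‖kern m h j‖ ≤
      (‖ctrInv m‖ + ‖idInv m * (expFun m h - 1)‖ / decay m h) * decay m h ^ j := by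
    rintro (_ | j)
    · rw [pow_zero, mul_one]
      exact le_add_of_nonneg_right (by positivity)
    · calc ‖kern m h (j + 1)‖ ≤ ‖idInv m * (expFun m h - 1)‖ * ‖expFun m (j * h)‖ := norm_mul_le _ _
        _ ≤ ‖idInv m * (expFun m h - 1)‖ * decay m h ^ j := by
          gcongr
          exact norm_expFun_nat_mul_le m hh j
        _ = ‖idInv m * (expFun m h - 1)‖ / decay m h * decay m h ^ (j + 1) := by
          rw [pow_succ]
          field_simp
        _ ≤ _ := by
          gcongr
          exact le_add_of_nonneg_left (norm_nonneg _)
  refine ⟨rad m * (‖ctrInv m‖ + ‖idInv m * (expFun m h - 1)‖ / decay m h), by positivity,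
    fun j f => ?_⟩
  rw [coef_apply]
  calc |(contour m (kern m h j * f)).re| ≤ ‖contour m (kern m h j * f)‖ := Complex.abs_re_le_norm _
    _ ≤ rad m * ‖kern m h j * f‖ := norm_contour_le _
    _ ≤ rad m * (‖kern m h j‖ * ‖f‖) := by gcongr; exact norm_mul_le _ _
    _ ≤ rad m * ((‖ctrInv m‖ + ‖idInv m * (expFun m h - 1)‖ / decay m h) * decay m h ^ j * ‖f‖) := by
      gcongr
      exact hk j
    _ = _ := by ring

/-! ### Signals of subexponential growth in the past -/

/-- The signal grows subexponentially towards the past. -/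
def Subexp (w : ℤ → ℝ) : Prop :=
  ∀ σ : ℝ, 0 < σ → σ < 1 → ∀ k : ℤ, ∃ C, ∀ j : ℕ, |w (k - j)| * σ ^ j ≤ C

theorem Subexp.summable {w : ℤ → ℝ} (hw : Subexp w) {σ : ℝ} (h0 : 0 < σ) (h1 : σ < 1) (k : ℤ) :
    Summable fun j : ℕ => σ ^ j * |w (k - j)| := by
  obtain ⟨τ, hστ, hτ⟩ := exists_between h1
  obtain ⟨C, hC⟩ := hw τ (h0.trans hστ) hτ k
  have hτ0 := h0.trans hστ
  refine Summable.of_nonneg_of_le (fun j => by positivity) (fun j => ?_)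
    ((summable_geometric_of_lt_one (by positivity) ((div_lt_one hτ0).2 hστ)).mul_left C)
  calc σ ^ j * |w (k - j)| = (|w (k - j)| * τ ^ j) * (σ / τ) ^ j := by
        rw [div_pow]
        field_simp
    _ ≤ C * (σ / τ) ^ j := by gcongr; exact hC j

/-- The functional `f ↦ ∑ j, coef j f * w (k - j)`. -/
def response (m : ℕ) (h : ℝ) (w : ℤ → ℝ) (k : ℤ) : CircleFun m →L[ℝ] ℝ :=
  ∑' j : ℕ, w (k - j) • coef m h j

theorem Subexp.summable_response {m : ℕ} {h : ℝ} (hh : 0 < h) {w : ℤ → ℝ} (hw : Subexp w)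
    (k : ℤ) : Summable fun j : ℕ => w (k - j) • coef m h j := by
  obtain ⟨c, hc, hcf⟩ := exists_abs_coef_le m hh
  refine Summable.of_norm_bounded
    (((hw.summable (decay_pos m h) (decay_lt_one m hh) k)).mul_left c) fun j => ?_
  rw [norm_smul, Real.norm_eq_abs]
  have : ‖coef m h j‖ ≤ c * decay m h ^ j :=
    ContinuousLinearMap.opNorm_le_bound _ (mul_nonneg hc (pow_nonneg (decay_pos m h).le _))
      fun f => hcf j f
  calc |w (k - j)| * ‖coef m h j‖ ≤ |w (k - j)| * (c * decay m h ^ j) := by gcongr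
    _ = _ := by ring

theorem Subexp.hasSum_response {m : ℕ} {h : ℝ} (hh : 0 < h) {w : ℤ → ℝ} (hw : Subexp w)
    (k : ℤ) (f : CircleFun m) :
    HasSum (fun j : ℕ => coef m h j f * w (k - j)) (response m h w k f) := by
  have := (hw.summable_response (m := m) hh k).hasSum.mapL (ContinuousLinearMap.apply ℝ ℝ f)
  rw [BlockDescent.response]
  have e : ∀ j : ℕ, ContinuousLinearMap.apply ℝ ℝ f (w (k - j) • coef m h j) =
      coef m h j f * w (k - j) := fun j => by simp [mul_comm]
  simp only [e] at this
  exact this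

/-- With a rate `τ < 1` above both `σ` and the decay of the coefficients, the growth bound of `w` at
rate `τ` leaves the convergent series of `(decay / τ) ^ j`. -/
theorem Subexp.response {m : ℕ} {h : ℝ} (hh : 0 < h) {w : ℤ → ℝ} (hw : Subexp w)
    (f : CircleFun m) : Subexp fun k => response m h w k f := by
  intro σ h0 h1 k
  obtain ⟨τ, hστ, hτ⟩ := exists_between (max_lt h1 (decay_lt_one m hh))
  have hσ : σ < τ := (le_max_left _ _).trans_lt hστ
  have hρ : decay m h < τ := (le_max_right _ _).trans_lt hστ
  have hτ0 := h0.trans hσ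
  obtain ⟨C, hC⟩ := hw τ hτ0 hτ k
  obtain ⟨c, hc, hcf⟩ := exists_abs_coef_le m hh
  have hC0 : 0 ≤ C := le_trans (by positivity) (hC 0)
  have hg := summable_geometric_of_lt_one (div_pos (decay_pos m h) hτ0).le ((div_lt_one hτ0).2 hρ)
  refine ⟨c * ‖f‖ * C * ∑' j : ℕ, (decay m h / τ) ^ j, fun i => ?_⟩
  have hS := hw.hasSum_response (m := m) hh (k - i) f
  have hb : ∀ j : ℕ, ‖coef m h j f * w (k - i - j)‖ ≤
      (c * ‖f‖ * C * (τ ^ i)⁻¹) * (decay m h / τ) ^ j := by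
    intro j
    have h2 := hC (i + j)
    rw [show k - ((i + j : ℕ) : ℤ) = k - i - j by push_cast; ring, pow_add] at h2
    have h3 : |w (k - i - j)| ≤ C * ((τ ^ i)⁻¹ * (τ ^ j)⁻¹) := by
      rw [← mul_inv, ← div_eq_mul_inv, le_div_iff₀ (by positivity)]
      exact h2
    rw [norm_mul, Real.norm_eq_abs, Real.norm_eq_abs]
    calc _ ≤ (c * decay m h ^ j * ‖f‖) * (C * ((τ ^ i)⁻¹ * (τ ^ j)⁻¹)) :=
          mul_le_mul (hcf j f) h3 (abs_nonneg _)
            (mul_nonneg (mul_nonneg hc (pow_nonneg (decay_pos m h).le _)) (norm_nonneg _))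
      _ = _ := by rw [div_pow]; ring
  have h4 : |BlockDescent.response m h w (k - i) f| ≤
      (c * ‖f‖ * C * (τ ^ i)⁻¹) * ∑' j : ℕ, (decay m h / τ) ^ j := by
    rw [← hS.tsum_eq, ← Real.norm_eq_abs, ← tsum_mul_left]
    exact tsum_of_norm_bounded (hg.mul_left _).hasSum hb
  have hpos : 0 ≤ ∑' j : ℕ, (decay m h / τ) ^ j :=
    tsum_nonneg fun j => pow_nonneg (div_pos (decay_pos m h) hτ0).le _
  calc |BlockDescent.response m h w (k - i) f| * σ ^ i
      ≤ ((c * ‖f‖ * C * (τ ^ i)⁻¹) * ∑' j : ℕ, (decay m h / τ) ^ j) * τ ^ i := by gcongr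
    _ = _ := by field_simp

/-! ### Comparison with the continuous-time filter acting on a held signal -/

theorem floor_hold {h : ℝ} (hh : 0 < h) (k : ℤ) (j : ℕ) {s : ℝ}
    -- Looking back by `s` reverses the hold interval, so it is closed on the right here. The
    -- interval of index `j` sees the sample `j + 1` steps back.
    (hs : s ∈ Set.Ioc (j * h : ℝ) ((j + 1 : ℕ) * h : ℝ)) :
    ⌊(k * h - s) / h⌋ = k - ((j + 1 : ℕ) : ℤ) := by
  rw [Int.floor_eq_iff, sub_div, mul_div_cancel_right₀ _ hh.ne']
  have h1 := (lt_div_iff₀ hh).2 hs.1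
  have h2 := (div_le_iff₀ hh).2 hs.2
  push_cast at *
  constructor <;> linarith

theorem iUnion_Ioc_nat_mul {h : ℝ} (hh : 0 < h) :
    ⋃ j : ℕ, Set.Ioc (j * h : ℝ) ((j + 1 : ℕ) * h : ℝ) = Set.Ioi 0 := by
  ext s
  simp only [Set.mem_iUnion, Set.mem_Ioc, Set.mem_Ioi]
  constructor
  · rintro ⟨j, h1, -⟩
    exact lt_of_le_of_lt (by positivity) h1
  · intro hs
    have h1 : 0 < ⌈s / h⌉₊ := Nat.ceil_pos.2 (div_pos hs hh)
    refine ⟨⌈s / h⌉₊ - 1, ?_, ?_⟩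
    · rw [← lt_div_iff₀ hh]
      exact Nat.lt_ceil.1 (Nat.sub_one_lt h1.ne')
    · rw [Nat.sub_one_add_one h1.ne', ← div_le_iff₀ hh]
      exact Nat.le_ceil _

theorem continuous_impulseResponse {m : ℕ} {A B : ℝ[X]} (hA : HasZerosIn m A)
    (hB : B.natDegree ≤ A.natDegree) : Continuous (impulseResponse B A) := by
  have h1 : Continuous fun t => (contour m (transfer m B A * expFun m t)).re := by
    refine Complex.continuous_re.comp (continuous_iff_continuousAt.2 fun t => ?_)
    have h1 := (hasDerivAt_exp_smul_const (𝕂 := ℝ) (idFun m) t).continuousAt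
    exact ((contourL m).continuous.continuousAt).comp (continuousAt_const.mul h1)
  refine h1.congr fun t => ?_
  rw [contour_transfer_mul_expFun hA hB, Complex.ofReal_re]

theorem abs_impulseResponse_le {m : ℕ} {A B : ℝ[X]} (hA : HasZerosIn m A)
    (hB : B.natDegree ≤ A.natDegree) {h : ℝ} (hh : 0 < h) (j : ℕ) {s : ℝ} (hs : j * h ≤ s) :
    |impulseResponse B A s| ≤ rad m * ‖transfer m B A‖ * decay m h ^ j := by
  rw [← Real.norm_eq_abs, ← Complex.norm_real, ← contour_transfer_mul_expFun hA hB]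
  calc _ ≤ rad m * ‖transfer m B A * expFun m s‖ := norm_contour_le _
    _ ≤ rad m * (‖transfer m B A‖ * ‖expFun m s‖) := by
      gcongr
      exacts [(rad_pos m).le, norm_mul_le _ _]
    _ ≤ rad m * (‖transfer m B A‖ * decay m h ^ j) := by
      have := rad_pos m
      gcongr
      refine (norm_expFun_le m (le_trans (by positivity) hs)).trans ?_
      rw [decay, ← Real.exp_nat_mul, Real.exp_le_exp, mul_neg, neg_le_neg_iff, ← mul_div_assoc]
      gcongr
    _ = _ := by ring

/-- The half-line is cut into hold intervals, on each of which the held signal is constant and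
factors out of the integral. Since the right side is continuous and linear in the transfer function,
this identity carries every later argument about dependence on parameters. -/
theorem filt_eq_response {m : ℕ} {A B : ℝ[X]} (hA : HasZerosIn m A)
    (hB : B.natDegree ≤ A.natDegree) {h : ℝ} (hh : 0 < h) {w : ℤ → ℝ} (hw : Subexp w) (k : ℤ) :
    filt h B A w k = response m h w k (transfer m B A) := by
  have hS := hw.hasSum_response (m := m) hh k (transfer m B A)
  have hg := continuous_impulseResponse hA hB
  have hpiece : ∀ j : ℕ, ∀ s ∈ Set.Ioc (j * h : ℝ) ((j + 1 : ℕ) * h : ℝ),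
      impulseResponse B A s * hold h w (k * h - s) =
        impulseResponse B A s * w (k - (j + 1 : ℕ)) := by
    intro j s hs
    rw [hold, floor_hold hh k j hs]
  have hle : ∀ j : ℕ, (j * h : ℝ) ≤ ((j + 1 : ℕ) * h : ℝ) := fun j => by gcongr; simp
  have hint : ∀ j : ℕ, ∫ s in Set.Ioc (j * h : ℝ) ((j + 1 : ℕ) * h : ℝ),
      impulseResponse B A s * hold h w (k * h - s) =
        coef m h (j + 1) (transfer m B A) * w (k - (j + 1 : ℕ)) := by
    intro j
    rw [setIntegral_congr_fun measurableSet_Ioc (hpiece j), integral_mul_const,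
      ← intervalIntegral.integral_of_le (hle j), (ofReal_coef_succ h hA hB j).2]
  have hion : ∀ j : ℕ, IntegrableOn (fun s => impulseResponse B A s * hold h w (k * h - s))
      (Set.Ioc (j * h : ℝ) ((j + 1 : ℕ) * h : ℝ)) := by
    intro j
    rw [integrableOn_congr_fun (hpiece j) measurableSet_Ioc]
    exact ((hg.integrableOn_Icc).mono_set Set.Ioc_subset_Icc_self).mul_const _
  have hsum : Summable fun j : ℕ => ∫ s in Set.Ioc (j * h : ℝ) ((j + 1 : ℕ) * h : ℝ),
      ‖impulseResponse B A s * hold h w (k * h - s)‖ := by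
    have h1 := (summable_nat_add_iff 1).2 (hw.summable (decay_pos m h) (decay_lt_one m hh) k)
    refine Summable.of_nonneg_of_le (fun j => by positivity) (fun j => ?_)
      (h1.mul_left (rad m * ‖transfer m B A‖ / decay m h * h))
    have hb : ∀ s ∈ Set.Ioc (j * h : ℝ) ((j + 1 : ℕ) * h : ℝ),
        ‖‖impulseResponse B A s * hold h w (k * h - s)‖‖ ≤
          rad m * ‖transfer m B A‖ * decay m h ^ j * |w (k - (j + 1 : ℕ))| := by
      intro s hs
      rw [norm_norm, hpiece j s hs, norm_mul, Real.norm_eq_abs, Real.norm_eq_abs]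
      gcongr
      exact abs_impulseResponse_le hA hB hh j hs.1.le
    have h2 := norm_setIntegral_le_of_norm_le_const (μ := volume) (by simp) hb
    refine (le_abs_self _).trans ((Real.norm_eq_abs _).symm.le.trans (h2.trans_eq ?_))
    have h3 : volume.real (Set.Ioc (j * h : ℝ) ((j + 1 : ℕ) * h : ℝ)) = h := by
      rw [Real.volume_real_Ioc_of_le (hle j)]
      push_cast
      ring
    rw [h3, pow_succ]
    have := (decay_pos m h).ne'
    field_simp
  have hdisj : Pairwise fun i j : ℕ => Disjoint (Set.Ioc (i * h : ℝ) ((i + 1 : ℕ) * h : ℝ))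
      (Set.Ioc (j * h : ℝ) ((j + 1 : ℕ) * h : ℝ)) := by
    have hmono : Monotone fun j : ℕ => (j * h : ℝ) := fun i j hij => by
      dsimp only
      gcongr
    exact hmono.pairwise_disjoint_on_Ioc_succ
  have hall := hasSum_integral_iUnion (fun j => measurableSet_Ioc) hdisj
    (integrableOn_iUnion_of_summable_integral_norm hion hsum)
  rw [iUnion_Ioc_nat_mul hh] at hall
  simp only [hint] at hall
  -- The term of index zero is the feedthrough; only the remaining terms come from the impulse
  -- response.
  have htail := (hasSum_nat_add_iff' 1).2 hS
  have htot := htail.unique hall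
  rw [Finset.sum_range_one, (ofReal_coef_zero h hA hB).2, Nat.cast_zero, sub_zero] at htot
  rw [filt, filterCT, ← htot, hold, mul_div_cancel_right₀ _ hh.ne', Int.floor_intCast]
  ring

/-! ### The pointwise ergodic theorem -/

section Ergodic

variable {X : Type*} {T : X → X}

/-- The maximum of the first `n` Birkhoff sums and zero. -/
def maxBirkhoff (T : X → X) (f : X → ℝ) : ℕ → X → ℝ
  | 0 => fun _ => 0
  | n + 1 => fun x => max 0 (f x + maxBirkhoff T f n (T x))

theorem maxBirkhoff_nonneg (f : X → ℝ) : ∀ n x, 0 ≤ maxBirkhoff T f n x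
  | 0, _ => le_rfl
  | _ + 1, _ => le_max_left _ _

theorem maxBirkhoff_le_succ (f : X → ℝ) : ∀ n x, maxBirkhoff T f n x ≤ maxBirkhoff T f (n + 1) x
  | 0, _ => le_max_left _ _
  | n + 1, x => max_le_max le_rfl (add_le_add_right (maxBirkhoff_le_succ f n (T x)) _)

theorem birkhoffSum_le_maxBirkhoff (f : X → ℝ) :
    ∀ n x, birkhoffSum T f n x ≤ maxBirkhoff T f n x
  | 0, _ => by simp [maxBirkhoff]
  | n + 1, x => by
    rw [birkhoffSum_succ']
    exact (add_le_add_right (birkhoffSum_le_maxBirkhoff f n (T x)) _).trans (le_max_right _ _)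

variable [MeasurableSpace X] {μ : Measure X}

theorem integral_comp_measurePreserving (hT : MeasurePreserving T μ μ) {f : X → ℝ}
    (hf : AEStronglyMeasurable f μ) : ∫ x, f (T x) ∂μ = ∫ x, f x ∂μ := by
  have h := integral_map (f := f) hT.measurable.aemeasurable (by rwa [hT.map_eq])
  rw [hT.map_eq] at h
  exact h.symm

theorem integrable_maxBirkhoff (hT : MeasurePreserving T μ μ) {f : X → ℝ} (hf : Integrable f μ) :
    ∀ n, Integrable (maxBirkhoff T f n) μ
  | 0 => integrable_zero _ _ _
  | n + 1 => (integrable_zero _ _ _).sup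
      (hf.add (hT.integrable_comp_of_integrable (integrable_maxBirkhoff hT hf n)))

theorem measurable_maxBirkhoff (hT : Measurable T) {f : X → ℝ} (hf : Measurable f) :
    ∀ n, Measurable (maxBirkhoff T f n)
  | 0 => measurable_const
  | n + 1 => measurable_const.max (hf.add ((measurable_maxBirkhoff hT hf n).comp hT))

/-- Garsia's argument: where the maximum `M` is positive, `f ≥ M - M ∘ T`; elsewhere `M = 0 ≤ M ∘
T`. The function `M - M ∘ T` has integral zero because `T` preserves the measure. -/
theorem setIntegral_maxBirkhoff_nonneg (hT : MeasurePreserving T μ μ) {f : X → ℝ}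
    (hfm : Measurable f) (hf : Integrable f μ) (n : ℕ) :
    0 ≤ ∫ x, {x | 0 < maxBirkhoff T f n x}.indicator f x ∂μ := by
  have hM := integrable_maxBirkhoff hT hf n
  have hMT := hT.integrable_comp_of_integrable hM
  have hs : MeasurableSet {x | 0 < maxBirkhoff T f n x} :=
    measurableSet_lt measurable_const (measurable_maxBirkhoff hT.measurable hfm n)
  have h0 : ∫ x, (maxBirkhoff T f n x - maxBirkhoff T f n (T x)) ∂μ = 0 := by
    have h1 := integral_sub hM hMT
    simp only [Function.comp_apply] at h1
    rw [h1, integral_comp_measurePreserving hT hM.aestronglyMeasurable, sub_self]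
  refine h0.symm.le.trans ?_
  refine integral_mono (hM.sub hMT) (hf.indicator hs) fun x => ?_
  by_cases hx : 0 < maxBirkhoff T f n x
  · rw [Set.indicator_of_mem (show x ∈ {x | 0 < maxBirkhoff T f n x} from hx)]
    rcases n with _ | n
    · simp [maxBirkhoff] at hx
    · have h1 : maxBirkhoff T f (n + 1) x = f x + maxBirkhoff T f n (T x) := by
        rcases max_choice 0 (f x + maxBirkhoff T f n (T x)) with h | h
        · exact absurd h hx.ne'
        · exact h
      have h2 := maxBirkhoff_le_succ (T := T) f n (T x)
      linarith
  · rw [Set.indicator_of_notMem (show x ∉ {x | 0 < maxBirkhoff T f n x} from hx)]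
    have h1 := maxBirkhoff_nonneg (T := T) f n (T x)
    linarith

/-- If the Birkhoff sums are unbounded above, almost every point eventually lies in the sets where
the maximum is positive, and the maximal inequality passes to the limit by dominated convergence. -/
theorem integral_nonneg_of_ae_not_bddAbove (hT : MeasurePreserving T μ μ) {f : X → ℝ}
    (hfm : Measurable f) (hf : Integrable f μ)
    (h : ∀ᵐ x ∂μ, ¬ BddAbove (Set.range fun n => birkhoffSum T f n x)) : 0 ≤ ∫ x, f x ∂μ := by
  have hlim : Tendsto (fun n => ∫ x, {x | 0 < maxBirkhoff T f n x}.indicator f x ∂μ) atTop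
      (𝓝 (∫ x, f x ∂μ)) := by
    refine tendsto_integral_of_dominated_convergence (fun x => ‖f x‖) (fun n => ?_) hf.norm
      (fun n => Eventually.of_forall fun x => norm_indicator_le_norm_self _ _) ?_
    · exact (hf.indicator (measurableSet_lt measurable_const
        (measurable_maxBirkhoff hT.measurable hfm n))).aestronglyMeasurable
    · filter_upwards [h] with x hx
      obtain ⟨n, hn⟩ : ∃ n, 0 < birkhoffSum T f n x := by
        by_contra! hcon
        exact hx ⟨0, by rintro _ ⟨n, rfl⟩; exact hcon n⟩
      refine tendsto_const_nhds.congr' ?_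
      filter_upwards [eventually_ge_atTop n] with k hk
      have : 0 < maxBirkhoff T f k x := hn.trans_le ((birkhoffSum_le_maxBirkhoff f n x).trans
        (monotone_nat_of_le_succ (fun n => maxBirkhoff_le_succ f n x) hk))
      rw [Set.indicator_of_mem (show x ∈ {x | 0 < maxBirkhoff T f k x} from this)]
  exact ge_of_tendsto' hlim fun n => setIntegral_maxBirkhoff_nonneg hT hfm hf n

/-- Boundedness of the sums is invariant under `T`, so by ergodicity it holds almost everywhere or
almost nowhere. The second case contradicts the negative integral. -/
theorem ae_bddAbove_birkhoffSum (hT : Ergodic T μ) {f : X → ℝ}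
    (hfm : Measurable f) (hf : Integrable f μ) (hneg : ∫ x, f x ∂μ < 0) :
    ∀ᵐ x ∂μ, BddAbove (Set.range fun n => birkhoffSum T f n x) := by
  set s : Set X := {x | BddAbove (Set.range fun n => birkhoffSum T f n x)}
  have hsm : MeasurableSet s := by
    have : s = ⋃ C : ℕ, ⋂ n : ℕ, {x | birkhoffSum T f n x ≤ C} := by
      ext x
      simp only [s, Set.mem_ofPred_eq, Set.mem_iUnion, Set.mem_iInter]
      constructor
      · rintro ⟨C, hC⟩
        obtain ⟨n, hn⟩ := exists_nat_ge C
        exact ⟨n, fun k => (hC ⟨k, rfl⟩).trans hn⟩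
      · rintro ⟨C, hC⟩
        exact ⟨C, by rintro _ ⟨k, rfl⟩; exact hC k⟩
    rw [this]
    refine MeasurableSet.iUnion fun C => MeasurableSet.iInter fun n =>
      measurableSet_le ?_ measurable_const
    unfold birkhoffSum
    exact Finset.measurable_fun_sum _ fun k _ => hfm.comp (hT.measurable.iterate k)
  have hinv : T ⁻¹' s = s := by
    ext x
    simp only [s, Set.mem_preimage, Set.mem_ofPred_eq]
    constructor
    · rintro ⟨C, hC⟩
      refine ⟨max 0 (f x + C), ?_⟩
      rintro _ ⟨n, rfl⟩
      rcases n with _ | n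
      · simp
      · dsimp only
        rw [birkhoffSum_succ']
        exact (add_le_add_right (hC ⟨n, rfl⟩) _).trans (le_max_right _ _)
    · rintro ⟨C, hC⟩
      refine ⟨C - f x, ?_⟩
      rintro _ ⟨n, rfl⟩
      have := hC ⟨n + 1, rfl⟩
      dsimp only at this ⊢
      rw [birkhoffSum_succ'] at this
      linarith
  rcases hT.toPreErgodic.ae_mem_or_ae_notMem hsm hinv with h | h
  · exact h
  · exact absurd (integral_nonneg_of_ae_not_bddAbove hT.toMeasurePreserving hfm hf h) hneg.not_ge

theorem ae_eventually_birkhoffSum_le (hT : Ergodic T μ) [IsProbabilityMeasure μ] {f : X → ℝ}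
    (hfm : Measurable f) (hf : Integrable f μ) :
    ∀ᵐ x ∂μ, ∀ ε > 0, ∀ᶠ n : ℕ in atTop, (1 / (n : ℝ)) * birkhoffSum T f n x ≤ ∫ y, f y ∂μ + ε := by
  -- Lowering `f` by slightly more than its mean makes the integral negative. The bounded sums then
  -- contribute nothing after division by `n`, and countably many levels suffice.
  have h : ∀ k : ℕ, ∀ᵐ x ∂μ, BddAbove (Set.range fun n =>
      birkhoffSum T (fun x => f x - (∫ y, f y ∂μ + 1 / ((k : ℝ) + 1))) n x) := fun k => by
    refine ae_bddAbove_birkhoffSum hT (hfm.sub_const _) (hf.sub (integrable_const _)) ?_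
    rw [integral_sub hf (integrable_const _), integral_const, probReal_univ, one_smul]
    have : (0 : ℝ) < 1 / ((k : ℝ) + 1) := by positivity
    linarith
  filter_upwards [ae_all_iff.2 h] with x hx ε hε
  obtain ⟨k, hk⟩ := exists_nat_one_div_lt (half_pos hε)
  obtain ⟨C, hC⟩ := hx k
  obtain ⟨n0, hn0⟩ := exists_nat_gt (2 * C / ε)
  filter_upwards [eventually_ge_atTop n0, eventually_gt_atTop 0] with n hn hpos
  have hpos' : (0 : ℝ) < n := by exact_mod_cast hpos
  have h1 := hC ⟨n, rfl⟩
  simp only [birkhoffSum, Finset.sum_sub_distrib, Finset.sum_const, Finset.card_range,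
    nsmul_eq_mul] at h1
  have h2 : 2 * C / ε < n := hn0.trans_le (by exact_mod_cast hn)
  rw [div_lt_iff₀ hε] at h2
  rw [one_div, inv_mul_le_iff₀ hpos', birkhoffSum]
  nlinarith

theorem ae_tendsto_birkhoffAverage (hT : Ergodic T μ) [IsProbabilityMeasure μ] {f : X → ℝ}
    (hf : Integrable f μ) :
    ∀ᵐ x ∂μ, Tendsto (fun n : ℕ => (1 / (n : ℝ)) * ∑ k ∈ Finset.range n, f (T^[k] x)) atTop
      (𝓝 (∫ y, f y ∂μ)) := by
  obtain ⟨g, hgm, hfg⟩ := hf.aestronglyMeasurable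
  have hgm' := hgm.measurable
  have hg : Integrable g μ := hf.congr hfg
  have hcomp : ∀ᵐ x ∂μ, ∀ k : ℕ, f (T^[k] x) = g (T^[k] x) := ae_all_iff.2 fun k =>
    (hT.toMeasurePreserving.iterate k).quasiMeasurePreserving.ae hfg
  have hu := ae_eventually_birkhoffSum_le hT hgm' hg
  have hl := ae_eventually_birkhoffSum_le hT hgm'.neg hg.neg
  filter_upwards [hcomp, hu, hl] with x hx hu hl
  simp only [hx, integral_congr_ae hfg]
  rw [Metric.tendsto_nhds]
  intro ε hε
  filter_upwards [hu (ε / 2) (half_pos hε), hl (ε / 2) (half_pos hε)] with n h1 h2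
  simp only [birkhoffSum, Pi.neg_apply, Finset.sum_neg_distrib, mul_neg, integral_neg] at h1 h2
  rw [Real.dist_eq, abs_lt]
  constructor <;> linarith

/-- A uniform law of large numbers: local Lipschitz-type domination of the summands turns pointwise
convergence of the averages into locally uniform convergence. -/
theorem ae_eventually_average_near (hT : Ergodic T μ) [IsProbabilityMeasure μ] {Θ : Type*}
    [TopologicalSpace Θ] [TopologicalSpace.SeparableSpace Θ] {F : Θ → X → ℝ} {Z : X → ℝ}
    {ω : Θ × Θ → ℝ} (hω : Continuous ω) (hω0 : ∀ θ, ω (θ, θ) = 0)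
    (hF : ∀ θ, Integrable (F θ) μ) (hZ : Integrable Z μ)
    (hFZ : ∀ᵐ x ∂μ, ∀ θ θ', |F θ x - F θ' x| ≤ ω (θ, θ') * Z x) (hZ0 : ∀ x, 0 ≤ Z x) :
    ∀ᵐ x ∂μ, ∀ θ₀, ∀ ε > 0, ∃ U ∈ 𝓝 θ₀, ∀ᶠ n : ℕ in atTop, ∀ θ ∈ U,
      |(1 / (n : ℝ)) * ∑ k ∈ Finset.range n, F θ (T^[k] x) - ∫ y, F θ₀ y ∂μ| < ε := by
  obtain ⟨D, hDc, hDd⟩ := TopologicalSpace.exists_countable_dense Θ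
  have hD : ∀ᵐ x ∂μ, ∀ d ∈ D, Tendsto (fun n : ℕ => (1 / (n : ℝ)) *
      ∑ k ∈ Finset.range n, F d (T^[k] x)) atTop (𝓝 (∫ y, F d y ∂μ)) :=
    (ae_ball_iff hDc).2 fun d _ => ae_tendsto_birkhoffAverage hT (hF d)
  have hdom : ∀ᵐ x ∂μ, ∀ k : ℕ, ∀ θ θ',
      |F θ (T^[k] x) - F θ' (T^[k] x)| ≤ ω (θ, θ') * Z (T^[k] x) := ae_all_iff.2 fun k =>
    (hT.toMeasurePreserving.iterate k).quasiMeasurePreserving.ae hFZ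
  filter_upwards [hD, hdom, ae_tendsto_birkhoffAverage hT hZ] with x hxD hxdom hxZ θ₀ ε hε
  have hI : 0 ≤ ∫ y, Z y ∂μ := integral_nonneg hZ0
  -- The averages of `Z` are eventually below `c`. On a neighbourhood where `ω < ε / (4 c)`,
  -- comparison with a point `d` of the dense set gives three errors of at most `ε / 4`: of the
  -- averages, of the ergodic limit at `d`, and of the integrals.
  set c := ∫ y, Z y ∂μ + 1
  have hc : 0 < c := by positivity
  have hδ : 0 < ε / (4 * c) := by positivity
  have hev : ∀ᶠ p : Θ × Θ in 𝓝 (θ₀, θ₀), ω p < ε / (4 * c) := by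
    have := hω.tendsto (θ₀, θ₀)
    rw [hω0] at this
    exact this.eventually_lt_const hδ
  rw [nhds_prod_eq] at hev
  obtain ⟨U, hU, hUω⟩ := (Filter.eventually_prod_self_iff
    (r := fun θ θ' => ω (θ, θ') < ε / (4 * c))).1 hev
  obtain ⟨d, hdD, hdU⟩ := hDd.inter_nhds_nonempty hU
  refine ⟨U, hU, ?_⟩
  have h1 : ∀ᶠ n : ℕ in atTop, (1 / (n : ℝ)) * ∑ k ∈ Finset.range n, Z (T^[k] x) < c :=
    hxZ.eventually_lt_const (lt_add_one _)
  have h2 : ∀ᶠ n : ℕ in atTop, |(1 / (n : ℝ)) * ∑ k ∈ Finset.range n, F d (T^[k] x) -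
      ∫ y, F d y ∂μ| < ε / 4 := by
    have := (Metric.tendsto_nhds.1 (hxD d hdD)) (ε / 4) (by positivity)
    simpa only [Real.dist_eq] using this
  have h3 : |∫ y, F d y ∂μ - ∫ y, F θ₀ y ∂μ| ≤ ε / 4 := by
    rw [← integral_sub (hF d) (hF θ₀)]
    calc |∫ y, (F d y - F θ₀ y) ∂μ| ≤ ∫ y, |F d y - F θ₀ y| ∂μ := abs_integral_le_integral_abs
      _ ≤ ∫ y, (ε / (4 * c)) * Z y ∂μ := by
        refine integral_mono_ae ((hF d).sub (hF θ₀)).abs (hZ.const_mul _) ?_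
        filter_upwards [hFZ] with y hy
        exact (hy d θ₀).trans (mul_le_mul_of_nonneg_right
          (hUω d hdU θ₀ (mem_of_mem_nhds hU)).le (hZ0 y))
      _ = ε / (4 * c) * ∫ y, Z y ∂μ := integral_const_mul _ _
      _ ≤ ε / (4 * c) * c := by
        gcongr
        exact (lt_add_one _).le
      _ = ε / 4 := by field_simp
  filter_upwards [h1, h2] with n h1 h2 θ hθ
  have h4 : |(1 / (n : ℝ)) * ∑ k ∈ Finset.range n, F θ (T^[k] x) -
      (1 / (n : ℝ)) * ∑ k ∈ Finset.range n, F d (T^[k] x)| ≤ ε / 4 := by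
    rw [← mul_sub, ← Finset.sum_sub_distrib, abs_mul, abs_of_nonneg (by positivity)]
    calc _ ≤ 1 / (n : ℝ) * ∑ k ∈ Finset.range n, ε / (4 * c) * Z (T^[k] x) := by
          gcongr
          refine (Finset.abs_sum_le_sum_abs _ _).trans (Finset.sum_le_sum fun k _ => ?_)
          exact (hxdom k θ d).trans (mul_le_mul_of_nonneg_right (hUω θ hθ d hdU).le (hZ0 _))
      _ = ε / (4 * c) * (1 / (n : ℝ) * ∑ k ∈ Finset.range n, Z (T^[k] x)) := by
          rw [← Finset.mul_sum]
          ring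
      _ ≤ ε / (4 * c) * c := by gcongr
      _ = ε / 4 := by field_simp
  rw [abs_lt] at h2 ⊢
  rw [abs_le] at h3 h4
  constructor <;> linarith [h2.1, h2.2, h3.1, h3.2, h4.1, h4.2]

end Ergodic

/-! ### Stationary path space -/

/-- Sample paths of `K` inputs and one disturbance. -/
abbrev PathSpace (K : ℕ) : Type := ℤ → (Fin K → ℝ) × ℝ

/-- The time shift by `k`. -/
def shift {K : ℕ} (k : ℤ) (x : PathSpace K) : PathSpace K := fun l => x (l + k)

section Shift

variable {K : ℕ}

theorem measurable_shift (k : ℤ) : Measurable (shift (K := K) k) :=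
  measurable_pi_lambda _ fun l => measurable_pi_apply (l + k)

theorem shift_shift (k l : ℤ) (x : PathSpace K) : shift k (shift l x) = shift (k + l) x := by
  funext i
  simp only [shift]
  congr 1
  ring

@[simp] theorem shift_zero (x : PathSpace K) : shift 0 x = x := by
  funext i
  simp [shift]

theorem iterate_shift_one (n : ℕ) (x : PathSpace K) : (shift 1)^[n] x = shift n x := by
  induction n with
  | zero => simp
  | succ n ih =>
    rw [Function.iterate_succ_apply', ih, shift_shift]
    congr 1
    push_cast
    ring

variable {μ : Measure (PathSpace K)}

theorem measurePreserving_shift (hμ : Ergodic (shift (K := K) 1) μ) (k : ℤ) :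
    MeasurePreserving (shift k) μ μ := by
  have hnat : ∀ n : ℕ, MeasurePreserving (shift (K := K) n) μ μ := fun n => by
    have h := hμ.toMeasurePreserving.iterate n
    have e : (shift (K := K) 1)^[n] = shift (n : ℤ) := funext fun x => iterate_shift_one n x
    rwa [e] at h
  obtain ⟨n, rfl | rfl⟩ := k.eq_nat_or_neg
  · exact hnat n
  · refine ⟨measurable_shift _, ?_⟩
    have h := (hnat n).map_eq
    conv_lhs => rw [← h]
    rw [Measure.map_map (measurable_shift _) (measurable_shift _)]
    have e : shift (K := K) (-(n : ℤ)) ∘ shift (n : ℤ) = id := funext fun x => by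
      rw [Function.comp_apply, shift_shift, neg_add_cancel, shift_zero, id]
    rw [e, Measure.map_id]

theorem ae_forall_shift (hμ : Ergodic (shift (K := K) 1) μ) {p : PathSpace K → Prop}
    (h : ∀ᵐ x ∂μ, p x) : ∀ᵐ x ∂μ, ∀ k : ℤ, p (shift k x) :=
  ae_all_iff.2 fun k => (measurePreserving_shift hμ k).quasiMeasurePreserving.ae h

/-- By the Cauchy–Schwarz inequality the square of the weighted sum is at most `(1 - ρ)⁻¹` times the
weighted sum of squares, whose expectation is finite by stationarity. The bound `Z'` is the square
root of this quantity. -/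
theorem exists_memLp_tsum_le (hμ : Ergodic (shift (K := K) 1) μ) {Z : PathSpace K → ℝ}
    (hZ0 : ∀ x, 0 ≤ Z x) (hZ : MemLp Z 2 μ) {ρ : ℝ} (h0 : 0 < ρ) (h1 : ρ < 1) :
    ∃ Z' : PathSpace K → ℝ, (∀ x, 0 ≤ Z' x) ∧ MemLp Z' 2 μ ∧ ∀ᵐ x ∂μ,
      Summable (fun j : ℕ => ρ ^ j * Z (shift (-j) x)) ∧
        ∑' j : ℕ, ρ ^ j * Z (shift (-j) x) ≤ Z' x := by
  have hsq : Integrable (fun x => Z x ^ 2) μ := hZ.integrable_sq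
  have hsqj : ∀ j : ℕ, Integrable (fun x => ρ ^ j * Z (shift (-j) x) ^ 2) μ := fun j =>
    ((measurePreserving_shift hμ (-j)).integrable_comp_of_integrable hsq).const_mul _
  have hnn : ∀ (j : ℕ) x, 0 ≤ ρ ^ j * Z (shift (-j) x) ^ 2 := fun j x => by positivity
  -- Extended values let Tonelli's theorem give the integral before convergence is known.
  set G : PathSpace K → ENNReal := fun x =>
    ∑' j : ℕ, ENNReal.ofReal (ρ ^ j * Z (shift (-j) x) ^ 2)
  have hGm : AEMeasurable G μ :=
    AEMeasurable.tsum fun j => (hsqj j).aemeasurable.ennreal_ofReal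
  have hGfin : ∫⁻ x, G x ∂μ ≠ ⊤ := by
    rw [lintegral_tsum fun j => (hsqj j).aemeasurable.ennreal_ofReal]
    have e : ∀ j : ℕ, ∫⁻ x, ENNReal.ofReal (ρ ^ j * Z (shift (-j) x) ^ 2) ∂μ =
        ENNReal.ofReal (ρ ^ j * ∫ x, Z x ^ 2 ∂μ) := fun j => by
      rw [← ofReal_integral_eq_lintegral_ofReal (hsqj j) (Eventually.of_forall (hnn j)),
        integral_const_mul]
      congr 2
      exact integral_comp_measurePreserving (measurePreserving_shift hμ (-j))
        hsq.aestronglyMeasurable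
    simp only [e]
    rw [← ENNReal.ofReal_tsum_of_nonneg]
    · exact ENNReal.ofReal_ne_top
    · exact fun j => mul_nonneg (pow_nonneg h0.le _) (integral_nonneg fun x => sq_nonneg _)
    · exact (summable_geometric_of_lt_one h0.le h1).mul_right _
  have hGae : ∀ᵐ x ∂μ, G x ≠ ⊤ := by
    filter_upwards [ae_lt_top' hGm hGfin] with x hx using hx.ne
  have hGint : Integrable (fun x => (G x).toReal) μ := integrable_toReal_of_lintegral_ne_top hGm hGfin
  have hpos : 0 < (1 - ρ)⁻¹ := inv_pos.2 (by linarith)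
  refine ⟨fun x => Real.sqrt ((1 - ρ)⁻¹ * (G x).toReal), fun x => Real.sqrt_nonneg _, ?_, ?_⟩
  · rw [memLp_two_iff_integrable_sq]
    · refine (hGint.const_mul (1 - ρ)⁻¹).congr (Eventually.of_forall fun x => ?_)
      exact (Real.sq_sqrt (mul_nonneg hpos.le ENNReal.toReal_nonneg)).symm
    · exact (Real.continuous_sqrt.measurable.comp_aemeasurable
        (hGint.aemeasurable.const_mul _)).aestronglyMeasurable
  · filter_upwards [hGae] with x hx
    have hs : Summable fun j : ℕ => ρ ^ j * Z (shift (-j) x) ^ 2 := by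
      have := ENNReal.summable_toReal hx
      simpa only [ENNReal.toReal_ofReal (hnn _ x)] using this
    have ht : (G x).toReal = ∑' j : ℕ, ρ ^ j * Z (shift (-j) x) ^ 2 := by
      rw [ENNReal.tsum_toReal_eq fun j => ENNReal.ofReal_ne_top]
      simp only [ENNReal.toReal_ofReal (hnn _ x)]
    have hb : ∀ n, ∑ j ∈ Finset.range n, ρ ^ j * Z (shift (-j) x) ≤
        Real.sqrt ((1 - ρ)⁻¹ * (G x).toReal) := fun n => by
      refine Real.le_sqrt_of_sq_le ?_
      calc _ ≤ (∑ j ∈ Finset.range n, ρ ^ j) *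
            ∑ j ∈ Finset.range n, ρ ^ j * Z (shift (-j) x) ^ 2 :=
            Finset.sum_sq_le_sum_mul_sum_of_sq_le_mul _ (fun j _ => pow_nonneg h0.le _)
              (fun j _ => hnn j x) fun j _ => by apply le_of_eq; ring
        _ ≤ (1 - ρ)⁻¹ * (G x).toReal := by
          rw [ht, ← tsum_geometric_of_lt_one h0.le h1]
          exact mul_le_mul
            ((summable_geometric_of_lt_one h0.le h1).sum_le_tsum _ fun j _ => pow_nonneg h0.le _)
            (hs.sum_le_tsum _ fun j _ => hnn j x) (Finset.sum_nonneg fun j _ => hnn j x)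
            (tsum_nonneg fun j => pow_nonneg h0.le _)
    have hnn' : ∀ j : ℕ, 0 ≤ ρ ^ j * Z (shift (-j) x) := fun j =>
      mul_nonneg (pow_nonneg h0.le _) (hZ0 _)
    exact ⟨summable_of_sum_range_le hnn' hb, Real.tsum_le_of_sum_range_le hnn' hb⟩

/-- It is enough to control the countably many rates `1 - 1 / (n + 2)`, which exceed any given `σ <
1` for some `n`. -/
theorem ae_subexp (hμ : Ergodic (shift (K := K) 1) μ) {f : PathSpace K → ℝ} (hf : MemLp f 2 μ) :
    ∀ᵐ x ∂μ, Subexp fun k => f (shift k x) := by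
  have h : ∀ n : ℕ, ∀ᵐ x ∂μ, ∀ k : ℤ, Summable fun j : ℕ =>
      (1 - 1 / ((n : ℝ) + 2)) ^ j * |f (shift (-j) (shift k x))| := fun n => by
    have hn : 1 / ((n : ℝ) + 2) ≤ 1 / 2 := one_div_le_one_div_of_le (by norm_num)
      (by linarith [(Nat.cast_nonneg n : (0 : ℝ) ≤ n)])
    have hn' : 0 < 1 / ((n : ℝ) + 2) := by positivity
    obtain ⟨Z', -, -, hZ'⟩ := exists_memLp_tsum_le hμ (fun x => abs_nonneg (f x)) hf.abs
      (ρ := 1 - 1 / ((n : ℝ) + 2)) (by linarith) (by linarith)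
    exact ae_forall_shift hμ (hZ'.mono fun x hx => hx.1)
  filter_upwards [ae_all_iff.2 h] with x hx σ h0 h1 k
  obtain ⟨n, hn⟩ := exists_nat_one_div_lt (sub_pos.2 h1)
  have hn2 : 1 / ((n : ℝ) + 2) ≤ 1 / ((n : ℝ) + 1) :=
    one_div_le_one_div_of_le (by positivity) (by linarith)
  refine ⟨∑' j : ℕ, (1 - 1 / ((n : ℝ) + 2)) ^ j * |f (shift (-j) (shift k x))|, fun j => ?_⟩
  have hσ : σ ≤ 1 - 1 / ((n : ℝ) + 2) := by linarith
  have e : shift (-(j : ℤ)) (shift k x) = shift (k - j) x := by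
    rw [shift_shift, neg_add_eq_sub]
  calc |f (shift (k - j) x)| * σ ^ j
      ≤ (1 - 1 / ((n : ℝ) + 2)) ^ j * |f (shift (-j) (shift k x))| := by
        rw [e, mul_comm]
        gcongr
    _ ≤ _ := (hx n k).le_tsum j fun i _ =>
        mul_nonneg (pow_nonneg (h0.le.trans hσ) _) (abs_nonneg _)

/-! ### Families of signals with a common square integrable bound -/

variable {Θ : Type*} [TopologicalSpace Θ]

/-- A family of random variables on path space which is bounded by, and continuous in the parameter
relative to, a common square integrable function. -/
def Dominated (μ : Measure (PathSpace K)) (P : Θ → PathSpace K → ℝ) : Prop :=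
  (∀ θ, AEStronglyMeasurable (P θ) μ) ∧
  ∃ (Z : PathSpace K → ℝ) (c : Θ → ℝ) (ω : Θ × Θ → ℝ), (∀ x, 0 ≤ Z x) ∧ MemLp Z 2 μ ∧
    Continuous c ∧ Continuous ω ∧ (∀ θ, 0 ≤ c θ) ∧ (∀ p, 0 ≤ ω p) ∧ (∀ θ, ω (θ, θ) = 0) ∧
    ∀ᵐ x ∂μ, ∀ θ, |P θ x| ≤ c θ * Z x ∧ ∀ θ', |P θ x - P θ' x| ≤ ω (θ, θ') * Z x

theorem Dominated.congr {P P' : Θ → PathSpace K → ℝ} (hP : Dominated μ P)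
    (h : ∀ᵐ x ∂μ, ∀ θ, P' θ x = P θ x) : Dominated μ P' := by
  obtain ⟨hm, Z, c, ω, hZ0, hZ, hc, hω, hc0, hω0, hωd, hb⟩ := hP
  refine ⟨fun θ => (hm θ).congr (h.mono fun x hx => (hx θ).symm), Z, c, ω, hZ0, hZ, hc, hω, hc0,
    hω0, hωd, ?_⟩
  filter_upwards [hb, h] with x hx hx'
  simp only [hx']
  exact hx

theorem Dominated.memLp {P : Θ → PathSpace K → ℝ} (hP : Dominated μ P) (θ : Θ) :
    MemLp (P θ) 2 μ := by
  obtain ⟨hm, Z, c, ω, hZ0, hZ, -, -, -, -, -, hb⟩ := hP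
  refine hZ.of_le_mul (hm θ) (c := c θ) ?_
  filter_upwards [hb] with x hx
  rw [Real.norm_eq_abs, Real.norm_eq_abs, abs_of_nonneg (hZ0 x)]
  exact (hx θ).1

theorem dominated_const {f : PathSpace K → ℝ} (hf : MemLp f 2 μ) :
    Dominated μ fun _ : Θ => f := by
  refine ⟨fun _ => hf.1, fun x => |f x|, fun _ => 1, fun _ => 0, fun x => abs_nonneg _, hf.abs,
    continuous_const, continuous_const, fun _ => zero_le_one, fun _ => le_rfl, fun _ => rfl,
    Eventually.of_forall fun x θ => ⟨by simp, fun θ' => by simp⟩⟩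

theorem Dominated.add {P Q : Θ → PathSpace K → ℝ} (hP : Dominated μ P) (hQ : Dominated μ Q) :
    Dominated μ fun θ x => P θ x + Q θ x := by
  obtain ⟨hm, Z, c, ω, hZ0, hZ, hc, hω, hc0, hω0, hωd, hb⟩ := hP
  obtain ⟨hm', Z', c', ω', hZ0', hZ', hc', hω', hc0', hω0', hωd', hb'⟩ := hQ
  refine ⟨fun θ => (hm θ).add (hm' θ), fun x => Z x + Z' x, fun θ => c θ + c' θ,
    fun p => ω p + ω' p, fun x => add_nonneg (hZ0 x) (hZ0' x), hZ.add hZ', hc.add hc', hω.add hω',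
    fun θ => add_nonneg (hc0 θ) (hc0' θ), fun p => add_nonneg (hω0 p) (hω0' p),
    fun θ => by simp [hωd, hωd'], ?_⟩
  filter_upwards [hb, hb'] with x hx hx' θ
  have key : ∀ a b a' b' z z' : ℝ, 0 ≤ z → 0 ≤ z' → 0 ≤ a' → 0 ≤ b' → |a| ≤ a' * z → |b| ≤ b' * z' →
      |a + b| ≤ (a' + b') * (z + z') := by
    intro a b a' b' z z' hz hz' ha hb h1 h2
    have := abs_add_le a b
    nlinarith [mul_nonneg ha hz', mul_nonneg hb hz]
  refine ⟨key _ _ _ _ _ _ (hZ0 x) (hZ0' x) (hc0 θ) (hc0' θ) (hx θ).1 (hx' θ).1, fun θ' => ?_⟩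
  rw [add_sub_add_comm]
  exact key _ _ _ _ _ _ (hZ0 x) (hZ0' x) (hω0 _) (hω0' _) ((hx θ).2 θ') ((hx' θ).2 θ')

theorem Dominated.sum {ι : Type*} (s : Finset ι) {P : ι → Θ → PathSpace K → ℝ}
    (hP : ∀ i ∈ s, Dominated μ (P i)) : Dominated μ fun θ x => ∑ i ∈ s, P i θ x := by
  classical
  induction s using Finset.induction_on with
  | empty =>
    simp only [Finset.sum_empty]
    exact dominated_const (MemLp.zero' (μ := μ) (p := 2) (ε := ℝ))
  | insert i s hi ih =>
    simp only [Finset.sum_insert hi]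
    exact (hP i (Finset.mem_insert_self i s)).add
      (ih fun j hj => hP j (Finset.mem_insert_of_mem hj))

/-- The geometric decay of the coefficients turns the bound of the family into a weighted sum of its
shifts, again square integrable by `exists_memLp_tsum_le`. A difference splits into a change of the
filter and a change of the family. -/
theorem Dominated.filter (hμ : Ergodic (shift (K := K) 1) μ) {P : Θ → PathSpace K → ℝ}
    (hP : Dominated μ P) {m : ℕ} {h : ℝ} (hh : 0 < h) {f : Θ → CircleFun m} (hf : Continuous f) :
    Dominated μ fun θ x => ∑' j : ℕ, coef m h j (f θ) * P θ (shift (-j) x) := by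
  obtain ⟨hm, Z, c, ω, hZ0, hZ, hc, hω, hc0, hω0, hωd, hb⟩ := hP
  obtain ⟨C, hC, hcf⟩ := exists_abs_coef_le m hh
  obtain ⟨Z', hZ0', hZ', hb'⟩ := exists_memLp_tsum_le hμ hZ0 hZ (decay_pos m h) (decay_lt_one m hh)
  have hd := (decay_pos m h).le
  have hbs := ae_forall_shift hμ hb
  have hbound : ∀ᵐ x ∂μ, ∀ θ, ∀ j : ℕ, |coef m h j (f θ) * P θ (shift (-j) x)| ≤
      (C * ‖f θ‖ * c θ) * (decay m h ^ j * Z (shift (-j) x)) := by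
    filter_upwards [hbs] with x hx θ j
    rw [abs_mul]
    calc _ ≤ (C * decay m h ^ j * ‖f θ‖) * (c θ * Z (shift (-j) x)) :=
          mul_le_mul (hcf j _) (hx _ θ).1 (abs_nonneg _) (by positivity)
      _ = _ := by ring
  have hsum : ∀ᵐ x ∂μ, ∀ θ, Summable fun j : ℕ => coef m h j (f θ) * P θ (shift (-j) x) := by
    filter_upwards [hbound, hb'] with x hx hx' θ
    exact Summable.of_norm_bounded (hx'.1.mul_left (C * ‖f θ‖ * c θ)) fun j => hx θ j
  refine ⟨fun θ => ?_, Z', fun θ => C * ‖f θ‖ * c θ,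
    fun p => C * (‖f p.1 - f p.2‖ * c p.1 + ‖f p.2‖ * ω p), hZ0', hZ', by fun_prop, by fun_prop,
    fun θ => mul_nonneg (mul_nonneg hC (norm_nonneg _)) (hc0 θ),
    fun p => mul_nonneg hC (add_nonneg (mul_nonneg (norm_nonneg _) (hc0 _))
      (mul_nonneg (norm_nonneg _) (hω0 _))), fun θ => by simp [hωd], ?_⟩
  · refine aestronglyMeasurable_of_tendsto_ae atTop (f := fun (n : ℕ) x =>
      ∑ j ∈ Finset.range n, coef m h j (f θ) * P θ (shift (-j) x)) (fun n => ?_) ?_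
    · refine Finset.aestronglyMeasurable_fun_sum _ fun j _ => ?_
      exact ((hm θ).comp_quasiMeasurePreserving
        (measurePreserving_shift hμ (-j)).quasiMeasurePreserving).const_mul _
    · filter_upwards [hsum] with x hx
      exact (hx θ).hasSum.tendsto_sum_nat
  · filter_upwards [hbound, hsum, hbs, hb'] with x hx hxs hxb hx' θ
    have hle : ∀ {g : ℕ → ℝ} {r : ℝ}, 0 ≤ r → (∀ j : ℕ, |g j| ≤ r * (decay m h ^ j * Z (shift (-j) x))) →
        |∑' j, g j| ≤ r * Z' x := by
      intro g r hr hg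
      calc |∑' j, g j| ≤ r * ∑' j : ℕ, decay m h ^ j * Z (shift (-j) x) := by
            rw [← Real.norm_eq_abs, ← tsum_mul_left]
            exact tsum_of_norm_bounded (hx'.1.mul_left r).hasSum hg
        _ ≤ r * Z' x := by
          gcongr
          exact hx'.2
    refine ⟨hle (mul_nonneg (mul_nonneg hC (norm_nonneg _)) (hc0 θ)) (hx θ), fun θ' => ?_⟩
    rw [← (hxs θ).tsum_sub (hxs θ')]
    refine hle (mul_nonneg hC (add_nonneg (mul_nonneg (norm_nonneg _) (hc0 _))
      (mul_nonneg (norm_nonneg _) (hω0 _)))) fun j => ?_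
    have e : coef m h j (f θ) * P θ (shift (-j) x) - coef m h j (f θ') * P θ' (shift (-j) x) =
        coef m h j (f θ - f θ') * P θ (shift (-j) x) +
          coef m h j (f θ') * (P θ (shift (-j) x) - P θ' (shift (-j) x)) := by
      rw [map_sub]
      ring
    rw [e]
    calc _ ≤ |coef m h j (f θ - f θ')| * |P θ (shift (-j) x)| +
          |coef m h j (f θ')| * |P θ (shift (-j) x) - P θ' (shift (-j) x)| := by
          rw [← abs_mul, ← abs_mul]
          exact abs_add_le _ _
      _ ≤ (C * decay m h ^ j * ‖f θ - f θ'‖) * (c θ * Z (shift (-j) x)) +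
          (C * decay m h ^ j * ‖f θ'‖) * (ω (θ, θ') * Z (shift (-j) x)) :=
        add_le_add (mul_le_mul (hcf j _) (hxb _ θ).1 (abs_nonneg _) (by positivity))
          (mul_le_mul (hcf j _) ((hxb _ θ).2 θ') (abs_nonneg _) (by positivity))
      _ = _ := by ring

theorem sum_Icc_int_eq_sum_range (g : ℤ → ℝ) (N : ℕ) :
    ∑ k ∈ Finset.Icc (1 : ℤ) N, g k = ∑ j ∈ Finset.range N, g (j + 1) := by
  refine Finset.sum_nbij' (fun k => (k - 1).toNat) (fun j => (j : ℤ) + 1) ?_ ?_ ?_ ?_ ?_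
  all_goals simp only [Finset.mem_Icc, Finset.mem_range]
  · intro k hk
    omega
  · intro j hj
    omega
  · intro k hk
    omega
  · intro j _
    omega
  · intro k hk
    congr 1
    omega

/-- The uniform law of large numbers for products of dominated families. -/
theorem Dominated.ae_eventually_average_mul_near [TopologicalSpace.SeparableSpace Θ]
    [IsProbabilityMeasure μ] (hμ : Ergodic (shift (K := K) 1) μ) {P Q : Θ → PathSpace K → ℝ}
    (hP : Dominated μ P) (hQ : Dominated μ Q) :
    ∀ᵐ x ∂μ, ∀ θ₀, ∀ ε > 0, ∃ U ∈ 𝓝 θ₀, ∀ᶠ N : ℕ in atTop, ∀ θ ∈ U,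
      |(1 / (N : ℝ)) * ∑ k ∈ Finset.Icc (1 : ℤ) N, P θ (shift k x) * Q θ (shift k x) -
        ∫ y, P θ₀ y * Q θ₀ y ∂μ| < ε := by
  have hi : ∀ θ, Integrable (fun x => P θ x * Q θ x) μ := fun θ =>
    (hP.memLp θ).integrable_mul (hQ.memLp θ)
  obtain ⟨hm, Z, c, ω, hZ0, hZ, hc, hω, hc0, hω0, hωd, hb⟩ := hP
  obtain ⟨hm', Z', c', ω', hZ0', hZ', hc', hω', hc0', hω0', hωd', hb'⟩ := hQ
  have h := ae_eventually_average_near hμ (Θ := Θ) (F := fun θ x => P θ x * Q θ x)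
    (Z := fun x => Z x * Z' x) (ω := fun p => ω p * c' p.1 + c p.2 * ω' p) (by fun_prop)
    (fun θ => by simp [hωd, hωd']) hi (hZ.integrable_mul hZ') (by
      filter_upwards [hb, hb'] with x hx hx' θ θ'
      have e : P θ x * Q θ x - P θ' x * Q θ' x =
          (P θ x - P θ' x) * Q θ x + P θ' x * (Q θ x - Q θ' x) := by ring
      rw [e]
      calc _ ≤ |P θ x - P θ' x| * |Q θ x| + |P θ' x| * |Q θ x - Q θ' x| := by
            rw [← abs_mul, ← abs_mul]
            exact abs_add_le _ _
        _ ≤ (ω (θ, θ') * Z x) * (c' θ * Z' x) + (c θ' * Z x) * (ω' (θ, θ') * Z' x) :=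
          add_le_add (mul_le_mul ((hx θ).2 θ') (hx' θ).1 (abs_nonneg _)
              (mul_nonneg (hω0 _) (hZ0 x)))
            (mul_le_mul (hx θ').1 ((hx' θ).2 θ') (abs_nonneg _) (mul_nonneg (hc0 _) (hZ0 x)))
        _ = _ := by ring) fun x => mul_nonneg (hZ0 x) (hZ0' x)
  filter_upwards [ae_forall_shift hμ h] with x hx θ₀ ε hε
  obtain ⟨U, hU, hN⟩ := hx 1 θ₀ ε hε
  refine ⟨U, hU, hN.mono fun N hN θ hθ => ?_⟩
  rw [sum_Icc_int_eq_sum_range (fun k => P θ (shift k x) * Q θ (shift k x))]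
  simpa only [iterate_shift_one, shift_shift] using hN θ hθ

end Shift

/-! ### Zero sets of real analytic functions -/

theorem volume_zeros_eq_zero_of_analyticOnNhd {g : ℝ → ℝ} {I : Set ℝ} (hI : IsPreconnected I)
    (hg : AnalyticOnNhd ℝ g I) {t₁ : ℝ} (ht₁ : t₁ ∈ I) (hne : g t₁ ≠ 0) :
    volume {t ∈ I | g t = 0} = 0 := by
  refine measure_null_of_locally_null _ fun t ht => ?_
  have h := (hg.eqOn_zero_or_eventually_ne_zero_of_preconnected hI).resolve_left
    fun h => hne (h ht₁)
  have h' : ∀ᶠ s in 𝓝[≠] t, g s ≠ 0 := by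
    rcases (hg t ht.1).eventually_eq_zero_or_eventually_ne_zero with h0 | h0
    · exact absurd (hg.eqOn_zero_of_preconnected_of_eventuallyEq_zero hI ht.1 h0 ht₁) hne
    · exact h0
  refine ⟨{t}, ?_, by simp⟩
  rw [mem_nhdsWithin_iff_eventually]
  filter_upwards [eventually_nhdsWithin_iff.1 h'] with s hs hsI
  by_contra hst
  exact hs hst hsI.2

/-- Near a zero `x` some point `x + v` is not a zero, by the identity theorem. Every line in
direction `v` that meets a small ball around `x` then contains a nonzero of `f` nearby, so it meets
the zero set in a null set, and Fubini's theorem applies. -/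
theorem measure_zeros_eq_zero_of_analyticOnNhd {E : Type*} [NormedAddCommGroup E]
    [NormedSpace ℝ E] [FiniteDimensional ℝ E] [MeasurableSpace E] [BorelSpace E]
    (μ : Measure E) [μ.IsAddHaarMeasure] {f : E → ℝ} {U : Set E} (hU : IsOpen U)
    (hpc : IsPreconnected U) (hf : AnalyticOnNhd ℝ f U) {x₁ : E} (hx₁ : x₁ ∈ U)
    (hne : f x₁ ≠ 0) : μ {x ∈ U | f x = 0} = 0 := by
  have : ProperSpace E := FiniteDimensional.proper ℝ E
  refine measure_null_of_locally_null _ fun x hx => ?_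
  obtain ⟨r, hr, hrU⟩ := Metric.isOpen_iff.1 hU x hx.1
  obtain ⟨x₂, hx₂, hfx₂⟩ : ∃ x₂ ∈ Metric.ball x r, f x₂ ≠ 0 := by
    by_contra! hcon
    exact hne (hf.eqOn_zero_of_preconnected_of_eventuallyEq_zero hpc hx.1
      (Filter.eventuallyEq_of_mem (Metric.ball_mem_nhds x hr) hcon) hx₁)
  set v := x₂ - x with hv
  have hev : ∀ᶠ y in 𝓝 x, y + v ∈ Metric.ball x r ∧ f (y + v) ≠ 0 := by
    have hc : ContinuousAt (fun y => y + v) x := by fun_prop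
    have hxv : x + v = x₂ := by rw [hv, add_sub_cancel]
    have h1 : ∀ᶠ z in 𝓝 (x + v), z ∈ Metric.ball x r ∧ f z ≠ 0 := by
      rw [hxv]
      exact (Metric.isOpen_ball.eventually_mem hx₂).and
        ((hf x₂ (hrU hx₂)).continuousAt.eventually_ne hfx₂)
    exact hc.eventually h1
  obtain ⟨δ, hδ, hδv⟩ := Metric.eventually_nhds_iff_ball.1
    (hev.and (Metric.isOpen_ball.eventually_mem (Metric.mem_ball_self hr)))
  refine ⟨Metric.ball x δ ∩ f ⁻¹' {0}, ?_, ?_⟩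
  · rw [mem_nhdsWithin_iff_eventually]
    filter_upwards [Metric.ball_mem_nhds x hδ] with y hy hyU using ⟨hy, hyU.2⟩
  · have hcont : ContinuousOn f (Metric.ball x δ) := fun y hy =>
      (hf y (hrU (hδv y hy).2)).continuousAt.continuousWithinAt
    have hmeas : MeasurableSet (Metric.ball x δ ∩ f ⁻¹' {0}) := by
      obtain ⟨t, ht, hte⟩ := continuousOn_iff_isClosed.1 hcont {0} isClosed_singleton
      rw [Set.inter_comm, hte]
      exact ht.measurableSet.inter measurableSet_ball
    have := ae_mem_of_ae_add_linearMap_mem (LinearMap.toSpanSingleton ℝ E v) volume μ hmeas.compl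
      fun y => ?_
    · rw [ae_iff] at this
      simp only [Set.mem_compl_iff, not_not] at this
      exact this
    · rw [ae_iff]
      simp only [LinearMap.toSpanSingleton_apply, Set.mem_compl_iff, not_not]
      -- Lines missing the small ball contribute nothing. For the others, the part inside the large
      -- ball is an interval of parameters, and `t₀ + 1` is a point of it with nonzero value.
      by_cases hemp : ∃ t₀ : ℝ, y + t₀ • v ∈ Metric.ball x δ
      · obtain ⟨t₀, ht₀⟩ := hemp
        set I := {t : ℝ | y + t • v ∈ Metric.ball x r}
        have hI : IsPreconnected I := by
          have : Convex ℝ I := by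
            intro s hs t ht a b ha hb hab
            have := convex_ball x r hs ht ha hb hab
            have e : a • (y + s • v) + b • (y + t • v) = y + (a • s + b • t) • v := by
              rw [← eq_sub_iff_add_eq'] at hab
              subst hab
              module
            rwa [e] at this
          exact this.isPreconnected
        have hlin : ∀ t, AnalyticAt ℝ (fun t : ℝ => y + t • v) t := fun t => by fun_prop
        have hg : AnalyticOnNhd ℝ (fun t : ℝ => f (y + t • v)) I := fun t ht =>
          AnalyticAt.fun_comp (g := f) (f := fun t : ℝ => y + t • v) (hf _ (hrU ht)) (hlin t)
        have h1 := (hδv _ ht₀).1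
        have e : y + t₀ • v + v = y + (t₀ + 1) • v := by rw [add_smul, one_smul, add_assoc]
        rw [e] at h1
        refine measure_mono_null ?_ (volume_zeros_eq_zero_of_analyticOnNhd hI hg h1.1 h1.2)
        intro t ht
        exact ⟨(hδv _ ht.1).2, ht.2⟩
      · push Not at hemp
        convert measure_empty (μ := (volume : Measure ℝ))
        ext t
        simp only [Set.mem_ofPred_eq, Set.mem_inter_iff, Set.mem_empty_iff_false, iff_false, not_and]
        exact fun h => absurd h (hemp t)

/-! ### Denominators -/

section DenPoly

variable {n : ℕ}

theorem coeff_denPoly_zero (a : Fin n → ℝ) : (denPoly a).coeff 0 = 1 := by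
  simp [denPoly, coeff_one]

theorem coeff_denPoly_succ (a : Fin n → ℝ) (r : Fin n) : (denPoly a).coeff (r + 1) = a r := by
  simp [denPoly, coeff_one, coeff_X_pow, Fin.val_inj]

theorem natDegree_denPoly_le (a : Fin n → ℝ) : (denPoly a).natDegree ≤ n := by
  refine (natDegree_add_le _ _).trans (max_le (by simp) ?_)
  refine natDegree_sum_le_of_forall_le _ _ fun r _ => ?_
  exact (natDegree_C_mul_X_pow_le _ _).trans r.2

theorem denPoly_ne_zero (a : Fin n → ℝ) : denPoly a ≠ 0 := fun h => by
  have := coeff_denPoly_zero a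
  rw [h] at this
  simp at this

theorem natDegree_denPoly_eq_iff (a : Fin n → ℝ) :
    (denPoly a).natDegree = n ↔ (denPoly a).coeff n ≠ 0 := by
  constructor
  · intro h
    have := leadingCoeff_ne_zero.2 (denPoly_ne_zero a)
    rwa [leadingCoeff, h] at this
  · intro h
    exact le_antisymm (natDegree_denPoly_le a) (le_natDegree_of_ne_zero h)

theorem aeval_denPoly {S : Type*} [CommRing S] [Algebra ℝ S] (a : Fin n → ℝ) (z : S) :
    aeval z (denPoly a) = 1 + ∑ r : Fin n, a r • z ^ (r.val + 1) := by
  simp [denPoly, Algebra.smul_def]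

/-- A polynomial of degree at most `n` with constant coefficient `1` is a `denPoly`. -/
theorem denPoly_coeff {P : ℝ[X]} (hP : P.natDegree ≤ n) (h0 : P.coeff 0 = 1) :
    denPoly (fun r : Fin n => P.coeff (r + 1)) = P := by
  ext k
  rcases k with _ | k
  · rw [coeff_denPoly_zero, h0]
  · by_cases hk : k < n
    · exact coeff_denPoly_succ (fun r : Fin n => P.coeff (r + 1)) ⟨k, hk⟩
    · rw [coeff_eq_zero_of_natDegree_lt (hP.trans_lt (by omega)),
        coeff_eq_zero_of_natDegree_lt ((natDegree_denPoly_le _).trans_lt (by omega))]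

theorem continuous_coeff_denPoly (k : ℕ) : Continuous fun a : Fin n → ℝ => (denPoly a).coeff k := by
  simp only [denPoly, coeff_add, finsetSum_coeff, coeff_C_mul]
  fun_prop

theorem continuous_aeval_denPoly {Y : Type*} [TopologicalSpace Y] {α : Y → Fin n → ℝ}
    (hα : Continuous α) : Continuous fun p : Y × ℂ => aeval p.2 (denPoly (α p.1)) := by
  simp only [aeval_denPoly]
  fun_prop

/-- The zeros of `denPoly` depend upper semicontinuously on the coefficients. -/
theorem eventually_forall_zero_denPoly {Y : Type*} [TopologicalSpace Y] {α : Y → Fin n → ℝ}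
    (hα : Continuous α) {y₀ : Y} (hdeg : (denPoly (α y₀)).coeff n ≠ 0) {W : Set (Y × ℂ)}
    (hW : IsOpen W) (h : ∀ z, aeval z (denPoly (α y₀)) = 0 → (y₀, z) ∈ W) :
    ∀ᶠ y in 𝓝 y₀, ∀ z, aeval z (denPoly (α y)) = 0 → (y, z) ∈ W := by
  -- The reversed polynomial `w ^ n A (1 / w)` has the leading coefficient as its value at `w = 0`.
  -- As this is nonzero at `y₀`, no zero of `A` escapes to infinity nearby, and only a compact disc
  -- remains.
  set rev : Y × ℂ → ℂ := fun p => p.2 ^ n + ∑ r : Fin n, α p.1 r • p.2 ^ (n - (r.val + 1)) with hrev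
  have hrevc : Continuous rev := by
    simp only [hrev]
    fun_prop
  have hrev_eq : ∀ y z, z ≠ 0 → aeval z (denPoly (α y)) = z ^ n * rev (y, z⁻¹) := by
    intro y z hz
    rw [aeval_denPoly, hrev]
    simp only [mul_add, Finset.mul_sum]
    congr 1
    · rw [← mul_pow, mul_inv_cancel₀ hz, one_pow]
    · refine Finset.sum_congr rfl fun r _ => ?_
      rw [mul_smul_comm]
      congr 1
      rw [inv_pow, eq_mul_inv_iff_mul_eq₀ (pow_ne_zero _ hz), ← pow_add]
      congr 1
      omega
  have hrev0 : rev (y₀, 0) ≠ 0 := by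
    rw [hrev]
    rcases n with _ | n
    · simp
    · have e : ∀ r : Fin (n + 1), α y₀ r • (0 : ℂ) ^ (n + 1 - (r.val + 1)) =
          if r = Fin.last n then ((α y₀ (Fin.last n) : ℝ) : ℂ) else 0 := fun r => by
        split_ifs with hr
        · subst hr
          simp
        · have : n + 1 - (r.val + 1) ≠ 0 := by
            have := Fin.val_lt_last hr
            omega
          rw [zero_pow this, smul_zero]
      simp only [e]
      have := coeff_denPoly_succ (α y₀) (Fin.last n)
      rw [Fin.val_last] at this
      rw [this] at hdeg
      simpa using hdeg
  obtain ⟨δ, hδ, hb⟩ : ∃ δ > 0, ∀ᶠ y in 𝓝 y₀, ∀ w ∈ Metric.ball (0 : ℂ) δ, rev (y, w) ≠ 0 := by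
    have hev := hrevc.continuousAt.eventually_ne hrev0
    rw [nhds_prod_eq, Filter.eventually_prod_iff] at hev
    obtain ⟨pa, hpa, pb, hpb, hab⟩ := hev
    obtain ⟨δ, hδ, hball⟩ := Metric.eventually_nhds_iff_ball.1 hpb
    exact ⟨δ, hδ, hpa.mono fun y hy w hw => hab hy (hball w hw)⟩
  have hcpt : ∀ᶠ y in 𝓝 y₀, ∀ z ∈ Metric.closedBall (0 : ℂ) δ⁻¹,
      aeval z (denPoly (α y)) = 0 → (y, z) ∈ W := by
    refine (isCompact_closedBall _ _).eventually_forall_of_forall_eventually fun z _ => ?_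
    by_cases hz : aeval z (denPoly (α y₀)) = 0
    · filter_upwards [hW.eventually_mem (h z hz)] with p hp _ using hp
    · filter_upwards [(continuous_aeval_denPoly hα).continuousAt.eventually_ne
        (x := (y₀, z)) hz] with p hp h0
      exact absurd h0 hp
  filter_upwards [hb, hcpt] with y hy hy' z hz
  by_cases hzR : z ∈ Metric.closedBall (0 : ℂ) δ⁻¹
  · exact hy' z hzR hz
  · rw [mem_closedBall_zero_iff, not_le] at hzR
    have hz0 : z ≠ 0 := by
      rintro rfl
      simp at hzR
      exact absurd hzR hδ.le.not_gt
    rw [hrev_eq y z hz0] at hz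
    refine absurd ((mul_eq_zero.1 hz).resolve_left (pow_ne_zero _ hz0)) (hy _ ?_)
    rw [mem_ball_zero_iff, norm_inv]
    exact inv_lt_of_inv_lt₀ hδ hzR

theorem eventually_natDegree_denPoly {Y : Type*} [TopologicalSpace Y] {α : Y → Fin n → ℝ}
    (hα : Continuous α) {y₀ : Y} (hdeg : (denPoly (α y₀)).natDegree = n) :
    ∀ᶠ y in 𝓝 y₀, (denPoly (α y)).natDegree = n := by
  simp only [natDegree_denPoly_eq_iff] at hdeg ⊢
  exact ((continuous_coeff_denPoly n).comp hα).continuousAt.eventually_ne hdeg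

theorem eventually_zeros_denPoly {Y : Type*} [TopologicalSpace Y] {α : Y → Fin n → ℝ}
    (hα : Continuous α) {y₀ : Y} (hdeg : (denPoly (α y₀)).natDegree = n) {U : Set ℂ}
    (hU : IsOpen U) (h : ∀ z, aeval z (denPoly (α y₀)) = 0 → z ∈ U) :
    ∀ᶠ y in 𝓝 y₀, ∀ z, aeval z (denPoly (α y)) = 0 → z ∈ U :=
  eventually_forall_zero_denPoly hα ((natDegree_denPoly_eq_iff _).1 hdeg)
    (W := Prod.snd ⁻¹' U) (hU.preimage continuous_snd) h

theorem eventually_hasZerosIn_denPoly {Y : Type*} [TopologicalSpace Y] {α : Y → Fin n → ℝ}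
    (hα : Continuous α) {y₀ : Y} (hdeg : (denPoly (α y₀)).natDegree = n) {m : ℕ}
    (h : HasZerosIn m (denPoly (α y₀))) : ∀ᶠ y in 𝓝 y₀, HasZerosIn m (denPoly (α y)) :=
  (eventually_zeros_denPoly hα hdeg Metric.isOpen_ball h.2).mono fun _ hy =>
    ⟨denPoly_ne_zero _, hy⟩

/-- The denominators of a single subsystem in `denRegion`. -/
def denRegionSingle (h : ℝ) (n : ℕ) : Set (Fin n → ℝ) :=
  {a | (denPoly a).natDegree = n ∧ IsStable (denPoly a) ∧ IsSampledFast h (denPoly a)}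

theorem isOpen_denRegionSingle (h : ℝ) (n : ℕ) : IsOpen (denRegionSingle h n) := by
  rw [isOpen_iff_eventually]
  rintro a ⟨h1, h2, h3⟩
  have hs : IsOpen {z : ℂ | z.re < 0 ∧ 2 * |z.im| < 2 * Real.pi / h} :=
    (isOpen_lt Complex.continuous_re continuous_const).inter
      (isOpen_lt (continuous_const.mul Complex.continuous_im.abs) continuous_const)
  filter_upwards [eventually_natDegree_denPoly continuous_id h1,
    eventually_zeros_denPoly continuous_id h1 hs fun z hz => ⟨h2 z hz, h3 z hz⟩] with b hb1 hb2
  exact ⟨hb1, fun z hz => (hb2 z hz).1, fun z hz => (hb2 z hz).2⟩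

/-! ### Contraction of the zeros and connectedness of the region of denominators -/

/-- The polynomial obtained from `A` by moving its zeros `z` to `(1 - t) z - t`, up to scaling. -/
def contract (A : ℝ[X]) (n : ℕ) (t : ℝ) : ℝ[X] :=
  ∑ r ∈ Finset.range (n + 1), C (A.coeff r * (1 - t) ^ (n - r)) * (X + C t) ^ r

theorem coeff_contract (A : ℝ[X]) (n : ℕ) (t : ℝ) (k : ℕ) : (contract A n t).coeff k =
    ∑ r ∈ Finset.range (n + 1), A.coeff r * (1 - t) ^ (n - r) * (t ^ (r - k) * r.choose k) := by
  rw [contract, finsetSum_coeff]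
  refine Finset.sum_congr rfl fun r _ => ?_
  rw [coeff_C_mul, coeff_X_add_C_pow]

theorem coeff_contract_self (A : ℝ[X]) (n : ℕ) (t : ℝ) : (contract A n t).coeff n = A.coeff n := by
  rw [coeff_contract, Finset.sum_eq_single n]
  · simp
  · intro r hr hrn
    rw [Nat.choose_eq_zero_of_lt]
    · simp
    · have := Finset.mem_range.1 hr
      omega
  · simp

theorem natDegree_contract_le (A : ℝ[X]) (n : ℕ) (t : ℝ) : (contract A n t).natDegree ≤ n := by
  refine natDegree_sum_le_of_forall_le _ _ fun r hr => ?_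
  refine (natDegree_C_mul_le _ _).trans ((natDegree_pow_le).trans ?_)
  rw [natDegree_X_add_C, mul_one]
  exact Nat.lt_succ_iff.1 (Finset.mem_range.1 hr)

theorem exists_zero_of_aeval_contract {A : ℝ[X]} {n : ℕ} (hA : A.natDegree = n) (hA0 : A ≠ 0)
    {t : ℝ} {z : ℂ} (hz : aeval z (contract A n t) = 0) :
    (t = 1 ∧ z = -1) ∨ ∃ w : ℂ, aeval w A = 0 ∧ z = (1 - t) * w - t := by
  have e : aeval z (contract A n t) =
      ∑ r ∈ Finset.range (n + 1), (A.coeff r : ℂ) * (1 - t) ^ (n - r) * (z + t) ^ r := by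
    simp [contract]
  rw [e] at hz
  -- At `t = 1` only the top summand survives and the polynomial is a multiple of `(X + 1) ^ n`; for
  -- other `t` the affine substitution can be inverted.
  by_cases ht : t = 1
  · left
    refine ⟨ht, ?_⟩
    rw [Finset.sum_eq_single n] at hz
    · have hlc : (A.coeff n : ℂ) ≠ 0 := by
        rw [← hA]
        exact_mod_cast leadingCoeff_ne_zero.2 hA0
      simp only [Nat.sub_self, pow_zero, mul_one, mul_eq_zero, hlc, false_or] at hz
      have := eq_zero_of_pow_eq_zero hz
      rw [ht] at this
      rw [eq_neg_iff_add_eq_zero]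
      exact_mod_cast this
    · intro r hr hrn
      have h1 : n - r ≠ 0 := by
        have := Finset.mem_range.1 hr
        omega
      simp [ht, h1]
    · simp
  · right
    have ht' : (1 - t : ℂ) ≠ 0 := by
      rw [sub_ne_zero]
      exact_mod_cast Ne.symm ht
    refine ⟨(z + t) / (1 - t), ?_, by field_simp; ring⟩
    have e2 : (1 - t : ℂ) ^ n * aeval ((z + t) / (1 - t)) A =
        ∑ r ∈ Finset.range (n + 1), (A.coeff r : ℂ) * (1 - t) ^ (n - r) * (z + t) ^ r := by
      rw [aeval_eq_sum_range, hA, Finset.mul_sum]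
      refine Finset.sum_congr rfl fun r hr => ?_
      have h1 : n = (n - r) + r := by
        have := Finset.mem_range.1 hr
        omega
      conv_lhs => rw [h1, pow_add, div_pow]
      rw [Complex.real_smul]
      have := pow_ne_zero r ht'
      field_simp
    rw [← e2] at hz
    exact (mul_eq_zero.1 hz).resolve_left (pow_ne_zero _ ht')

/-- The admissible zeros form a convex set containing `-1`. Contracting all zeros to `-1` thus joins
any denominator inside the region to `(1 + p) ^ n`, whose coefficients are the binomial ones. -/
theorem isPreconnected_denRegionSingle {h : ℝ} (hh : 0 < h) (n : ℕ) :
    IsPreconnected (denRegionSingle h n) := by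
  refine isPreconnected_of_forall (fun r : Fin n => (n.choose (r + 1) : ℝ)) ?_
  rintro a ⟨h1, h2, h3⟩
  set A := denPoly a with hA
  have hA0 : A ≠ 0 := denPoly_ne_zero a
  have hn0 : A.coeff n ≠ 0 := (natDegree_denPoly_eq_iff a).1 h1
  set U : Set ℂ := {z | z.re < 0 ∧ 2 * |z.im| < 2 * Real.pi / h}
  have hzero : ∀ t ∈ Set.Icc (0 : ℝ) 1, ∀ z : ℂ, aeval z (contract A n t) = 0 → z ∈ U := by
    intro t ht z hz
    rcases exists_zero_of_aeval_contract h1 hA0 hz with ⟨-, rfl⟩ | ⟨w, hw, rfl⟩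
    · refine ⟨by simp, ?_⟩
      simp only [Complex.neg_im, Complex.one_im, neg_zero, abs_zero, mul_zero]
      have := Real.pi_pos
      positivity
    · have e : ((1 - t) * w - t : ℂ) = ((1 - t : ℝ) : ℂ) * w - (t : ℝ) := by push_cast; ring
      rw [e]
      have hw2 := h2 w hw
      have hw3 := h3 w hw
      refine ⟨?_, ?_⟩
      · rw [Complex.sub_re, Complex.re_ofReal_mul, Complex.ofReal_re]
        rcases ht.1.eq_or_lt with rfl | h0
        · simpa using hw2
        · nlinarith [ht.2]
      · rw [Complex.sub_im, Complex.im_ofReal_mul, Complex.ofReal_im, sub_zero, abs_mul,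
          abs_of_nonneg (by linarith [ht.2])]
        nlinarith [ht.1, abs_nonneg w.im]
  have hc0 : ∀ t ∈ Set.Icc (0 : ℝ) 1, (contract A n t).coeff 0 ≠ 0 := by
    intro t ht h0
    have := hzero t ht 0 (by rw [← coeff_zero_eq_aeval_zero', h0, map_zero])
    simp [U] at this
  -- The constant coefficient must be normalised to one. It is nonzero along the path because the
  -- origin is not an admissible zero.
  set γ : ℝ → Fin n → ℝ := fun t r => (contract A n t).coeff (r + 1) / (contract A n t).coeff 0
  have hγ : ∀ t ∈ Set.Icc (0 : ℝ) 1, denPoly (γ t) = C ((contract A n t).coeff 0)⁻¹ * contract A n t := by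
    intro t ht
    rw [← denPoly_coeff (n := n) (P := C ((contract A n t).coeff 0)⁻¹ * contract A n t)]
    · congr 1
      funext r
      rw [coeff_C_mul, ← div_eq_inv_mul]
    · exact (natDegree_C_mul_le _ _).trans (natDegree_contract_le A n t)
    · rw [coeff_C_mul, inv_mul_cancel₀ (hc0 t ht)]
  refine ⟨γ '' Set.Icc 0 1, ?_, ⟨1, by simp, ?_⟩, ⟨0, by simp, ?_⟩, isPreconnected_Icc.image _ ?_⟩
  · rintro _ ⟨t, ht, rfl⟩
    have hroot : ∀ z : ℂ, aeval z (denPoly (γ t)) = 0 → z ∈ U := by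
      intro z hz
      rw [hγ t ht, map_mul, aeval_C] at hz
      refine hzero t ht z ((mul_eq_zero.1 hz).resolve_left ?_)
      simpa using hc0 t ht
    refine ⟨?_, fun z hz => (hroot z hz).1, fun z hz => (hroot z hz).2⟩
    rw [natDegree_denPoly_eq_iff, hγ t ht, coeff_C_mul, coeff_contract_self]
    exact mul_ne_zero (inv_ne_zero (hc0 t ht)) hn0
  · funext r
    have e : ∀ k, (contract A n 1).coeff k = A.coeff n * n.choose k := by
      intro k
      rw [coeff_contract, Finset.sum_eq_single n]
      · simp
      · intro r hr hrn
        have : n - r ≠ 0 := by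
          have := Finset.mem_range.1 hr
          omega
        simp [this]
      · simp
    simp only [γ, e]
    field_simp
    simp
  · funext r
    have e : ∀ k ≤ n, (contract A n 0).coeff k = A.coeff k := by
      intro k hk
      rw [coeff_contract, Finset.sum_eq_single k]
      · simp
      · intro r hr hrn
        rcases lt_or_gt_of_ne hrn with h | h
        · simp [Nat.choose_eq_zero_of_lt h]
        · have : r - k ≠ 0 := by omega
          simp [this]
      · intro hk'
        simp at hk'
        omega
    simp only [γ]
    rw [e _ r.2, e 0 (Nat.zero_le _), hA, coeff_denPoly_zero, coeff_denPoly_succ, div_one]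
  · refine continuousOn_pi.2 fun r => ContinuousOn.div ?_ ?_ hc0
    all_goals
      simp only [coeff_contract]
      fun_prop

end DenPoly

section Region

variable {K : ℕ}

theorem denRegion_eq_pi (h : ℝ) (n : Fin K → ℕ) :
    denRegion h n = Set.univ.pi fun i => denRegionSingle h (n i) := by
  ext a
  simp [denRegion, denRegionSingle]

theorem isOpen_denRegion (h : ℝ) (n : Fin K → ℕ) : IsOpen (denRegion h n) := by
  rw [denRegion_eq_pi]
  exact isOpen_set_pi Set.finite_univ fun i _ => isOpen_denRegionSingle h (n i)

theorem isPreconnected_denRegion {h : ℝ} (hh : 0 < h) (n : Fin K → ℕ) :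
    IsPreconnected (denRegion h n) := by
  rw [denRegion_eq_pi]
  exact isPreconnected_univ_pi fun i => isPreconnected_denRegionSingle hh (n i)

end Region

/-! ### Models -/

section Model

variable {n m : ℕ}

theorem continuous_den : Continuous (den : Param n m → Fin n → ℝ) :=
  continuous_pi fun r => continuous_apply (Sum.inl r)

theorem aeval_polyB {S : Type*} [CommRing S] [Algebra ℝ S] (θ : Param n m) (z : S) :
    aeval z (polyB θ) = ∑ r : Fin (m + 1), θ (Sum.inr r) • z ^ r.val := by
  simp [polyB, Algebra.smul_def]

theorem natDegree_polyB_le (θ : Param n m) : (polyB θ).natDegree ≤ m :=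
  natDegree_sum_le_of_forall_le _ _ fun r _ =>
    (natDegree_C_mul_X_pow_le _ _).trans (Nat.lt_succ_iff.1 r.2)

theorem coeff_polyB (θ : Param n m) (r : Fin (m + 1)) : (polyB θ).coeff r = θ (Sum.inr r) := by
  simp [polyB, coeff_X_pow, Fin.val_inj]

/-- Coprimality becomes a condition at the complex zeros of the denominator only, which is the form
to which upper semicontinuity of the zeros applies. -/
theorem isModel_iff (θ : Param n m) : IsModel θ ↔ (polyA θ).natDegree = n ∧
    ∀ z : ℂ, aeval z (polyA θ) = 0 → z.re < 0 ∧ aeval z (polyB θ) ≠ 0 := by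
  rw [IsModel, isCoprime_iff_aeval_ne_zero_of_isAlgClosed ℝ ℂ]
  refine and_congr_right fun _ => ⟨fun h z hz => ⟨h.1 z hz, (h.2 z).resolve_left fun h => h hz⟩,
    fun h => ⟨fun z hz => (h z hz).1, fun z => ?_⟩⟩
  by_cases hz : aeval z (polyA θ) = 0
  exacts [Or.inr (h z hz).2, Or.inl hz]

theorem isOpen_isModel : IsOpen {θ : Param n m | IsModel θ} := by
  rw [isOpen_iff_eventually]
  intro θ hθ
  simp only [Set.mem_ofPred_eq, isModel_iff] at hθ ⊢
  have hW : IsOpen {p : Param n m × ℂ | p.2.re < 0 ∧ aeval p.2 (polyB p.1) ≠ 0} := by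
    refine (isOpen_lt (Complex.continuous_re.comp continuous_snd) continuous_const).inter (isOpen_ne_fun ?_ continuous_const)
    simp only [aeval_polyB]
    fun_prop
  exact (eventually_natDegree_denPoly continuous_den hθ.1).and
    (eventually_forall_zero_denPoly continuous_den ((natDegree_denPoly_eq_iff _).1 hθ.1) hW hθ.2)

end Model

/-! ### Algebra of transfer functions -/

section Transfer

variable {m : ℕ}

theorem transfer_add (B B' A : ℝ[X]) : transfer m (B + B') A = transfer m B A + transfer m B' A := by
  rw [transfer, map_add, add_mul, transfer, transfer]

theorem transfer_sub (B B' A : ℝ[X]) : transfer m (B - B') A = transfer m B A - transfer m B' A := by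
  rw [transfer, map_sub, sub_mul, transfer, transfer]

theorem transfer_neg (B A : ℝ[X]) : transfer m (-B) A = -transfer m B A := by
  rw [transfer, map_neg, neg_mul, transfer]

theorem transfer_zero (A : ℝ[X]) : transfer m 0 A = 0 := by
  rw [transfer, map_zero, zero_mul]

theorem transfer_C_mul (c : ℝ) (B A : ℝ[X]) : transfer m (C c * B) A = c • transfer m B A := by
  rw [transfer, map_mul, aeval_C, mul_assoc, ← Algebra.smul_def, transfer]

theorem transfer_sum {ι : Type*} (s : Finset ι) (B : ι → ℝ[X]) (A : ℝ[X]) :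
    transfer m (∑ i ∈ s, B i) A = ∑ i ∈ s, transfer m (B i) A := by
  rw [transfer, map_sum, Finset.sum_mul]
  rfl

theorem eq_sum_fin_coeff {B : ℝ[X]} {d : ℕ} (hB : B.natDegree < d) :
    B = ∑ r : Fin d, C (B.coeff r) * X ^ (r : ℕ) := by
  conv_lhs => rw [B.as_sum_range_C_mul_X_pow' hB]
  rw [Finset.sum_range]

theorem transfer_mul (B B' A A' : ℝ[X]) :
    transfer m (B * B') (A * A') = transfer m B A * transfer m B' A' := by
  simp only [transfer, map_mul, Ring.mul_inverse_rev]
  ring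

theorem transfer_self {A : ℝ[X]} (hA : HasZerosIn m A) : transfer m A A = 1 :=
  Ring.mul_inverse_cancel _ hA.isUnit

theorem transfer_mul_cancel {E : ℝ[X]} (hE : HasZerosIn m E) (B A : ℝ[X]) :
    transfer m (B * E) (A * E) = transfer m B A := by
  rw [transfer_mul, transfer_self hE, mul_one]

theorem transfer_sub_transfer {A A' : ℝ[X]} (hA : HasZerosIn m A) (hA' : HasZerosIn m A')
    (B B' : ℝ[X]) :
    transfer m B A - transfer m B' A' = transfer m (B * A' - B' * A) (A * A') := by
  rw [transfer_sub, transfer_mul_cancel hA', mul_comm A A', transfer_mul_cancel hA]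

theorem transfer_C_mul_den {c : ℝ} (hc : c ≠ 0) {A : ℝ[X]} (B : ℝ[X]) :
    transfer m (C c * B) (C c * A) = transfer m B A := by
  rw [transfer_mul]
  have : transfer m (C c) (C c) = 1 := by
    rw [transfer, aeval_C, Ring.mul_inverse_cancel]
    exact (IsUnit.mk0 c hc).map (algebraMap ℝ (CircleFun m))
  rw [this, one_mul]

theorem continuousAt_transfer {Y : Type*} [TopologicalSpace Y] {B A : Y → ℝ[X]} {y : Y}
    (hB : ContinuousAt (fun y => aeval (idFun m) (B y)) y)
    (hA : ContinuousAt (fun y => aeval (idFun m) (A y)) y) (h : HasZerosIn m (A y)) :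
    ContinuousAt (fun y => transfer m (B y) (A y)) y := by
  obtain ⟨x, hx⟩ := h.isUnit
  have := NormedRing.inverse_continuousAt x
  rw [hx] at this
  exact hB.mul (ContinuousAt.comp (f := fun y => aeval (idFun m) (A y)) this hA)

theorem analyticAt_transfer {E : Type*} [NormedAddCommGroup E] [NormedSpace ℝ E] {A : E → ℝ[X]}
    {e : E} (B : ℝ[X]) (hA : AnalyticAt ℝ (fun e => aeval (idFun m) (A e)) e)
    (h : HasZerosIn m (A e)) : AnalyticAt ℝ (fun e => transfer m B (A e)) e := by
  obtain ⟨x, hx⟩ := h.isUnit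
  have := analyticAt_inverse (𝕜 := ℝ) x
  rw [hx] at this
  exact analyticAt_const.mul (AnalyticAt.comp (f := fun e => aeval (idFun m) (A e)) this hA)

/-- The quotient rule in the Banach algebra. -/
theorem hasDerivAt_transfer_line {A : ℝ[X]} (hA : HasZerosIn m A) (B A' B' : ℝ[X]) :
    HasDerivAt (fun t : ℝ => transfer m (B + C t * B') (A + C t * A'))
      (transfer m (B' * A - B * A') (A ^ 2)) 0 := by
  obtain ⟨x, hx⟩ := hA.isUnit
  have e : ∀ (P Q : ℝ[X]) (t : ℝ), aeval (idFun m) (P + C t * Q) =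
      aeval (idFun m) P + t • aeval (idFun m) Q := fun P Q t => by
    rw [map_add, map_mul, aeval_C, ← Algebra.smul_def]
  have hline : ∀ P Q : ℝ[X], HasDerivAt (fun t : ℝ => aeval (idFun m) (P + C t * Q))
      (aeval (idFun m) Q) 0 := fun P Q => by
    simp only [e]
    simpa using ((hasDerivAt_id (0 : ℝ)).smul_const (aeval (idFun m) Q)).const_add
      (aeval (idFun m) P)
  have hinv := hasFDerivAt_ringInverse (𝕜 := ℝ) x
  have hinv' : HasFDerivAt Ring.inverse (-ContinuousLinearMap.mulLeftRight ℝ (CircleFun m)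
      ↑x⁻¹ ↑x⁻¹) (aeval (idFun m) (A + C (0 : ℝ) * A')) := by
    rwa [map_zero, zero_mul, add_zero, ← hx]
  have h := (hline B B').mul (hinv'.comp_hasDerivAt (0 : ℝ) (hline A A'))
  refine h.congr_deriv ?_
  have hxi : (↑x⁻¹ : CircleFun m) = Ring.inverse (aeval (idFun m) A) := by
    rw [← hx, Ring.inverse_unit]
  have hc := Ring.mul_inverse_cancel _ hA.isUnit
  have hp : Ring.inverse (aeval (idFun m) A ^ 2) = Ring.inverse (aeval (idFun m) A) ^ 2 := by
    rw [pow_two, Ring.mul_inverse_rev, pow_two]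
  simp only [map_zero, zero_mul, add_zero, Function.comp_apply, neg_apply,
    ContinuousLinearMap.mulLeftRight_apply, hxi, transfer, map_sub, map_mul, map_pow, hp]
  linear_combination (-(aeval (idFun m) B') * Ring.inverse (aeval (idFun m) A)) * hc

end Transfer

/-! ### The transfer functions of a model and their gradients -/

section Gradient

variable {m : ℕ} {p q : ℕ}

/-- The transfer function of the model `θ`. -/
def modelFun (m : ℕ) (θ : Param p q) : CircleFun m := transfer m (polyB θ) (polyA θ)

/-- The gradient of the transfer function of the model `θ`. -/
def gradFun (m : ℕ) (θ : Param p q) : Fin p ⊕ Fin (q + 1) → CircleFun m :=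
  Sum.elim (fun r => transfer m (-(X ^ (r.val + 1) * polyB θ)) (polyA θ ^ 2))
    (fun r => transfer m (X ^ r.val) (polyA θ))

/-- The parameters of a model of order `p` with poles inside the `m`-th circle. -/
def modelSet (m p q : ℕ) : Set (Param p q) :=
  {θ | (polyA θ).natDegree = p ∧ HasZerosIn m (polyA θ)}

theorem isOpen_modelSet : IsOpen (modelSet m p q) := by
  rw [isOpen_iff_eventually]
  intro θ hθ
  exact (eventually_natDegree_denPoly continuous_den hθ.1).and
    (eventually_hasZerosIn_denPoly continuous_den hθ.1 hθ.2)

theorem polyA_ne_zero (θ : Param p q) : polyA θ ≠ 0 := denPoly_ne_zero _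

theorem eventually_mem_modelSet {θ : Param p q} (hd : (polyA θ).natDegree = p)
    (hs : IsStable (polyA θ)) : ∀ᶠ m in atTop, θ ∈ modelSet m p q :=
  (hs.eventually_hasZerosIn (polyA_ne_zero θ)).mono fun _ hm => ⟨hd, hm⟩

theorem IsModel.eventually_mem_modelSet {θ : Param p q} (hθ : IsModel θ) :
    ∀ᶠ m in atTop, θ ∈ modelSet m p q :=
  BlockDescent.eventually_mem_modelSet hθ.1 hθ.2.1

theorem continuous_aeval_polyA : Continuous fun θ : Param p q => aeval (idFun m) (polyA θ) := by
  simp only [polyA, aeval_denPoly, den]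
  fun_prop

theorem continuous_aeval_polyB : Continuous fun θ : Param p q => aeval (idFun m) (polyB θ) := by
  simp only [aeval_polyB]
  fun_prop

theorem continuousAt_modelFun {θ : Param p q} (h : θ ∈ modelSet m p q) :
    ContinuousAt (modelFun m) θ :=
  continuousAt_transfer continuous_aeval_polyB.continuousAt continuous_aeval_polyA.continuousAt h.2

theorem continuousAt_transfer_polyA (B : ℝ[X]) {θ : Param p q} (h : θ ∈ modelSet m p q) :
    ContinuousAt (fun θ : Param p q => transfer m B (polyA θ)) θ :=
  continuousAt_transfer continuousAt_const continuous_aeval_polyA.continuousAt h.2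

theorem continuousAt_transfer_polyB_sq (B : ℝ[X]) {θ : Param p q} (h : θ ∈ modelSet m p q) :
    ContinuousAt (fun θ : Param p q => transfer m (B * polyB θ) (polyA θ ^ 2)) θ := by
  refine continuousAt_transfer ?_ ?_ (h.2.pow 2)
  · simp only [map_mul]
    exact continuousAt_const.mul continuous_aeval_polyB.continuousAt
  · simp only [map_pow]
    exact continuous_aeval_polyA.continuousAt.pow 2

theorem continuousAt_gradFun (a : Fin p ⊕ Fin (q + 1)) {θ : Param p q}
    (h : θ ∈ modelSet m p q) : ContinuousAt (fun θ => gradFun m θ a) θ := by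
  rcases a with r | r
  · simp only [gradFun, Sum.elim_inl, ← neg_mul]
    exact continuousAt_transfer_polyB_sq _ h
  · exact continuousAt_transfer_polyA _ h

/-- Both polynomials are affine in the parameters, so a coordinate direction is a line as in
`hasDerivAt_transfer_line`. This justifies calling the instrument a gradient. -/
theorem hasDerivAt_modelFun (a : Fin p ⊕ Fin (q + 1)) {θ : Param p q}
    (h : θ ∈ modelSet m p q) :
    HasDerivAt (fun t : ℝ => modelFun m (θ + t • Pi.single a 1)) (gradFun m θ a) 0 := by
  have hA : ∀ t : ℝ, polyA (θ + t • Pi.single a 1) =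
      polyA θ + C t * Sum.elim (fun r : Fin p => X ^ (r.val + 1)) (fun _ => 0) a := by
    intro t
    have e : ∀ r : Fin p, den (θ + t • Pi.single a 1) r =
        den θ r + t * (Pi.single a (1 : ℝ) : Param p q) (Sum.inl r) := fun r => by
      simp [den]
    simp only [polyA, denPoly, e, map_add, add_mul, Finset.sum_add_distrib]
    rw [add_assoc]
    congr 2
    rcases a with s | s
    · rw [Finset.sum_eq_single s]
      · simp
      · intro r _ hr
        simp [hr]
      · simp
    · simp
  have hB : ∀ t : ℝ, polyB (θ + t • Pi.single a 1) =
      polyB θ + C t * Sum.elim (fun _ => 0) (fun r : Fin (q + 1) => X ^ r.val) a := by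
    intro t
    simp only [polyB, Pi.add_apply, Pi.smul_apply, smul_eq_mul, map_add, add_mul,
      Finset.sum_add_distrib]
    congr 1
    rcases a with s | s
    · simp
    · rw [Finset.sum_eq_single s]
      · simp
      · intro r _ hr
        simp [hr]
      · simp
  simp only [modelFun, hA, hB]
  refine (hasDerivAt_transfer_line h.2 _ _ _).congr_deriv ?_
  rcases a with s | s
  · simp [gradFun, mul_comm]
  · simp only [Sum.elim_inr, mul_zero, sub_zero, gradFun]
    rw [pow_two, transfer_mul_cancel h.2]

end Gradient

/-! ### Filtered inputs as random variables on the path space -/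

theorem response_shift (m : ℕ) (h : ℝ) (w : ℤ → ℝ) (k : ℤ) :
    response m h (fun l => w (l + k)) 0 = response m h w k := by
  simp only [response]
  congr 1
  funext j
  congr 2
  ring

section Paths

variable {K : ℕ}

/-- The sample path of the input `i`. -/
def inputPath (i : Fin K) (x : PathSpace K) : ℤ → ℝ := fun k => (x k).1 i

/-- The sample path of the disturbance. -/
def noisePath (x : PathSpace K) : ℤ → ℝ := fun k => (x k).2

/-- The filtered input `i` at time `0`. -/
def filteredInput (m : ℕ) (h : ℝ) (i : Fin K) (f : CircleFun m) (x : PathSpace K) : ℝ :=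
  response m h (inputPath i x) 0 f

/-- The properties of the law of the sample paths common to both setups. -/
structure SignalLaw (μ : Measure (PathSpace K)) : Prop where
  ergodic : Ergodic (shift 1) μ
  memLp_input : ∀ i, MemLp (fun x => inputPath i x 0) 2 μ
  memLp_noise : MemLp (fun x => noisePath x 0) 2 μ
  integral_input_mul_noise : ∀ i k, ∫ x, inputPath i x k * noisePath x 0 ∂μ = 0

theorem inputPath_shift (i : Fin K) (k l : ℤ) (x : PathSpace K) :
    inputPath i (shift k x) l = inputPath i x (l + k) := rfl

theorem noisePath_shift (k l : ℤ) (x : PathSpace K) :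
    noisePath (shift k x) l = noisePath x (l + k) := rfl

theorem filteredInput_shift (m : ℕ) (h : ℝ) (i : Fin K) (f : CircleFun m) (k : ℤ)
    (x : PathSpace K) : filteredInput m h i f (shift k x) = response m h (inputPath i x) k f := by
  rw [filteredInput, ← response_shift m h (inputPath i x) k]
  rfl

variable {μ : Measure (PathSpace K)} {m : ℕ} {h : ℝ}

theorem SignalLaw.memLp_input_at (hμ : SignalLaw μ) (i : Fin K) (k : ℤ) :
    MemLp (fun x => inputPath i x k) 2 μ := by
  refine ((hμ.memLp_input i).comp_measurePreserving
    (measurePreserving_shift hμ.ergodic k)).ae_eq (Eventually.of_forall fun x => ?_)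
  simp [inputPath_shift]

theorem SignalLaw.ae_subexp_input (hμ : SignalLaw μ) :
    ∀ᵐ x ∂μ, ∀ i, Subexp (inputPath i x) := by
  refine ae_all_iff.2 fun i => ?_
  filter_upwards [ae_subexp hμ.ergodic (hμ.memLp_input i)] with x hx
  simpa [inputPath_shift] using hx

theorem SignalLaw.ae_subexp_noise (hμ : SignalLaw μ) : ∀ᵐ x ∂μ, Subexp (noisePath x) := by
  filter_upwards [ae_subexp hμ.ergodic hμ.memLp_noise] with x hx
  simpa [noisePath_shift] using hx

theorem SignalLaw.dominated_filteredInput (hμ : SignalLaw μ) (hh : 0 < h) {Θ : Type*}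
    [TopologicalSpace Θ] (i : Fin K) {f : Θ → CircleFun m} (hf : Continuous f) :
    Dominated μ fun θ x => filteredInput m h i (f θ) x := by
  refine ((dominated_const (Θ := Θ) (hμ.memLp_input i)).filter hμ.ergodic hh hf).congr ?_
  filter_upwards [hμ.ae_subexp_input] with x hx θ
  rw [filteredInput, ← ((hx i).hasSum_response hh 0 (f θ)).tsum_eq]
  simp [inputPath_shift]

theorem SignalLaw.memLp_filteredInput (hμ : SignalLaw μ) (hh : 0 < h) (i : Fin K)
    (f : CircleFun m) : MemLp (filteredInput m h i f) 2 μ :=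
  (hμ.dominated_filteredInput hh i (continuous_const (y := f)) (Θ := Unit)).memLp ()

/-- The bounding variable and the exceptional null set do not depend on the filter. This uniformity
makes correlations jointly continuous in the filters. -/
theorem SignalLaw.exists_abs_filteredInput_le (hμ : SignalLaw μ) (hh : 0 < h) (m : ℕ) (i : Fin K) :
    ∃ Z : PathSpace K → ℝ, (∀ x, 0 ≤ Z x) ∧ MemLp Z 2 μ ∧
      ∀ᵐ x ∂μ, ∀ f : CircleFun m, |filteredInput m h i f x| ≤ Z x * ‖f‖ := by
  obtain ⟨c, hc, hcf⟩ := exists_abs_coef_le m hh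
  obtain ⟨Z, hZ0, hZ, hZx⟩ := exists_memLp_tsum_le hμ.ergodic
    (Z := fun x => |inputPath i x 0|) (fun x => abs_nonneg _) (hμ.memLp_input i).abs
    (decay_pos m h) (decay_lt_one m hh)
  refine ⟨fun x => c * Z x, fun x => mul_nonneg hc (hZ0 x), hZ.const_mul c, ?_⟩
  filter_upwards [hZx, hμ.ae_subexp_input] with x hx hs f
  have hS := (hs i).hasSum_response (m := m) hh 0 f
  have hb : ∀ j : ℕ, ‖coef m h j f * inputPath i x (0 - j)‖ ≤
      c * ‖f‖ * (decay m h ^ j * |inputPath i (shift (-j) x) 0|) := fun j => by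
    rw [norm_mul, Real.norm_eq_abs, Real.norm_eq_abs, inputPath_shift, zero_sub, zero_add]
    calc _ ≤ (c * decay m h ^ j * ‖f‖) * |inputPath i x (-j)| := by gcongr; exact hcf j f
      _ = _ := by ring
  rw [filteredInput, ← hS.tsum_eq, ← Real.norm_eq_abs]
  calc _ ≤ ∑' j : ℕ, c * ‖f‖ * (decay m h ^ j * |inputPath i (shift (-j) x) 0|) :=
        tsum_of_norm_bounded (hx.1.mul_left _).hasSum hb
    _ = c * ‖f‖ * ∑' j : ℕ, (decay m h ^ j * |inputPath i (shift (-j) x) 0|) := tsum_mul_left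
    _ ≤ c * ‖f‖ * Z x := by gcongr; exact hx.2
    _ = _ := by ring

theorem SignalLaw.hasSum_integral_filteredInput_mul (hμ : SignalLaw μ) (hh : 0 < h) (i : Fin K)
    (f : CircleFun m) {W : PathSpace K → ℝ} (hW : MemLp W 2 μ) :
    HasSum (fun j : ℕ => coef m h j f * ∫ x, inputPath i x (-j) * W x ∂μ)
      (∫ x, filteredInput m h i f x * W x ∂μ) := by
  obtain ⟨c, hc, hcf⟩ := exists_abs_coef_le m hh
  set F : ℕ → PathSpace K → ℝ := fun j x => coef m h j f * (inputPath i x (-j) * W x)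
  have hint : ∀ j : ℕ, Integrable (fun x => inputPath i x (-j) * W x) μ := fun j =>
    (hμ.memLp_input_at i (-j)).integrable_mul hW
  have hF : ∀ j, Integrable (F j) μ := fun j => (hint j).const_mul _
  have hsq := (hμ.memLp_input i).integrable_sq
  have hb : ∀ j, ∫ x, ‖F j x‖ ∂μ ≤ (c * ‖f‖ * (∫ x, inputPath i x 0 ^ 2 ∂μ + ∫ x, W x ^ 2 ∂μ)) *
      decay m h ^ j := fun j => by
    have e : ∫ x, inputPath i x (-j) ^ 2 ∂μ = ∫ x, inputPath i x 0 ^ 2 ∂μ := by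
      rw [← integral_comp_measurePreserving (measurePreserving_shift hμ.ergodic (-j))
        hsq.aestronglyMeasurable]
      simp [inputPath_shift]
    calc ∫ x, ‖F j x‖ ∂μ = |coef m h j f| * ∫ x, |inputPath i x (-j) * W x| ∂μ := by
          simp only [F, norm_mul, Real.norm_eq_abs, integral_const_mul, abs_mul]
      _ ≤ |coef m h j f| * ∫ x, (inputPath i x (-j) ^ 2 + W x ^ 2) ∂μ := by
          gcongr
          · exact (hint j).abs
          · exact (hμ.memLp_input_at i (-j)).integrable_sq.add hW.integrable_sq
          · intro x
            simp only [abs_mul]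
            nlinarith [sq_abs (inputPath i x (-j)), sq_abs (W x),
              sq_nonneg (|inputPath i x (-j)| - |W x|), sq_nonneg (|inputPath i x (-j)| + |W x|)]
      _ = |coef m h j f| * (∫ x, inputPath i x 0 ^ 2 ∂μ + ∫ x, W x ^ 2 ∂μ) := by
          rw [integral_add (hμ.memLp_input_at i (-j)).integrable_sq hW.integrable_sq, e]
      _ ≤ (c * decay m h ^ j * ‖f‖) * (∫ x, inputPath i x 0 ^ 2 ∂μ + ∫ x, W x ^ 2 ∂μ) := by
          gcongr
          exact hcf j f
      _ = _ := by ring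
  have hsum : Summable fun j => ∫ x, ‖F j x‖ ∂μ :=
    Summable.of_nonneg_of_le (fun j => integral_nonneg fun x => norm_nonneg _) hb
      ((summable_geometric_of_lt_one (decay_pos m h).le (decay_lt_one m hh)).mul_left _)
  have hS := hasSum_integral_of_summable_integral_norm hF hsum
  have e1 : ∫ x, ∑' j, F j x ∂μ = ∫ x, filteredInput m h i f x * W x ∂μ := by
    refine integral_congr_ae ?_
    filter_upwards [hμ.ae_subexp_input] with x hx
    have := ((hx i).hasSum_response (m := m) hh 0 f).mul_right (W x)
    rw [filteredInput, ← this.tsum_eq]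
    simp only [F, zero_sub, mul_assoc]
  rw [e1] at hS
  simpa only [F, integral_const_mul] using hS

/-! ### Correlations of filtered inputs -/

theorem SignalLaw.integral_filteredInput_mul_noise (hμ : SignalLaw μ) (hh : 0 < h) (i : Fin K)
    (f : CircleFun m) : ∫ x, filteredInput m h i f x * noisePath x 0 ∂μ = 0 := by
  have := hμ.hasSum_integral_filteredInput_mul hh i f hμ.memLp_noise
  simp only [hμ.integral_input_mul_noise, mul_zero] at this
  exact this.unique hasSum_zero

theorem SignalLaw.integral_filteredInput_mul_eq_zero (hμ : SignalLaw μ) (hh : 0 < h) {i j : Fin K}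
    (hij : ∀ k l, ∫ x, inputPath i x k * inputPath j x l ∂μ = 0) (f g : CircleFun m) :
    ∫ x, filteredInput m h i f x * filteredInput m h j g x ∂μ = 0 := by
  have h1 : ∀ k, ∫ x, filteredInput m h j g x * inputPath i x k ∂μ = 0 := fun k => by
    have := hμ.hasSum_integral_filteredInput_mul hh j g (hμ.memLp_input_at i k)
    have e : ∀ l, ∫ x, inputPath j x l * inputPath i x k ∂μ = 0 := fun l => by
      simpa only [mul_comm] using hij k l
    simp only [e, mul_zero] at this
    exact this.unique hasSum_zero
  have := hμ.hasSum_integral_filteredInput_mul hh i f (hμ.memLp_filteredInput hh j g)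
  have e : ∀ k, ∫ x, inputPath i x k * filteredInput m h j g x ∂μ = 0 := fun k => by
    simpa only [mul_comm] using h1 k
  simp only [e, mul_zero] at this
  exact this.unique hasSum_zero

theorem SignalLaw.integrable_filteredInput_mul (hμ : SignalLaw μ) (hh : 0 < h) (i j : Fin K)
    (f g : CircleFun m) :
    Integrable (fun x => filteredInput m h i f x * filteredInput m h j g x) μ :=
  (hμ.memLp_filteredInput hh i f).integrable_mul (hμ.memLp_filteredInput hh j g)

/-- The correlation of the filtered inputs is a continuous bilinear form in the filters. -/
theorem SignalLaw.exists_correlation (hμ : SignalLaw μ) (hh : 0 < h) (m : ℕ) (i j : Fin K) :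
    ∃ b : CircleFun m →L[ℝ] CircleFun m →L[ℝ] ℝ, ∀ f g,
      b f g = ∫ x, filteredInput m h i f x * filteredInput m h j g x ∂μ := by
  obtain ⟨Z, hZ0, hZ, hZx⟩ := hμ.exists_abs_filteredInput_le hh m i
  obtain ⟨Z', hZ0', hZ', hZx'⟩ := hμ.exists_abs_filteredInput_le hh m j
  have hint := hμ.integrable_filteredInput_mul hh i j (m := m)
  refine ⟨LinearMap.mkContinuous₂ (LinearMap.mk₂ ℝ
    (fun f g : CircleFun m => ∫ x, filteredInput m h i f x * filteredInput m h j g x ∂μ)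
    ?_ ?_ ?_ ?_) (∫ x, Z x * Z' x ∂μ) ?_, fun f g => rfl⟩
  · intro f f' g
    rw [← integral_add (hint f g) (hint f' g)]
    simp only [filteredInput, map_add, add_mul]
  · intro c f g
    rw [smul_eq_mul, ← integral_const_mul]
    simp only [filteredInput, map_smul, smul_eq_mul, mul_assoc]
  · intro f g g'
    rw [← integral_add (hint f g) (hint f g')]
    simp only [filteredInput, map_add, mul_add]
  · intro c f g
    rw [smul_eq_mul, ← integral_const_mul]
    simp only [filteredInput, map_smul, smul_eq_mul, mul_left_comm]
  · intro f g
    rw [LinearMap.mk₂_apply]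
    calc _ ≤ ∫ x, Z x * Z' x * (‖f‖ * ‖g‖) ∂μ := by
          refine norm_integral_le_of_norm_le ((hZ.integrable_mul hZ').mul_const _) ?_
          filter_upwards [hZx, hZx'] with x hx hx'
          rw [norm_mul]
          calc _ ≤ (Z x * ‖f‖) * (Z' x * ‖g‖) :=
                mul_le_mul (hx f) (hx' g) (abs_nonneg _)
                  (mul_nonneg (hZ0 x) (norm_nonneg _))
            _ = _ := by ring
      _ = _ := by rw [integral_mul_const]; ring

end Paths

/-! ### Persistence of excitation -/

section Excitation

variable {K : ℕ}

/-- No nontrivial combination of `r` consecutive samples of the input vanishes. -/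
def Exciting (μ : Measure (PathSpace K)) (i : Fin K) (r : ℕ) : Prop :=
  ∀ ν : ℕ → ℝ, (∀ᵐ x ∂μ, ∑ s ∈ Finset.range r, ν s * inputPath i x s = 0) → ∀ s < r, ν s = 0

variable {μ : Measure (PathSpace K)}

theorem Exciting.mono {i : Fin K} {r r' : ℕ} (hr : r' ≤ r) (h : Exciting μ i r) :
    Exciting μ i r' := by
  intro ν hν s hs
  have := h (fun s => if s < r' then ν s else 0) ?_ s (hs.trans_le hr)
  · simpa [hs] using this
  · filter_upwards [hν] with x hx
    refine Eq.trans ?_ hx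
    rw [← Finset.sum_subset (Finset.range_subset_range.2 hr)]
    · refine Finset.sum_congr rfl fun s hs => ?_
      simp [Finset.mem_range.1 hs]
    · intro s _ hs
      simp only [Finset.mem_range] at hs
      simp [hs]

/-- The quadratic form of the covariance matrix is the second moment of the corresponding
combination of samples. -/
theorem SignalLaw.exciting (hμ : SignalLaw μ) {i : Fin K} {r : ℕ}
    (hr : IsPersistentlyExciting μ (fun k x => inputPath i x k) r) : Exciting μ i r := by
  intro ν hν s hs
  by_contra hne
  set c : Fin r → ℝ := fun a => ν a
  have hc : c ≠ 0 := fun h => hne (congrFun h ⟨s, hs⟩)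
  have hpos := hr.dotProduct_mulVec_pos hc
  refine hpos.ne' ?_
  have e : ∀ a b : Fin r, c a * ((∫ x, inputPath i x a * inputPath i x b ∂μ) * c b) =
      ∫ x, (c a * inputPath i x a) * (c b * inputPath i x b) ∂μ := fun a b => by
    rw [← integral_mul_const, ← integral_const_mul]
    congr 1
    funext x
    ring
  have hint : ∀ a b : Fin r, Integrable
      (fun x => (c a * inputPath i x a) * (c b * inputPath i x b)) μ := fun a b =>
    ((hμ.memLp_input_at i a).const_mul (c a)).integrable_mul
      ((hμ.memLp_input_at i b).const_mul (c b))
  simp only [dotProduct, Matrix.mulVec, Matrix.of_apply, star_trivial, Finset.mul_sum, e]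
  simp only [← integral_finsetSum _ fun b _ => hint _ b]
  rw [← integral_finsetSum]
  · refine integral_eq_zero_of_ae ?_
    filter_upwards [hν] with x hx
    rw [Finset.sum_range] at hx
    simp only [← Finset.mul_sum, ← Finset.sum_mul, Pi.zero_apply]
    rw [mul_eq_zero]
    exact Or.inl hx
  · exact fun a _ => integrable_finsetSum _ fun b _ => hint a b

end Excitation

/-! ### Sampled responses of filters with real poles -/

section Sampled

/-- The monic polynomial with zeros `s`. -/
def rootPoly (s : Multiset ℝ) : ℝ[X] := (s.map fun w => X - C w).prod

/-- The monic polynomial with zeros `exp (h w)`, for `w` in `s`. -/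
def sampledPoly (h : ℝ) (s : Multiset ℝ) : ℝ[X] := (s.map fun w => X - C (Real.exp (h * w))).prod

/-- The entire function `(exp (h z) - exp (h w)) / (z - w)`. -/
def expQuot (h w : ℝ) : ℂ → ℂ := dslope (fun z => Complex.exp (h * z)) w

variable {h : ℝ}

theorem natDegree_rootPoly (s : Multiset ℝ) : (rootPoly s).natDegree = s.card :=
  natDegree_multiset_prod_X_sub_C_eq_card s

theorem monic_rootPoly (s : Multiset ℝ) : (rootPoly s).Monic :=
  monic_multiset_prod_of_monic _ _ fun w _ => monic_X_sub_C w

theorem rootPoly_cons (w : ℝ) (s : Multiset ℝ) : rootPoly (w ::ₘ s) = (X - C w) * rootPoly s := by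
  rw [rootPoly, Multiset.map_cons, Multiset.prod_cons, rootPoly]

theorem sampledPoly_eq (h : ℝ) (s : Multiset ℝ) :
    sampledPoly h s = rootPoly (s.map fun w => Real.exp (h * w)) := by
  rw [sampledPoly, rootPoly, Multiset.map_map]
  rfl

theorem natDegree_sampledPoly (h : ℝ) (s : Multiset ℝ) : (sampledPoly h s).natDegree = s.card := by
  rw [sampledPoly_eq, natDegree_rootPoly, Multiset.card_map]

theorem coeff_sampledPoly_card (h : ℝ) (s : Multiset ℝ) : (sampledPoly h s).coeff s.card = 1 := by
  have := monic_rootPoly (s.map fun w => Real.exp (h * w))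
  rwa [Monic, leadingCoeff, natDegree_rootPoly, Multiset.card_map, ← sampledPoly_eq] at this

theorem hasZerosIn_rootPoly {m : ℕ} {s : Multiset ℝ} :
    HasZerosIn m (rootPoly s) ↔ ∀ w ∈ s, (w : ℂ) ∈ Metric.ball (ctr m) (rad m) := by
  have e : ∀ z : ℂ, aeval z (rootPoly s) = (s.map fun w : ℝ => z - w).prod := fun z => by
    rw [rootPoly, map_multiset_prod, Multiset.map_map]
    simp
  constructor
  · intro hs w hw
    refine hs.2 w ?_
    rw [e]
    exact Multiset.prod_eq_zero (Multiset.mem_map.2 ⟨w, hw, sub_self _⟩)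
  · refine fun hs => ⟨(monic_rootPoly s).ne_zero, fun z hz => ?_⟩
    rw [e, Multiset.prod_eq_zero_iff, Multiset.mem_map] at hz
    obtain ⟨w, hw, hzw⟩ := hz
    rw [sub_eq_zero.1 hzw]
    exact hs w hw

theorem differentiable_expQuot (h w : ℝ) : Differentiable ℂ (expQuot h w) := by
  rw [← differentiableOn_univ, expQuot, Complex.differentiableOn_dslope Filter.univ_mem]
  fun_prop

theorem sub_mul_expQuot (h w : ℝ) (z : ℂ) :
    (z - w) * expQuot h w z = Complex.exp (h * z) - Real.exp (h * w) := by
  have := sub_smul_dslope (fun z : ℂ => Complex.exp (h * z)) w z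
  rw [smul_eq_mul] at this
  rw [expQuot, this]
  push_cast
  rfl

/-- This is where real poles are convenient: the real exponential is injective, so distinct poles
stay distinct after sampling, and at a coincidence the quotient is the derivative `h exp (h w)`. -/
theorem expQuot_ne_zero (hh : 0 < h) (w z : ℝ) : expQuot h w z ≠ 0 := by
  rcases eq_or_ne z w with rfl | hne
  · have : HasDerivAt (fun z : ℂ => Complex.exp (h * z)) (Complex.exp (h * z) * h) z := by
      simpa using ((hasDerivAt_id (z : ℂ)).const_mul (h : ℂ)).cexp
    rw [expQuot, dslope_same, this.deriv]
    exact mul_ne_zero (Complex.exp_ne_zero _) (by exact_mod_cast hh.ne')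
  · intro h0
    have := sub_mul_expQuot h w z
    rw [h0, mul_zero] at this
    have h1 : Real.exp (h * z) = Real.exp (h * w) := by
      have := sub_eq_zero.1 this.symm
      exact_mod_cast this
    exact hne (mul_left_cancel₀ hh.ne' (Real.exp_injective h1))

theorem aeval_exp_sampledPoly (h : ℝ) (s : Multiset ℝ) (z : ℂ) :
    aeval (Complex.exp (h * z)) (sampledPoly h s) =
      aeval z (rootPoly s) * (s.map fun w => expQuot h w z).prod := by
  induction s using Multiset.induction_on with
  | empty => simp [sampledPoly, rootPoly]
  | cons w s ih =>
    rw [sampledPoly, Multiset.map_cons, Multiset.prod_cons, map_mul, ← sampledPoly, ih,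
      rootPoly_cons, map_mul, Multiset.map_cons, Multiset.prod_cons]
    have := sub_mul_expQuot h w z
    simp only [map_sub, aeval_X, aeval_C, Complex.coe_algebraMap]
    rw [← this]
    ring

theorem differentiable_prod_expQuot (h : ℝ) (s : Multiset ℝ) :
    Differentiable ℂ fun z => (s.map fun w => expQuot h w z).prod := by
  induction s using Multiset.induction_on with
  | empty => simp
  | cons w s ih =>
    simp only [Multiset.map_cons, Multiset.prod_cons]
    exact (differentiable_expQuot h w).mul ih

/-- Delaying by one sample multiplies the kernel by `exp (h z)`, so applying the recurrence `P` to
the coefficients multiplies it by `P (exp (h z))`. -/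
theorem sum_coeff_mul_coef {m : ℕ} {A B : ℝ[X]} (hA : HasZerosIn m A)
    (hB : B.natDegree ≤ A.natDegree) (P : ℝ[X]) (j : ℕ) :
    ((∑ l ∈ Finset.range (P.natDegree + 1), P.coeff l * coef m h (j + l + 1) (transfer m B A) : ℝ)
      : ℂ) = contour m (idInv m * (expFun m h - 1) * expFun m (j * h) *
        aeval (expFun m h) P * transfer m B A) := by
  have e : ∀ l : ℕ, expFun m ((j + l : ℕ) * h) = expFun m (j * h) * expFun m h ^ l := fun l => by
    ext z
    simp only [ContinuousMap.mul_apply, ContinuousMap.pow_apply, expFun_apply, ← Complex.exp_nat_mul,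
      ← Complex.exp_add]
    congr 1
    push_cast
    ring
  push_cast
  simp only [ofReal_coef h hA hB, kern, e]
  rw [aeval_eq_sum_range, Finset.mul_sum, Finset.sum_mul]
  simp only [← contourL_apply, map_sum]
  refine Finset.sum_congr rfl fun l _ => ?_
  rw [← smul_eq_mul, ← map_smul]
  congr 1
  ext z
  simp only [ContinuousMap.mul_apply, ContinuousMap.smul_apply, smul_eq_mul, Complex.real_smul]
  ring

theorem aeval_expFun_apply (m : ℕ) (h : ℝ) (P : ℝ[X]) (z : Metric.sphere (ctr m) (rad m)) :
    (aeval (expFun m h) P : CircleFun m) z = aeval (Complex.exp (h * z)) P := by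
  rw [← expFun_apply]
  exact (aeval_algHom_apply (ContinuousMap.evalAlgHom ℝ ℂ z) (expFun m h) P).symm

/-- `sampledPoly` evaluated at `exp (h z)` is divisible by `rootPoly` among entire functions, so all
poles cancel and Cauchy's theorem gives zero. The recurrence involves only coefficients of index at
least one, since the feedthrough has a different kernel. -/
theorem sum_coeff_sampledPoly_mul_coef {m : ℕ} {s : Multiset ℝ} (hs : HasZerosIn m (rootPoly s))
    {B : ℝ[X]} (hB : B.natDegree ≤ s.card) (j : ℕ) :
    ∑ l ∈ Finset.range (s.card + 1), (sampledPoly h s).coeff l *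
      coef m h (j + l + 1) (transfer m B (rootPoly s)) = 0 := by
  have key := sum_coeff_mul_coef (B := B) (h := h) hs (by rwa [natDegree_rootPoly]) (sampledPoly h s) j
  rw [natDegree_sampledPoly] at key
  rw [← Complex.ofReal_eq_zero, key]
  refine contour_eq_zero (F := fun z => z⁻¹ * (Complex.exp (h * z) - 1) * Complex.exp ((j * h : ℝ) * z) *
    (s.map fun w => expQuot h w z).prod * aeval z B) ?_ fun z => ?_
  · have hinv : DifferentiableOn ℂ (fun z : ℂ => z⁻¹) {z | z.re < 0} := fun z hz =>
      (differentiableAt_inv (by rintro rfl; simp at hz)).differentiableWithinAt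
    have h1 : Differentiable ℂ fun z : ℂ => Complex.exp (h * z) - 1 := by fun_prop
    have h2 : Differentiable ℂ fun z : ℂ => Complex.exp ((j * h : ℝ) * z) := by fun_prop
    exact ((((hinv.mul h1.differentiableOn).mul h2.differentiableOn).mul
      (differentiable_prod_expQuot h s).differentiableOn).mul
      (Polynomial.differentiable_aeval B).differentiableOn)
  · have hne := hs.ne_zero_on z.2
    have hev := aeval_expFun_apply m h (sampledPoly h s) z
    simp only [ContinuousMap.mul_apply, ContinuousMap.sub_apply, ContinuousMap.one_apply,
      expFun_apply, transfer_apply hs, hev, aeval_exp_sampledPoly]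
    rw [show idInv m z = (z : ℂ)⁻¹ from rfl]
    field_simp

/-- One pole `w` is left uncancelled, and Cauchy's formula returns the value there. Its factors
other than `B (w)` are nonzero, so this quantity detects whether `w` is a zero of `B`. -/
theorem sum_coeff_sampledPoly_mul_coef_cons {m : ℕ} {w : ℝ} {s : Multiset ℝ}
    (hs : HasZerosIn m (rootPoly (w ::ₘ s))) {B : ℝ[X]} (hB : B.natDegree ≤ s.card + 1) :
    ((∑ l ∈ Finset.range (s.card + 1), (sampledPoly h s).coeff l *
      coef m h (l + 1) (transfer m B (rootPoly (w ::ₘ s))) : ℝ) : ℂ) =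
      (w : ℂ)⁻¹ * (Complex.exp (h * w) - 1) * (s.map fun v => expQuot h v w).prod * aeval (w : ℂ) B := by
  have key := sum_coeff_mul_coef (B := B) (h := h) hs (by rwa [natDegree_rootPoly, Multiset.card_cons])
    (sampledPoly h s) 0
  rw [natDegree_sampledPoly] at key
  simp only [zero_add] at key
  rw [key]
  refine contour_eq_value (F := fun z => z⁻¹ * (Complex.exp (h * z) - 1) *
    (s.map fun w => expQuot h w z).prod * aeval z B)
    (hasZerosIn_rootPoly.1 hs w (Multiset.mem_cons_self w s)) ?_ fun z => ?_
  · have hinv : DifferentiableOn ℂ (fun z : ℂ => z⁻¹) {z | z.re < 0} := fun z hz =>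
      (differentiableAt_inv (by rintro rfl; simp at hz)).differentiableWithinAt
    have h1 : Differentiable ℂ fun z : ℂ => Complex.exp (h * z) - 1 := by fun_prop
    exact (((hinv.mul h1.differentiableOn).mul
      (differentiable_prod_expQuot h s).differentiableOn).mul
      (Polynomial.differentiable_aeval B).differentiableOn)
  · have hne := hs.ne_zero_on z.2
    have hev := aeval_expFun_apply m h (sampledPoly h s) z
    have he : aeval (z : ℂ) (rootPoly (w ::ₘ s)) = (z - w) * aeval (z : ℂ) (rootPoly s) := by
      rw [rootPoly_cons, map_mul]
      simp
    rw [he] at hne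
    have hne1 := left_ne_zero_of_mul hne
    have hne2 := right_ne_zero_of_mul hne
    simp only [ContinuousMap.mul_apply, ContinuousMap.sub_apply, ContinuousMap.one_apply,
      expFun_apply, transfer_apply hs, hev, aeval_exp_sampledPoly, he]
    rw [show idInv m z = (z : ℂ)⁻¹ from rfl]
    simp only [CharP.cast_eq_zero, zero_mul, Complex.ofReal_zero, Complex.exp_zero]
    field_simp

/-- Induction on the poles: vanishing coefficients force `B (w) = 0`, the common factor `X - w`
cancels, and one pole fewer remains. Without poles, `B` is a constant equal to the feedthrough. -/
theorem eq_zero_of_forall_coef_eq_zero (hh : 0 < h) {m : ℕ} {s : Multiset ℝ}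
    (hs : HasZerosIn m (rootPoly s)) {B : ℝ[X]} (hB : B.natDegree ≤ s.card)
    (h0 : ∀ j, coef m h j (transfer m B (rootPoly s)) = 0) : B = 0 := by
  induction s using Multiset.induction_on generalizing B with
  | empty =>
    have := (ofReal_coef_zero (B := B) h hs (by rwa [natDegree_rootPoly])).2
    rw [h0, feedthrough, coeff_zero_expansionAtInfinity, natDegree_rootPoly,
      (monic_rootPoly _).leadingCoeff, div_one, Multiset.card_zero] at this
    rw [Multiset.card_zero] at hB
    rw [eq_C_of_natDegree_le_zero hB, ← this, C_0]
  | cons w s ih =>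
    have hs' : HasZerosIn m (rootPoly s) :=
      hasZerosIn_rootPoly.2 fun v hv => hasZerosIn_rootPoly.1 hs v (Multiset.mem_cons_of_mem hv)
    have hw := hasZerosIn_rootPoly.1 hs w (Multiset.mem_cons_self w s)
    have hw0 : w < 0 := by
      simpa using re_neg_of_mem_closedBall (Metric.ball_subset_closedBall hw)
    rw [Multiset.card_cons] at hB
    have key := sum_coeff_sampledPoly_mul_coef_cons (h := h) hs hB
    simp only [h0, mul_zero, Finset.sum_const_zero, Complex.ofReal_zero] at key
    have hroot : aeval (w : ℂ) B = 0 := by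
      refine (mul_eq_zero.1 key.symm).resolve_left (mul_ne_zero (mul_ne_zero ?_ ?_) ?_)
      · exact inv_ne_zero (by exact_mod_cast hw0.ne)
      · have : Real.exp (h * w) ≠ 1 := by
          rw [Ne, Real.exp_eq_one_iff]
          exact mul_ne_zero hh.ne' hw0.ne
        rw [sub_ne_zero]
        exact_mod_cast this
      · rw [Ne, Multiset.prod_eq_zero_iff, Multiset.mem_map]
        rintro ⟨v, -, hv⟩
        exact expQuot_ne_zero hh v w hv
    have hroot' : B.IsRoot w := by
      have e : aeval (w : ℂ) B = ((B.eval w : ℝ) : ℂ) := by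
        rw [← Complex.coe_algebraMap, aeval_algebraMap_apply]
        simp
      rw [e] at hroot
      exact_mod_cast hroot
    obtain ⟨B', rfl⟩ := dvd_iff_isRoot.2 hroot'
    by_cases hB' : B' = 0
    · rw [hB', mul_zero]
    have hXw : HasZerosIn m (X - C w) := by
      have := hasZerosIn_rootPoly (m := m) (s := {w})
      simpa [rootPoly] using this.2 (by simpa using hw)
    rw [ih hs' (B := B') ?_ fun j => ?_, mul_zero]
    · rw [natDegree_mul (X_sub_C_ne_zero w) hB', natDegree_X_sub_C] at hB
      omega
    · rw [← transfer_mul_cancel hXw, mul_comm B', mul_comm (rootPoly s), ← rootPoly_cons]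
      exact h0 j

end Sampled

/-! ### Filtered persistently exciting inputs do not vanish -/

section Excitation

variable {K : ℕ} {μ : Measure (PathSpace K)} {h : ℝ}

/-- Applying the recurrence `sampledPoly` to the filtered signal cancels the infinite past and
leaves a moving average of `s.card + 1` consecutive samples. -/
theorem sum_mul_response {m : ℕ} (hh : 0 < h) {s : Multiset ℝ} (hs : HasZerosIn m (rootPoly s))
    {B : ℝ[X]} (hB : B.natDegree ≤ s.card) {w : ℤ → ℝ} (hw : Subexp w) :
    ∑ l ∈ Finset.range (s.card + 1), (sampledPoly h s).coeff l *
        response m h w l (transfer m B (rootPoly s)) =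
      ∑ k ∈ Finset.range (s.card + 1), (∑ l ∈ Finset.range (s.card + 1),
        if k ≤ l then (sampledPoly h s).coeff l * coef m h (l - k) (transfer m B (rootPoly s))
          else 0) * w k := by
  set f := transfer m B (rootPoly s)
  have hsum : ∀ l : ℕ, Summable fun t : ℕ => coef m h (t + (l + 1)) f * w (l - (t + (l + 1) : ℕ)) :=
    fun l => (summable_nat_add_iff (l + 1)).2 (hw.hasSum_response hh l f).summable
  have e1 : ∀ l : ℕ, response m h w l f = ∑ k ∈ Finset.range (l + 1), coef m h (l - k) f * w k +
      ∑' t : ℕ, coef m h (t + (l + 1)) f * w (l - (t + (l + 1) : ℕ)) := fun l => by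
    rw [← (hw.hasSum_response hh l f).tsum_eq,
      ← (hw.hasSum_response hh l f).summable.sum_add_tsum_nat_add (l + 1)]
    congr 1
    rw [← Finset.sum_flip]
    refine Finset.sum_congr rfl fun k hk => ?_
    have := Finset.mem_range.1 hk
    rw [Nat.cast_sub (by omega)]
    congr 2
    ring
  simp only [e1, mul_add, Finset.sum_add_distrib]
  -- These are the contributions of samples at negative times; for each such time the recurrence for
  -- the coefficients applies.
  have e2 : ∑ l ∈ Finset.range (s.card + 1), (sampledPoly h s).coeff l *
      ∑' t : ℕ, coef m h (t + (l + 1)) f * w (l - (t + (l + 1) : ℕ)) = 0 := by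
    simp only [← tsum_mul_left]
    rw [← Summable.tsum_finsetSum fun l _ => (hsum l).mul_left _]
    refine (tsum_congr fun t => ?_).trans tsum_zero
    have := sum_coeff_sampledPoly_mul_coef (h := h) hs hB t
    rw [← zero_mul (w (-1 - t)), ← this, Finset.sum_mul]
    refine Finset.sum_congr rfl fun l _ => ?_
    rw [← mul_assoc, add_assoc]
    congr 2
    push_cast
    ring
  rw [e2, add_zero]
  simp only [Finset.sum_mul]
  rw [Finset.sum_comm]
  refine Finset.sum_congr rfl fun l hl => ?_
  rw [Finset.mul_sum]
  have hsub : Finset.range (l + 1) ⊆ Finset.range (s.card + 1) :=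
    Finset.range_subset_range.2 (by have := Finset.mem_range.1 hl; omega)
  rw [← Finset.sum_subset hsub]
  · refine Finset.sum_congr rfl fun k hk => ?_
    rw [if_pos (Nat.lt_succ_iff.1 (Finset.mem_range.1 hk)), mul_assoc]
  · intro k _ hk
    rw [if_neg, zero_mul]
    simpa [Nat.lt_succ_iff] using hk

/-- If the output vanishes at time zero, then by stationarity it vanishes at all times, so the
moving average of `sum_mul_response` vanishes. Excitation kills its weights, hence all coefficients
of the filter, hence `B`. -/
theorem SignalLaw.eq_zero_of_filteredInput_eq_zero (hμ : SignalLaw μ) (hh : 0 < h) {m : ℕ}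
    {i : Fin K} {r : ℕ} (hr : Exciting μ i r) {s : Multiset ℝ} (hs : HasZerosIn m (rootPoly s))
    {B : ℝ[X]} (hB : B.natDegree ≤ s.card) (hBr : B.natDegree < r) (hsr : s.card ≤ r)
    (h0 : ∀ᵐ x ∂μ, filteredInput m h i (transfer m B (rootPoly s)) x = 0) : B = 0 := by
  set f := transfer m B (rootPoly s)
  set ν : ℕ → ℝ := fun k => ∑ l ∈ Finset.range (s.card + 1),
    if k ≤ l then (sampledPoly h s).coeff l * coef m h (l - k) f else 0 with hν
  have hsum : ∀ᵐ x ∂μ, ∑ k ∈ Finset.range (s.card + 1), ν k * inputPath i x k = 0 := by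
    filter_upwards [hμ.ae_subexp_input, ae_forall_shift hμ.ergodic h0] with x hx hx0
    rw [← sum_mul_response hh hs hB (hx i)]
    refine Finset.sum_eq_zero fun l _ => ?_
    rw [← filteredInput_shift, hx0, mul_zero]
  have hνtop : ν s.card = coef m h 0 f := by
    rw [hν]
    simp only
    rw [Finset.sum_eq_single s.card]
    · rw [if_pos le_rfl, coeff_sampledPoly_card, one_mul, Nat.sub_self]
    · intro l hl hne
      rw [if_neg]
      have := Finset.mem_range.1 hl
      omega
    · simp
  -- If `s.card = r`, the moving average has one sample too many. Its top weight is the feedthrough,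
  -- which is zero because `B` has degree below `r`.
  have hν0 : ∀ k ≤ s.card, ν k = 0 := by
    rcases hsr.eq_or_lt with heq | hlt
    · have htop : ν s.card = 0 := by
        rw [hνtop, (ofReal_coef_zero (B := B) h hs (by rwa [natDegree_rootPoly])).2, feedthrough,
          coeff_zero_expansionAtInfinity, natDegree_rootPoly,
          coeff_eq_zero_of_natDegree_lt (heq ▸ hBr), zero_div]
      simp only [Finset.sum_range_succ, htop, zero_mul, add_zero] at hsum
      intro k hk
      rcases hk.eq_or_lt with rfl | hk
      · exact htop
      · rw [heq] at hsum hk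
        exact hr ν hsum k hk
    · exact fun k hk => hr.mono hlt ν hsum k (by omega)
  refine eq_zero_of_forall_coef_eq_zero hh hs hB fun j => ?_
  -- The weights are triangular in the first `s.card + 1` coefficients, as `sampledPoly` is monic;
  -- beyond these the recurrence determines each coefficient from earlier ones.
  induction j using Nat.strong_induction_on with
  | _ j ih =>
    by_cases hj : j ≤ s.card
    · have := hν0 (s.card - j) (by omega)
      simp only [hν] at this
      rw [Finset.sum_range_succ, if_pos (by omega), coeff_sampledPoly_card, one_mul,
        Finset.sum_eq_zero, zero_add] at this
      · rwa [show s.card - (s.card - j) = j by omega] at this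
      · intro l hl
        have hl' := Finset.mem_range.1 hl
        split_ifs with hjl
        · rw [ih _ (by omega), mul_zero]
        · rfl
    · obtain ⟨t, rfl⟩ : ∃ t, j = t + s.card + 1 := ⟨j - s.card - 1, by omega⟩
      have := sum_coeff_sampledPoly_mul_coef (h := h) hs hB t
      rw [Finset.sum_range_succ, coeff_sampledPoly_card, one_mul, Finset.sum_eq_zero,
        zero_add] at this
      · exact this
      · intro l hl
        have hl' := Finset.mem_range.1 hl
        rw [ih _ (by omega), mul_zero]

end Excitation

/-! ### Partial fractions with real poles -/

section PartialFractions

theorem rootPoly_add (s t : Multiset ℝ) : rootPoly (s + t) = rootPoly s * rootPoly t := by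
  rw [rootPoly, Multiset.map_add, Multiset.prod_add, rootPoly, rootPoly]

theorem rootPoly_replicate (k : ℕ) (w : ℝ) : rootPoly (Multiset.replicate k w) = (X - C w) ^ k := by
  rw [rootPoly, Multiset.map_replicate, Multiset.prod_replicate]

theorem rootPoly_sum {ι : Type*} (t : Finset ι) (s : ι → Multiset ℝ) :
    rootPoly (∑ i ∈ t, s i) = ∏ i ∈ t, rootPoly (s i) := by
  classical
  induction t using Finset.induction_on with
  | empty => simp [rootPoly]
  | insert i t hi ih => rw [Finset.sum_insert hi, Finset.prod_insert hi, rootPoly_add, ih]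

theorem isCoprime_X_sub_C_pow {w w' : ℝ} (h : w ≠ w') (k l : ℕ) :
    IsCoprime ((X - C w) ^ k) ((X - C w') ^ l) :=
  (isCoprime_X_sub_C_of_isUnit_sub (sub_ne_zero.2 h).isUnit).pow

theorem hasZerosIn_X_sub_C_pow {m : ℕ} {w : ℝ} (hw : (w : ℂ) ∈ Metric.ball (ctr m) (rad m))
    (k : ℕ) : HasZerosIn m ((X - C w) ^ k) := by
  rw [← rootPoly_replicate, hasZerosIn_rootPoly]
  intro v hv
  rwa [Multiset.eq_of_mem_replicate hv]

theorem HasZerosIn.prod {ι : Type*} {m : ℕ} (s : Finset ι) {D : ι → ℝ[X]} (h : ∀ i ∈ s, HasZerosIn m (D i)) :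
    HasZerosIn m (∏ i ∈ s, D i) := by
  refine ⟨Finset.prod_ne_zero_iff.2 fun i hi => (h i hi).1, fun z hz => ?_⟩
  rw [map_prod, Finset.prod_eq_zero_iff] at hz
  obtain ⟨i, hi, hz⟩ := hz
  exact (h i hi).2 z hz

variable {ι : Type*} [DecidableEq ι]

theorem sum_transfer {m : ℕ} (s : Finset ι) {D : ι → ℝ[X]} (h : ∀ i ∈ s, HasZerosIn m (D i))
    (B : ι → ℝ[X]) : ∑ i ∈ s, transfer m (B i) (D i) =
      transfer m (∑ i ∈ s, B i * ∏ j ∈ s.erase i, D j) (∏ i ∈ s, D i) := by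
  rw [transfer_sum]
  refine Finset.sum_congr rfl fun i hi => ?_
  rw [← Finset.mul_prod_erase s D hi, transfer_mul_cancel]
  exact HasZerosIn.prod _ fun j hj => h j (Finset.mem_of_mem_erase hj)

/-- Uniqueness of partial fractions, with at most one term that is not strictly proper. -/
theorem eq_zero_of_sum_mul_prod_erase_eq_zero {s : Finset ι} {w : ι → ℝ} (hw : Set.InjOn w s)
    {k : ι → ℕ} {B : ι → ℝ[X]}
    (hB : ∀ i ∈ s, ∀ j ∈ s, k i ≤ (B i).natDegree → k j ≤ (B j).natDegree → i = j)
    (h0 : ∑ i ∈ s, B i * ∏ j ∈ s.erase i, (X - C (w j)) ^ k j = 0) : ∀ i ∈ s, B i = 0 := by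
  have hdvd : ∀ i ∈ s, (X - C (w i)) ^ k i ∣ B i := fun i hi => by
    have hcop : IsCoprime ((X - C (w i)) ^ k i) (∏ j ∈ s.erase i, (X - C (w j)) ^ k j) :=
      IsCoprime.prod_right fun j hj => isCoprime_X_sub_C_pow
        (fun h => Finset.ne_of_mem_erase hj (hw hi (Finset.mem_of_mem_erase hj) h).symm) _ _
    refine hcop.dvd_of_dvd_mul_right ?_
    rw [← Finset.add_sum_erase _ _ hi] at h0
    rw [eq_neg_of_add_eq_zero_left h0, dvd_neg]
    refine Finset.dvd_sum fun j hj => dvd_mul_of_dvd_right ?_ _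
    exact Finset.dvd_prod_of_mem _ (Finset.mem_erase.2 ⟨(Finset.ne_of_mem_erase hj).symm, hi⟩)
  have hsmall : ∀ i ∈ s, (B i).natDegree < k i → B i = 0 := fun i hs hi =>
    eq_zero_of_dvd_of_natDegree_lt (hdvd i hs) (by rwa [natDegree_pow, natDegree_X_sub_C, mul_one])
  intro i his
  by_cases hi : (B i).natDegree < k i
  · exact hsmall i his hi
  · rw [Finset.sum_eq_single i] at h0
    · refine (mul_eq_zero.1 h0).resolve_right (Finset.prod_ne_zero_iff.2 fun j _ =>
        pow_ne_zero _ (X_sub_C_ne_zero _))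
    · intro j hjs hji
      rw [hsmall j hjs, zero_mul]
      by_contra hj
      exact hji (hB j hjs i his (not_lt.1 hj) (not_lt.1 hi))
    · exact fun h => absurd his h

theorem natDegree_sum_mul_prod_erase_le {w : ι → ℝ} {k : ι → ℕ} {B : ι → ℝ[X]} {d : ℕ}
    (s : Finset ι) (hB : ∀ i ∈ s, (B i).natDegree + ∑ j ∈ s.erase i, k j ≤ d) :
    (∑ i ∈ s, B i * ∏ j ∈ s.erase i, (X - C (w j)) ^ k j).natDegree ≤ d := by
  refine natDegree_sum_le_of_forall_le _ _ fun i hi => natDegree_mul_le.trans ?_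
  refine le_trans (Nat.add_le_add_left ?_ _) (hB i hi)
  refine (natDegree_prod_le _ _).trans (Finset.sum_le_sum fun j _ => ?_)
  rw [natDegree_pow, natDegree_X_sub_C, mul_one]

end PartialFractions

/-! ### Setups on the path space -/

section Setup

variable {K : ℕ}

/-- The MISO setup on the path space. -/
def PathMISO (μ : Measure (PathSpace K)) (n m : Fin K → ℕ) : Prop :=
  (∀ i j, i ≠ j → ∀ k l, ∫ x, inputPath i x k * inputPath j x l ∂μ = 0) ∧
  ∀ i, Exciting μ i (max (2 * n i) (n i + m i + 1))

/-- The additive SISO setup on the path space. -/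
def PathSISO (μ : Measure (PathSpace K)) (n m : Fin K → ℕ) : Prop :=
  (∀ᵐ x ∂μ, ∀ i j, inputPath i x = inputPath j x) ∧
  (∀ i j, m i = n i → m j = n j → i = j) ∧
  ∀ i, Exciting μ i (max (2 * ∑ j, n j) (∑ j, (n j + m j + 1)))

variable {μ : Measure (PathSpace K)} {h : ℝ} {n m : Fin K → ℕ}

/-- The filtered inputs with the given multiple poles are linearly independent. -/
def Separated (μ : Measure (PathSpace K)) (q : ℕ) (h : ℝ) (n m : Fin K → ℕ) (w : Fin K → ℝ) :
    Prop :=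
  ∀ B : Fin K → ℝ[X], (∀ i, (B i).natDegree ≤ n i + m i) →
    (∀ᵐ x ∂μ, ∑ i, filteredInput q h i (transfer q (B i) ((X - C (w i)) ^ (2 * n i))) x = 0) →
    ∀ i, B i = 0

theorem SignalLaw.integral_sq_filteredInput_eq_zero_iff (hμ : SignalLaw μ) (hh : 0 < h) {q : ℕ}
    (i : Fin K) (f : CircleFun q) :
    ∫ x, filteredInput q h i f x * filteredInput q h i f x ∂μ = 0 ↔
      ∀ᵐ x ∂μ, filteredInput q h i f x = 0 := by
  rw [integral_eq_zero_iff_of_nonneg (fun x => mul_self_nonneg _)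
    (hμ.integrable_filteredInput_mul hh i i f f)]
  exact Filter.eventually_congr (Eventually.of_forall fun x => by simp)

/-- Correlating the vanishing sum with its own `i`-th term removes all other terms, so the
subsystems can be treated one at a time. -/
theorem SignalLaw.separated_of_pathMISO (hμ : SignalLaw μ) (hh : 0 < h)
    (hm : ∀ i, m i ≤ n i) (hset : PathMISO μ n m) {q : ℕ} {w : Fin K → ℝ}
    (hw : ∀ i, (w i : ℂ) ∈ Metric.ball (ctr q) (rad q)) : Separated μ q h n m w := by
  intro B hB h0 i
  set f : Fin K → CircleFun q := fun i => transfer q (B i) ((X - C (w i)) ^ (2 * n i))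
  have hi0 : ∀ᵐ x ∂μ, filteredInput q h i (f i) x = 0 := by
    rw [← hμ.integral_sq_filteredInput_eq_zero_iff hh]
    have e : ∫ x, filteredInput q h i (f i) x * ∑ j, filteredInput q h j (f j) x ∂μ = 0 := by
      refine integral_eq_zero_of_ae ?_
      filter_upwards [h0] with x hx
      rw [hx, mul_zero, Pi.zero_apply]
    simp only [Finset.mul_sum] at e
    rw [integral_finsetSum _ fun j _ => hμ.integrable_filteredInput_mul hh i j _ _,
      Finset.sum_eq_single i] at e
    · exact e
    · exact fun j _ hj => hμ.integral_filteredInput_mul_eq_zero hh (hset.1 i j hj.symm) _ _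
    · simp
  simp only [f, ← rootPoly_replicate] at hi0
  have hm' := hm i
  have hBi := hB i
  refine hμ.eq_zero_of_filteredInput_eq_zero hh (hset.2 i) ?_ ?_ ?_ ?_ hi0
  · rw [rootPoly_replicate]
    exact hasZerosIn_X_sub_C_pow (hw i) _
  all_goals
    try rw [Multiset.card_replicate]
    omega

theorem SignalLaw.sum_filteredInput (hset : ∀ᵐ x ∂μ, ∀ i j, inputPath (K := K) i x = inputPath j x)
    {q : ℕ} (i₀ : Fin K) (f : Fin K → CircleFun q) :
    ∀ᵐ x ∂μ, ∑ i, filteredInput q h i (f i) x = filteredInput q h i₀ (∑ i, f i) x := by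
  filter_upwards [hset] with x hx
  simp only [filteredInput, map_sum, hx _ i₀]

/-- Over the common denominator, of degree `2 ∑ n_j`, the sum is one filter acting on the common
input, and its numerator must vanish; uniqueness of partial fractions then separates the terms. The
alternative in `hr2` keeps the degree of this numerator below `r`. -/
theorem SignalLaw.separated_of_pathSISO (hμ : SignalLaw μ) (hh : 0 < h)
    (hm : ∀ i, m i ≤ n i) (hset : PathSISO μ n m) {r : ℕ} (hr : ∀ i, Exciting μ i r)
    (hr1 : 2 * ∑ j, n j ≤ r) (hr2 : 2 * ∑ j, n j < r ∨ ∀ i, m i < n i) {q : ℕ} {w : Fin K → ℝ}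
    (hw : ∀ i, (w i : ℂ) ∈ Metric.ball (ctr q) (rad q)) (hinj : Function.Injective w) :
    Separated μ q h n m w := by
  intro B hB h0 i
  set s : Multiset ℝ := ∑ i, Multiset.replicate (2 * n i) (w i) with hs
  have hcard : s.card = 2 * ∑ j, n j := by
    simp [hs, Finset.mul_sum]
  have hD : ∀ i ∈ Finset.univ, HasZerosIn q ((X - C (w i)) ^ (2 * n i)) := fun i _ =>
    hasZerosIn_X_sub_C_pow (hw i) _
  have hsz : rootPoly s = ∏ i, (X - C (w i)) ^ (2 * n i) := by
    simp only [hs, rootPoly_sum, rootPoly_replicate]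
  have hN0 : ∑ i, B i * ∏ j ∈ Finset.univ.erase i, (X - C (w j)) ^ (2 * n j) = 0 := by
    have hsplit : ∀ i, ∑ j ∈ Finset.univ.erase i, 2 * n j + 2 * n i = 2 * ∑ j, n j := fun i => by
      rw [Finset.sum_erase_add _ _ (Finset.mem_univ i), Finset.mul_sum]
    have hdeg : (∑ i, B i * ∏ j ∈ Finset.univ.erase i,
        (X - C (w j)) ^ (2 * n j)).natDegree ≤ 2 * ∑ j, n j := by
      refine natDegree_sum_mul_prod_erase_le _ fun i _ => ?_
      have := hsplit i
      have := hB i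
      have := hm i
      omega
    refine hμ.eq_zero_of_filteredInput_eq_zero hh (m := q) (hr i) (s := s) ?_ (by rwa [hcard]) ?_
      (by rwa [hcard]) ?_
    · rw [hsz]
      exact HasZerosIn.prod _ hD
    · rcases hr2 with hlt | hlt
      · omega
      · have : 0 < n i := (Nat.zero_le _).trans_lt (hlt i)
        have hsi := hsplit i
        have : (∑ i, B i * ∏ j ∈ Finset.univ.erase i,
            (X - C (w j)) ^ (2 * n j)).natDegree ≤ 2 * ∑ j, n j - 1 := by
          refine natDegree_sum_mul_prod_erase_le _ fun i _ => ?_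
          have := hsplit i
          have := hB i
          have := hlt i
          omega
        omega
    · filter_upwards [h0, SignalLaw.sum_filteredInput (h := h) hset.1 i
        fun i => transfer q (B i) ((X - C (w i)) ^ (2 * n i))] with x hx hx'
      rw [hsz, ← sum_transfer _ hD, ← hx', hx]
  refine eq_zero_of_sum_mul_prod_erase_eq_zero hinj.injOn
    (fun i _ j _ hi hj => hset.2.1 i j ?_ ?_) hN0 i (Finset.mem_univ i)
  · have := hB i
    have := hm i
    omega
  · have := hB j
    have := hm j
    omega

end Setup

/-! ### The sum of the residues of one group of poles -/

section Residue

/-- Up to a nonzero factor, the sum of the residues at `w` of `N / ((X - w) ^ a (X - w - ε) ^ b)`,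
extended continuously to `ε = 0`. -/
def residueForm (a b : ℕ) (w ε : ℝ) : ℝ[X] →ₗ[ℝ] ℝ :=
  ∑ p ∈ Finset.HasAntidiagonal.antidiagonal (a - 1),
    (ε ^ p.1 * PowerSeries.coeff p.2 (PowerSeries.invOneSubPow ℝ b : PowerSeries ℝ)) •
      (lcoeff ℝ p.1).comp (taylor w)

theorem residueForm_apply (a b : ℕ) (w ε : ℝ) (N : ℝ[X]) : residueForm a b w ε N =
    ∑ p ∈ Finset.HasAntidiagonal.antidiagonal (a - 1),
      ε ^ p.1 * PowerSeries.coeff p.2 (PowerSeries.invOneSubPow ℝ b : PowerSeries ℝ) *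
        (taylor w N).coeff p.1 := by
  simp [residueForm]

theorem continuous_residueForm (a b : ℕ) (w : ℝ) (N : ℝ[X]) :
    Continuous fun ε => residueForm a b w ε N := by
  simp only [residueForm_apply]
  fun_prop

/-- In the confluent limit the residue condition degenerates to vanishing of `N` at `w`. -/
theorem residueForm_zero (a b : ℕ) (w : ℝ) (N : ℝ[X]) : residueForm a b w 0 N =
    PowerSeries.coeff (a - 1) (PowerSeries.invOneSubPow ℝ b : PowerSeries ℝ) * N.eval w := by
  rw [residueForm_apply, Finset.sum_eq_single (0, a - 1)]
  · simp [taylor_coeff_zero]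
  · rintro ⟨i, j⟩ hij hne
    have : i ≠ 0 := by
      rintro rfl
      refine hne ?_
      rw [Finset.HasAntidiagonal.mem_antidiagonal] at hij
      simp only at hij
      rw [← hij, zero_add]
    simp [this]
  · simp

theorem coeff_invOneSubPow_ne_zero {b : ℕ} (hb : 0 < b) (k : ℕ) :
    PowerSeries.coeff k (PowerSeries.invOneSubPow ℝ b : PowerSeries ℝ) ≠ 0 := by
  rw [PowerSeries.invOneSubPow_val_eq_mk_sub_one_add_choose_of_pos ℝ b hb, PowerSeries.coeff_mk]
  exact_mod_cast (Nat.choose_pos (Nat.le_add_right _ _)).ne'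

/-- The fraction is `B / (X - w) ^ a + B' / (X - w - ε) ^ b`. At `w` only the first term matters,
and its residue is the Taylor coefficient of `B` of index `a - 1`, zero when `B` has degree at most
`a - 2`. Rescaling by `ε` turns this into an identity of power series that also covers `ε = 0`. -/
theorem residueForm_eq_zero {a b : ℕ} (w ε : ℝ) {B : ℝ[X]} (hB : B.natDegree + 2 ≤ a) (B' : ℝ[X]) :
    residueForm a b w ε (B * (X - C (w + ε)) ^ b + B' * (X - C w) ^ a) = 0 := by
  set S : PowerSeries ℝ := (PowerSeries.invOneSubPow ℝ b : PowerSeries ℝ)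
  set N := B * (X - C (w + ε)) ^ b + B' * (X - C w) ^ a
  have e1 : residueForm a b w ε N =
      PowerSeries.coeff (a - 1) ((((taylor w N).comp (C ε * X) : ℝ[X]) : PowerSeries ℝ) * S) := by
    rw [residueForm_apply, PowerSeries.coeff_mul]
    refine Finset.sum_congr rfl fun p _ => ?_
    rw [coeff_coe, comp_C_mul_X_coeff]
    ring
  have e2 : (taylor w N).comp (C ε * X) = (taylor w B).comp (C ε * X) * C ((-ε) ^ b) * (1 - X) ^ b +
      X ^ a * (C (ε ^ a) * (taylor w B').comp (C ε * X)) := by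
    simp only [N, map_add, taylor_apply, add_comp, mul_comp, pow_comp,
      sub_comp, X_comp, C_comp, map_pow, map_neg]
    rw [show C ε * X + C w - (C w + C ε) = -C ε * (1 - X) by ring,
      show C ε * X + C w - C w = C ε * X by ring, mul_pow, mul_pow]
    ring
  have hS : (1 - PowerSeries.X) ^ b * S = 1 := by
    rw [← PowerSeries.invOneSubPow_inv_eq_one_sub_pow]
    exact (PowerSeries.invOneSubPow ℝ b).inv_val
  have e3 : (((taylor w N).comp (C ε * X) : ℝ[X]) : PowerSeries ℝ) * S =
      (((taylor w B).comp (C ε * X) * C ((-ε) ^ b) : ℝ[X]) : PowerSeries ℝ) + PowerSeries.X ^ a *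
        (((C (ε ^ a) * (taylor w B').comp (C ε * X) : ℝ[X]) : PowerSeries ℝ) * S) := by
    have h1 : ((1 - X : ℝ[X]) : PowerSeries ℝ) = 1 - PowerSeries.X := by
      simp
    rw [e2, coe_add, add_mul, coe_mul, coe_pow, h1, mul_assoc, hS, mul_one, coe_mul (X ^ a),
      coe_pow, coe_X, mul_assoc]
  rw [e1, e3, map_add, PowerSeries.coeff_X_pow_mul', if_neg (by omega), add_zero, coeff_coe,
    coeff_mul_C, comp_C_mul_X_coeff, coeff_eq_zero_of_natDegree_lt]
  · simp
  · rw [natDegree_taylor]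
    omega

end Residue

/-! ### Polynomials of bounded degree as vectors -/

section VecPoly

/-- The polynomial with given coefficients. -/
def vecPoly (d : ℕ) : (Fin d → ℝ) →ₗ[ℝ] ℝ[X] :=
  ∑ r : Fin d, (LinearMap.lsmul ℝ ℝ[X]).flip (X ^ (r : ℕ)) ∘ₗ LinearMap.proj r

theorem vecPoly_apply {d : ℕ} (v : Fin d → ℝ) : vecPoly d v = ∑ r : Fin d, C (v r) * X ^ (r : ℕ) := by
  simp [vecPoly, smul_eq_C_mul]

theorem coeff_vecPoly {d : ℕ} (v : Fin d → ℝ) (r : Fin d) : (vecPoly d v).coeff r = v r := by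
  simp [vecPoly_apply, coeff_X_pow, Fin.val_inj]

theorem vecPoly_injective (d : ℕ) : Function.Injective (vecPoly d) := fun v v' h => by
  funext r
  rw [← coeff_vecPoly v, h, coeff_vecPoly]

theorem degree_vecPoly_lt {d : ℕ} (v : Fin d → ℝ) : (vecPoly d v).degree < d := by
  rw [vecPoly_apply, ← mem_degreeLT]
  refine Submodule.sum_mem _ fun r _ => ?_
  rw [mem_degreeLT]
  exact (degree_C_mul_X_pow_le _ _).trans_lt (by exact_mod_cast r.2)

theorem exists_vecPoly_eq {d : ℕ} {P : ℝ[X]} (hP : P.degree < d) : ∃ v, vecPoly d v = P := by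
  by_cases h0 : P = 0
  · exact ⟨0, by rw [h0, map_zero]⟩
  · refine ⟨fun r => P.coeff r, ?_⟩
    rw [vecPoly_apply, ← eq_sum_fin_coeff ((natDegree_lt_iff_degree_lt h0).2 hP)]

theorem continuous_aeval_vecPoly (m d : ℕ) : Continuous fun v => aeval (idFun m) (vecPoly d v) := by
  simp only [vecPoly_apply, map_sum, map_mul, aeval_C, ← Algebra.smul_def, map_pow, aeval_X]
  fun_prop

end VecPoly

/-! ### Separation of the subsystems for suitable poles -/

section Exceptional

variable {K : ℕ} {μ : Measure (PathSpace K)} {h : ℝ}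

/-- The filter `N / ((X - w) ^ a (X - w - ε) ^ b) + M / R`. -/
def mergedFun (q a b : ℕ) (w : ℝ) (R : ℝ[X]) (d ρ : ℕ) (ε : ℝ) :
    ((Fin d → ℝ) × (Fin ρ → ℝ)) →ₗ[ℝ] CircleFun q where
  toFun v := transfer q (vecPoly d v.1) ((X - C w) ^ a * (X - C (w + ε)) ^ b) +
    transfer q (vecPoly ρ v.2) R
  map_add' v v' := by
    simp only [Prod.fst_add, Prod.snd_add, map_add, transfer_add]
    abel
  map_smul' c v := by
    simp only [Prod.smul_fst, Prod.smul_snd, map_smul, smul_eq_C_mul, transfer_C_mul,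
      RingHom.id_apply, smul_add]

theorem continuousAt_mergedFun {q a b : ℕ} {w : ℝ} {R : ℝ[X]} (d ρ : ℕ)
    (hw : (w : ℂ) ∈ Metric.ball (ctr q) (rad q)) (hR : HasZerosIn q R)
    (v : (Fin d → ℝ) × (Fin ρ → ℝ)) :
    ContinuousAt (fun p : ℝ × ((Fin d → ℝ) × (Fin ρ → ℝ)) => mergedFun q a b w R d ρ p.1 p.2)
      (0, v) := by
  have hX : ∀ c : ℝ, aeval (idFun q) (X - C c) = idFun q - c • 1 := fun c => by
    rw [map_sub, aeval_X, aeval_C, Algebra.algebraMap_eq_smul_one]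
  refine ContinuousAt.add (continuousAt_transfer ?_ ?_ ?_) (continuousAt_transfer ?_ ?_ hR)
  · exact ((continuous_aeval_vecPoly q d).comp (continuous_fst.comp continuous_snd)).continuousAt
  · simp only [map_mul, map_pow, hX]
    fun_prop
  · simp only [add_zero]
    exact (hasZerosIn_X_sub_C_pow hw a).mul (hasZerosIn_X_sub_C_pow hw b)
  · exact ((continuous_aeval_vecPoly q ρ).comp (continuous_snd.comp continuous_snd)).continuousAt
  · exact continuousAt_const

/-- At `ε = 0` the residue condition gives `N (w) = 0`, so one of the merged poles cancels. There
remain `r - 1` poles and a numerator of degree at most `r - 1`, for which excitation of order `r` is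
enough. -/
theorem SignalLaw.eq_zero_of_mergedFun_zero (hμ : SignalLaw μ) (hh : 0 < h) {i : Fin K} {r q : ℕ}
    (hr : Exciting μ i r) {a b : ℕ} (ha : 0 < a) (hb : 0 < b) {w : ℝ}
    (hw : (w : ℂ) ∈ Metric.ball (ctr q) (rad q)) {t : Multiset ℝ} (ht : HasZerosIn q (rootPoly t))
    (hwt : IsCoprime (X - C w) (rootPoly t)) (hcard : a + b + t.card = r)
    (v : (Fin (a + b + 1) → ℝ) × (Fin t.card → ℝ))
    (h0 : ∀ᵐ x ∂μ, filteredInput q h i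
      (mergedFun q a b w (rootPoly t) (a + b + 1) t.card 0 v) x = 0)
    (hres : residueForm a b w 0 (vecPoly _ v.1) = 0) : v = 0 := by
  rw [residueForm_zero] at hres
  have hroot := (mul_eq_zero.1 hres).resolve_left (coeff_invOneSubPow_ne_zero hb _)
  obtain ⟨N, hN⟩ := dvd_iff_isRoot.2 hroot
  set M := vecPoly _ v.2 with hM
  have hdM : M.degree < t.card := degree_vecPoly_lt v.2
  have hdN : N.natDegree ≤ a + b - 1 := by
    by_cases hN0 : N = 0
    · simp [hN0]
    · have h1 : (vecPoly _ v.1).natDegree < a + b + 1 := by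
        refine (natDegree_lt_iff_degree_lt ?_).2 (degree_vecPoly_lt v.1)
        rw [hN]
        exact mul_ne_zero (X_sub_C_ne_zero w) hN0
      rw [hN, natDegree_mul (X_sub_C_ne_zero w) hN0, natDegree_X_sub_C] at h1
      omega
  have hXw := hasZerosIn_X_sub_C_pow hw
  have hX1 : HasZerosIn q (X - C w) := by simpa using hXw 1
  have hf : mergedFun q a b w (rootPoly t) (a + b + 1) t.card 0 v =
      transfer q (N * rootPoly t + M * (X - C w) ^ (a + b - 1))
        (rootPoly (Multiset.replicate (a + b - 1) w + t)) := by
    rw [rootPoly_add, rootPoly_replicate, transfer_add, transfer_mul_cancel ht,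
      mul_comm _ (rootPoly t), transfer_mul_cancel (hXw _), ← transfer_mul_cancel hX1 N,
      mul_comm N, ← hN, ← pow_succ, show a + b - 1 + 1 = a + b by omega, pow_add]
    simp only [mergedFun, LinearMap.coe_mk, AddHom.coe_mk, add_zero]
    rfl
  rw [hf] at h0
  have hdeg : (N * rootPoly t + M * (X - C w) ^ (a + b - 1)).natDegree ≤
      a + b - 1 + t.card := by
    refine (natDegree_add_le _ _).trans (max_le ?_ ?_)
    · refine natDegree_mul_le.trans ?_
      rw [natDegree_rootPoly]
      omega
    · refine natDegree_mul_le.trans ?_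
      rw [natDegree_pow, natDegree_X_sub_C, mul_one, add_comm]
      have : M.natDegree ≤ t.card := natDegree_le_of_degree_le hdM.le
      omega
  have hP := hμ.eq_zero_of_filteredInput_eq_zero hh hr (m := q)
    (s := Multiset.replicate (a + b - 1) w + t) ?_ (by simpa using hdeg) (by omega) ?_ h0
  · have hdvd : rootPoly t ∣ M := by
      refine (hwt.symm.pow_right (n := a + b - 1)).dvd_of_dvd_mul_right ?_
      rw [eq_neg_of_add_eq_zero_right hP, dvd_neg]
      exact dvd_mul_left _ _
    have hM0 : M = 0 := by
      refine eq_zero_of_dvd_of_degree_lt hdvd ?_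
      rwa [degree_eq_natDegree (monic_rootPoly t).ne_zero, natDegree_rootPoly]
    rw [hM0, zero_mul, add_zero] at hP
    have hN0 := (mul_eq_zero.1 hP).resolve_right (monic_rootPoly t).ne_zero
    rw [hN0, mul_zero] at hN
    refine Prod.ext (vecPoly_injective _ ?_) (vecPoly_injective _ ?_)
    · rw [hN, Prod.fst_zero, map_zero]
    · rw [← hM, hM0, Prod.snd_zero, map_zero]
  · rw [rootPoly_add, rootPoly_replicate]
    exact (hXw _).mul ht
  · rw [Multiset.card_add, Multiset.card_replicate]
    omega

/-- The second moment plus the squared residue is a continuous quadratic form in `v`, positive on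
the unit sphere at `ε = 0`. By compactness it stays positive for small `ε`, and homogeneity covers
all `v`. -/
theorem SignalLaw.eventually_eq_zero_of_mergedFun (hμ : SignalLaw μ) (hh : 0 < h) {i : Fin K}
    {r q : ℕ} (hr : Exciting μ i r) {a b : ℕ} (ha : 0 < a) (hb : 0 < b) {w : ℝ}
    (hw : (w : ℂ) ∈ Metric.ball (ctr q) (rad q)) {t : Multiset ℝ} (ht : HasZerosIn q (rootPoly t))
    (hwt : IsCoprime (X - C w) (rootPoly t)) (hcard : a + b + t.card = r) :
    ∀ᶠ ε in 𝓝 (0 : ℝ), ∀ v : (Fin (a + b + 1) → ℝ) × (Fin t.card → ℝ),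
      (∀ᵐ x ∂μ, filteredInput q h i
        (mergedFun q a b w (rootPoly t) (a + b + 1) t.card ε v) x = 0) →
      residueForm a b w ε (vecPoly _ v.1) = 0 → v = 0 := by
  obtain ⟨β, hβ⟩ := hμ.exists_correlation hh q i i
  set F := mergedFun q a b w (rootPoly t) (a + b + 1) t.card
  set ℓ : ℝ → (Fin (a + b + 1) → ℝ) × (Fin t.card → ℝ) → ℝ := fun ε v =>
    residueForm a b w ε (vecPoly _ v.1)
  have hnn : ∀ f : CircleFun q, 0 ≤ β f f := fun f => by
    rw [hβ]
    exact integral_nonneg fun x => mul_self_nonneg _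
  have hlc : Continuous fun p : ℝ × ((Fin (a + b + 1) → ℝ) × (Fin t.card → ℝ)) => ℓ p.1 p.2 := by
    simp only [ℓ, vecPoly_apply, map_sum, ← smul_eq_C_mul, map_smul]
    refine continuous_finsetSum _ fun r _ => ?_
    have h2 : Continuous fun p : ℝ × ((Fin (a + b + 1) → ℝ) × (Fin t.card → ℝ)) =>
        residueForm a b w p.1 (X ^ (r : ℕ)) :=
      (continuous_residueForm a b w _).comp continuous_fst
    have h3 : Continuous fun p : ℝ × ((Fin (a + b + 1) → ℝ) × (Fin t.card → ℝ)) => p.2.1 r := by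
      fun_prop
    exact h3.smul h2
  have hcpt := (isCompact_sphere (0 : (Fin (a + b + 1) → ℝ) × (Fin t.card → ℝ)) 1)
  have hev : ∀ᶠ ε in 𝓝 (0 : ℝ), ∀ v ∈ Metric.sphere
      (0 : (Fin (a + b + 1) → ℝ) × (Fin t.card → ℝ)) 1, 0 < β (F ε v) (F ε v) + ℓ ε v ^ 2 := by
    refine hcpt.eventually_forall_of_forall_eventually fun v hv => ?_
    have hc : ContinuousAt (fun p : ℝ × ((Fin (a + b + 1) → ℝ) × (Fin t.card → ℝ)) =>
        β (F p.1 p.2) (F p.1 p.2) + ℓ p.1 p.2 ^ 2) (0, v) := by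
      have hF : ContinuousAt (fun p : ℝ × ((Fin (a + b + 1) → ℝ) × (Fin t.card → ℝ)) =>
        F p.1 p.2) (0, v) := continuousAt_mergedFun _ _ hw ht v
      exact ((β.continuous.continuousAt.comp hF).clm_apply hF).add (hlc.continuousAt.pow 2)
    refine hc.eventually (lt_mem_nhds ?_)
    refine lt_of_le_of_ne (add_nonneg (hnn _) (sq_nonneg _)) fun heq => ?_
    have h1 : β (F 0 v) (F 0 v) = 0 := le_antisymm (by nlinarith [sq_nonneg (ℓ 0 v)]) (hnn _)
    have h2 : ℓ 0 v ^ 2 = 0 := by linarith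
    rw [hβ, hμ.integral_sq_filteredInput_eq_zero_iff hh] at h1
    have := hμ.eq_zero_of_mergedFun_zero hh hr ha hb hw ht hwt hcard v h1 (pow_eq_zero_iff two_ne_zero |>.1 h2)
    rw [this] at hv
    simp at hv
  filter_upwards [hev] with ε hε v h1 h2
  by_contra hv
  have hnorm : ‖v‖ ≠ 0 := norm_ne_zero_iff.2 hv
  refine (hε (‖v‖⁻¹ • v) ?_).ne' ?_
  · rw [mem_sphere_zero_iff_norm, norm_smul, norm_inv, norm_norm, inv_mul_cancel₀ hnorm]
  · have h3 : β (F ε v) (F ε v) = 0 := by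
      rw [hβ, hμ.integral_sq_filteredInput_eq_zero_iff hh]
      exact h1
    have h4 : ℓ ε (‖v‖⁻¹ • v) = ‖v‖⁻¹ * ℓ ε v := by
      simp only [ℓ, Prod.smul_fst, map_smul, smul_eq_mul]
    have h5 : ℓ ε v = 0 := h2
    simp [h4, h5, h3]

variable {n m : Fin K → ℕ}

/-- The pole of the biproper subsystem `j₀` is placed at distance `ε ≠ 0` from the pole of `j₁`. The
gap in degrees at `j₁` supplies the residue condition that replaces the missing order of excitation.
-/
theorem SignalLaw.exists_separated_of_pathSISO_of_gap (hμ : SignalLaw μ) (hh : 0 < h)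
    (hm : ∀ i, m i ≤ n i) (hset : PathSISO μ n m) (hr : ∀ i, Exciting μ i (2 * ∑ j, n j))
    {j₀ j₁ : Fin K} (h0 : m j₀ = n j₀) (hn0 : 0 < n j₀) (h1 : m j₁ + 2 ≤ n j₁) {q : ℕ}
    {w : Fin K → ℝ} (hw : ∀ i, (w i : ℂ) ∈ Metric.ball (ctr q) (rad q))
    (hinj : Function.Injective w) :
    ∃ w' : Fin K → ℝ, (∀ i, (w' i : ℂ) ∈ Metric.ball (ctr q) (rad q)) ∧ Separated μ q h n m w' := by
  have hj : j₁ ≠ j₀ := by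
    rintro rfl
    omega
  set s := (Finset.univ.erase j₁).erase j₀ with hs
  have hmem : ∀ i ∈ s, i ≠ j₀ ∧ i ≠ j₁ := fun i hi =>
    ⟨Finset.ne_of_mem_erase hi, Finset.ne_of_mem_erase (Finset.mem_of_mem_erase hi)⟩
  have hj0 : j₀ ∈ Finset.univ.erase j₁ := Finset.mem_erase.2 ⟨hj.symm, Finset.mem_univ _⟩
  have hsplit : ∀ {A : Type} [AddCommMonoid A] (f : Fin K → A),
      ∑ i, f i = f j₁ + (f j₀ + ∑ i ∈ s, f i) := fun f => by
    rw [← Finset.add_sum_erase _ f (Finset.mem_univ j₁), ← Finset.add_sum_erase _ f hj0]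
  set t : Multiset ℝ := ∑ i ∈ s, Multiset.replicate (2 * n i) (w i) with ht
  have htr : rootPoly t = ∏ i ∈ s, (X - C (w i)) ^ (2 * n i) := by
    simp only [ht, rootPoly_sum, rootPoly_replicate]
  have hcard : t.card = ∑ i ∈ s, 2 * n i := by simp [ht]
  have htz : HasZerosIn q (rootPoly t) := by
    rw [htr]
    exact HasZerosIn.prod _ fun i _ => hasZerosIn_X_sub_C_pow (hw i) _
  have hcop : IsCoprime (X - C (w j₁)) (rootPoly t) := by
    rw [htr]
    refine IsCoprime.prod_right fun i hi => ?_
    simpa using isCoprime_X_sub_C_pow (fun e => (hmem i hi).2 (hinj e).symm) 1 (2 * n i)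
  have hball : ∀ᶠ ε : ℝ in 𝓝 0, ((w j₁ + ε : ℝ) : ℂ) ∈ Metric.ball (ctr q) (rad q) := by
    have hc : Continuous fun ε : ℝ => ((w j₁ + ε : ℝ) : ℂ) := by fun_prop
    refine hc.continuousAt.eventually_mem (Metric.isOpen_ball.mem_nhds ?_)
    simpa using hw j₁
  have hev := hμ.eventually_eq_zero_of_mergedFun (q := q) hh (hr j₀) (a := 2 * n j₁)
    (b := 2 * n j₀) (by omega) (by omega) (hw j₁) htz hcop (by
      rw [hcard, Finset.mul_sum, hsplit fun i => 2 * n i, add_assoc])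
  obtain ⟨ε, ⟨hεb, hεv⟩, hε0⟩ := ((hball.and hev).filter_mono nhdsWithin_le_nhds |>.and
    (self_mem_nhdsWithin (s := {(0 : ℝ)}ᶜ))).exists
  set w' := Function.update w j₀ (w j₁ + ε) with hw'
  have hw'0 : w' j₀ = w j₁ + ε := Function.update_self ..
  have hw'n : ∀ i, i ≠ j₀ → w' i = w i := fun i hi => Function.update_of_ne hi ..
  refine ⟨w', fun i => ?_, fun B hB hsum => ?_⟩
  · by_cases hi : i = j₀
    · rw [hi, hw'0]
      exact hεb
    · rw [hw'n i hi]
      exact hw i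
  set a := 2 * n j₁
  set b := 2 * n j₀
  -- `N` is the combined numerator of the two nearly merged subsystems, of degree up to `a + b`
  -- since `j₀` is biproper; `M` collects the others, which are all strictly proper.
  set N := B j₁ * (X - C (w j₁ + ε)) ^ b + B j₀ * (X - C (w j₁)) ^ a with hN
  set M := ∑ i ∈ s, B i * ∏ j ∈ s.erase i, (X - C (w j)) ^ (2 * n j) with hM
  have hdeg : ∀ i ∈ s, (B i).natDegree < 2 * n i := fun i hi => by
    have := hB i
    have := hm i
    have := mt (hset.2.1 i j₀ · h0) (hmem i hi).1
    omega
  have hdN : N.degree < (a + b + 1 : ℕ) := by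
    have hB1 := hB j₁
    have hB0 := hB j₀
    have hle : N.natDegree ≤ a + b := by
      refine (natDegree_add_le _ _).trans (max_le ?_ ?_)
      all_goals
        refine natDegree_mul_le.trans ?_
        rw [natDegree_pow, natDegree_X_sub_C, mul_one]
        omega
    exact (degree_le_of_natDegree_le hle).trans_lt (Nat.cast_lt.2 (Nat.lt_succ_self _))
  have hdM : M.degree < t.card := by
    rcases s.eq_empty_or_nonempty with hse | ⟨i₀, hi₀⟩
    · rw [hM, hse, Finset.sum_empty, degree_zero]
      exact WithBot.bot_lt_coe _
    · have hpos : 0 < t.card := by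
        rw [hcard]
        exact Finset.sum_pos' (fun i _ => Nat.zero_le _) ⟨i₀, hi₀, by have := hdeg i₀ hi₀; omega⟩
      have hle : M.natDegree ≤ t.card - 1 := by
        refine natDegree_sum_mul_prod_erase_le s fun i hi => ?_
        have := hdeg i hi
        have := Finset.sum_erase_add s (fun i => 2 * n i) hi
        omega
      exact (degree_le_of_natDegree_le hle).trans_lt (Nat.cast_lt.2 (Nat.sub_one_lt_of_lt hpos))
  obtain ⟨v₁, hv₁⟩ := exists_vecPoly_eq hdN
  obtain ⟨v₂, hv₂⟩ := exists_vecPoly_eq hdM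
  have hfun : ∑ i, transfer q (B i) ((X - C (w' i)) ^ (2 * n i)) =
      mergedFun q a b (w j₁) (rootPoly t) (a + b + 1) t.card ε (v₁, v₂) := by
    rw [hsplit, hw'0, hw'n j₁ hj]
    simp only [mergedFun, LinearMap.coe_mk, AddHom.coe_mk, hv₁, hv₂]
    rw [← add_assoc, hN, hM, transfer_add, transfer_mul_cancel (hasZerosIn_X_sub_C_pow hεb _),
      mul_comm ((X - C (w j₁)) ^ a), transfer_mul_cancel (hasZerosIn_X_sub_C_pow (hw j₁) _), htr,
      ← sum_transfer s fun i _ => hasZerosIn_X_sub_C_pow (hw i) _]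
    congr 1
    refine Finset.sum_congr rfl fun i hi => ?_
    rw [hw'n i (hmem i hi).1]
  have hv := hεv (v₁, v₂) ?_ ?_
  · have hN0 : N = 0 := by
      rw [← hv₁, (Prod.mk_eq_zero.1 hv).1, map_zero]
    have hM0 : M = 0 := by
      rw [← hv₂, (Prod.mk_eq_zero.1 hv).2, map_zero]
    have hB1 : B j₁ = 0 := by
      refine eq_zero_of_dvd_of_natDegree_lt (p := (X - C (w j₁)) ^ a) ?_ ?_
      · have hc : IsCoprime ((X - C (w j₁)) ^ a) ((X - C (w j₁ + ε)) ^ b) :=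
          isCoprime_X_sub_C_pow (fun e => hε0 (by simpa using e)) a b
        refine hc.dvd_of_dvd_mul_right ?_
        rw [eq_neg_of_add_eq_zero_left hN0, dvd_neg]
        exact dvd_mul_left _ _
      · rw [natDegree_pow, natDegree_X_sub_C, mul_one]
        have := hB j₁
        omega
    have hB0 : B j₀ = 0 := by
      rw [hN, hB1, zero_mul, zero_add] at hN0
      exact (mul_eq_zero.1 hN0).resolve_right (pow_ne_zero _ (X_sub_C_ne_zero _))
    have hrest := eq_zero_of_sum_mul_prod_erase_eq_zero (s := s) hinj.injOn
      (fun i hi j _ hki _ => absurd hki (hdeg i hi).not_ge) hM0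
    intro i
    by_cases hi1 : i = j₁
    · rw [hi1, hB1]
    by_cases hi0 : i = j₀
    · rw [hi0, hB0]
    exact hrest i (Finset.mem_erase.2 ⟨hi0, Finset.mem_erase.2 ⟨hi1, Finset.mem_univ i⟩⟩)
  · rw [← hfun]
    filter_upwards [hsum, SignalLaw.sum_filteredInput (h := h) hset.1 j₀
      fun i => transfer q (B i) ((X - C (w' i)) ^ (2 * n i))] with x hx hx'
    rw [← hx', hx]
  · rw [hv₁]
    refine residueForm_eq_zero _ _ ?_ _
    have := hB j₁
    omega

/-- Suitable poles for which the subsystems are separated exist in both setups. -/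
theorem SignalLaw.exists_separated (hμ : SignalLaw μ) (hh : 0 < h) (hn : ∀ i, 1 ≤ n i)
    (hm : ∀ i, m i ≤ n i) (hset : PathMISO μ n m ∨ PathSISO μ n m) :
    ∃ (q : ℕ) (w : Fin K → ℝ), (∀ i, (w i : ℂ) ∈ Metric.ball (ctr q) (rad q)) ∧
      Separated μ q h n m w := by
  set w : Fin K → ℝ := fun i => -((i : ℝ) + 1)
  have hinj : Function.Injective w := fun i j hij => by
    simp only [w, neg_inj, add_left_inj, Nat.cast_inj] at hij
    exact Fin.ext hij
  obtain ⟨q, hq⟩ : ∃ q : ℕ, ∀ i, (w i : ℂ) ∈ Metric.ball (ctr q) (rad q) :=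
    (eventually_all.2 fun i => eventually_mem_ball (z := (w i : ℂ)) (by
      rw [Complex.ofReal_re]
      simp only [w]
      linarith [(Nat.cast_nonneg (i : ℕ) : (0 : ℝ) ≤ (i : ℕ))])).exists
  refine ⟨q, ?_⟩
  rcases hset with hset | hset
  · exact ⟨w, hq, hμ.separated_of_pathMISO hh hm hset hq⟩
  -- The common numerator has degree `2 ∑ n_j` only when a subsystem is biproper. The simple
  -- argument fails just when this happens and the order of excitation is exactly `2 ∑ n_j`.
  by_cases hcase : 2 * ∑ j, n j < max (2 * ∑ j, n j) (∑ j, (n j + m j + 1)) ∨ ∀ i, m i < n i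
  · exact ⟨w, hq, hμ.separated_of_pathSISO hh hm hset hset.2.2 (le_max_left _ _) hcase hq hinj⟩
  push Not at hcase
  obtain ⟨hle, j₀, hj₀⟩ := hcase
  have h0 : m j₀ = n j₀ := le_antisymm (hm j₀) hj₀
  have hsum := (le_max_right _ _).trans hle
  -- Otherwise `n_i + m_i + 1 ≥ 2 n_i` for all `i`, strictly for `j₀`, and the number of parameters
  -- would exceed `2 ∑ n_j`.
  obtain ⟨j₁, hj₁⟩ : ∃ j₁, m j₁ + 2 ≤ n j₁ := by
    by_contra! hcon
    rw [Finset.mul_sum] at hsum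
    refine hsum.not_gt (Finset.sum_lt_sum (fun i _ => ?_) ⟨j₀, Finset.mem_univ _, ?_⟩)
    · have := hcon i
      omega
    · omega
  exact hμ.exists_separated_of_pathSISO_of_gap hh hm hset
    (fun i => (hset.2.2 i).mono (le_max_left _ _)) h0 (hn j₀) hj₁ hq hinj

end Exceptional

/-! ### The cross correlation matrix and the generic set -/

section CrossMatrix

variable {K : ℕ}

/-- The indices of the coefficients of numerators of degree at most `n i + m i`. -/
abbrev NumIndex (n m : Fin K → ℕ) : Type := Σ i, Fin (n i + m i + 1)

/-- The correlations of the filtered inputs, with squared model denominators on the one hand and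
with products of system and model denominators on the other hand. -/
def crossMatrix (μ : Measure (PathSpace K)) (h : ℝ) (n m : Fin K → ℕ)
    (p : Denominators n × Denominators n) : Matrix (NumIndex n m) (NumIndex n m) ℝ :=
  Matrix.of fun r s => ∫ x, filt h (X ^ (r.2 : ℕ)) (denPoly (p.2 r.1) ^ 2) (inputPath r.1 x) 0 *
    filt h (X ^ (s.2 : ℕ)) (denPoly (p.1 s.1) * denPoly (p.2 s.1)) (inputPath s.1 x) 0 ∂μ

/-- The pairs of system and model denominators with nonsingular cross correlation matrix. -/
def goodSet (μ : Measure (PathSpace K)) (h : ℝ) (n m : Fin K → ℕ) :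
    Set (Denominators n × Denominators n) :=
  {p | p ∈ denRegion h n ×ˢ denRegion h n ∧ (crossMatrix μ h n m p).det ≠ 0}

/-- The denominators of the prescribed orders with zeros inside the `q`-th circle. -/
def denSet (q : ℕ) (n : Fin K → ℕ) : Set (Denominators n) :=
  {a | ∀ i, (denPoly (a i)).natDegree = n i ∧ HasZerosIn q (denPoly (a i))}

variable {μ : Measure (PathSpace K)} {h : ℝ} {n m : Fin K → ℕ} {q : ℕ}

theorem isOpen_denSet : IsOpen (denSet q n) := by
  have e : denSet q n = Set.univ.pi fun i =>
      {a : Fin (n i) → ℝ | (denPoly a).natDegree = n i ∧ HasZerosIn q (denPoly a)} := by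
    ext a
    simp [denSet]
  rw [e]
  refine isOpen_set_pi Set.finite_univ fun i _ => ?_
  rw [isOpen_iff_eventually]
  rintro a ⟨h1, h2⟩
  exact (eventually_natDegree_denPoly continuous_id h1).and
    (eventually_hasZerosIn_denPoly continuous_id h1 h2)

theorem eventually_mem_denSet {a : Denominators n} (ha : a ∈ denRegion h n) :
    ∀ᶠ q in atTop, a ∈ denSet q n :=
  eventually_all.2 fun i => ((ha i).2.1.eventually_hasZerosIn (denPoly_ne_zero _)).mono
    fun _ hq => ⟨(ha i).1, hq⟩

theorem filt_eq_filteredInput {A B : ℝ[X]} (hA : HasZerosIn q A) (hB : B.natDegree ≤ A.natDegree)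
    (hh : 0 < h) {i : Fin K} {x : PathSpace K} (hx : Subexp (inputPath i x)) :
    filt h B A (inputPath i x) 0 = filteredInput q h i (transfer q B A) x :=
  filt_eq_response hA hB hh hx 0

theorem natDegree_X_pow_le_sq {a : Denominators n} (ha : a ∈ denSet q n) (hm : ∀ i, m i ≤ n i)
    (r : NumIndex n m) : (X ^ (r.2 : ℕ) : ℝ[X]).natDegree ≤ (denPoly (a r.1) ^ 2).natDegree := by
  rw [natDegree_X_pow, natDegree_pow, (ha r.1).1]
  have := r.2.2
  have := hm r.1
  omega

theorem natDegree_X_pow_le_mul {a a' : Denominators n} (ha : a ∈ denSet q n) (ha' : a' ∈ denSet q n)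
    (hm : ∀ i, m i ≤ n i) (r : NumIndex n m) :
    (X ^ (r.2 : ℕ) : ℝ[X]).natDegree ≤ (denPoly (a r.1) * denPoly (a' r.1)).natDegree := by
  rw [natDegree_X_pow, natDegree_mul (denPoly_ne_zero _) (denPoly_ne_zero _), (ha r.1).1,
    (ha' r.1).1]
  have := r.2.2
  have := hm r.1
  omega

theorem SignalLaw.crossMatrix_apply (hμ : SignalLaw μ) (hh : 0 < h) (hm : ∀ i, m i ≤ n i)
    {p : Denominators n × Denominators n} (h1 : p.1 ∈ denSet q n) (h2 : p.2 ∈ denSet q n)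
    (r s : NumIndex n m) : crossMatrix μ h n m p r s =
      ∫ x, filteredInput q h r.1 (transfer q (X ^ (r.2 : ℕ)) (denPoly (p.2 r.1) ^ 2)) x *
        filteredInput q h s.1
          (transfer q (X ^ (s.2 : ℕ)) (denPoly (p.1 s.1) * denPoly (p.2 s.1))) x ∂μ := by
  rw [crossMatrix, Matrix.of_apply]
  refine integral_congr_ae ?_
  filter_upwards [hμ.ae_subexp_input] with x hx
  rw [filt_eq_filteredInput ((h2 r.1).2.pow 2) (natDegree_X_pow_le_sq h2 hm r) hh (hx _),
    filt_eq_filteredInput ((h1 s.1).2.mul (h2 s.1).2) (natDegree_X_pow_le_mul h1 h2 hm s) hh (hx _)]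

/-- Near `p` one circle encloses all poles, and there the entry is a continuous bilinear form
evaluated at Banach algebra inverses of elements polynomial in the coefficients. -/
theorem SignalLaw.analyticAt_crossMatrix (hμ : SignalLaw μ) (hh : 0 < h) (hm : ∀ i, m i ≤ n i)
    {p : Denominators n × Denominators n} (h1 : p.1 ∈ denSet q n) (h2 : p.2 ∈ denSet q n)
    (r s : NumIndex n m) : AnalyticAt ℝ (fun p => crossMatrix μ h n m p r s) p := by
  obtain ⟨β, hβ⟩ := hμ.exists_correlation hh q r.1 s.1
  have hev : (fun p : Denominators n × Denominators n =>
      β (transfer q (X ^ (r.2 : ℕ)) (denPoly (p.2 r.1) ^ 2))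
        (transfer q (X ^ (s.2 : ℕ)) (denPoly (p.1 s.1) * denPoly (p.2 s.1)))) =ᶠ[𝓝 p]
      fun p => crossMatrix μ h n m p r s := by
    filter_upwards [(isOpen_denSet.prod isOpen_denSet).mem_nhds
      (show p ∈ denSet q n ×ˢ denSet q n from ⟨h1, h2⟩)] with p' hp'
    rw [hμ.crossMatrix_apply hh hm hp'.1 hp'.2, hβ]
  refine AnalyticAt.congr ?_ hev
  have hcoord : ∀ (i : Fin K) (t : Fin (n i)),
      AnalyticAt ℝ (fun p : Denominators n × Denominators n => p.1 i t) p ∧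
      AnalyticAt ℝ (fun p : Denominators n × Denominators n => p.2 i t) p := fun i t =>
    ⟨((ContinuousLinearMap.proj (R := ℝ) t).comp ((ContinuousLinearMap.proj (R := ℝ) (φ := fun i => Fin (n i) → ℝ) i).comp
      (ContinuousLinearMap.fst ℝ (Denominators n) (Denominators n)))).analyticAt p,
      ((ContinuousLinearMap.proj (R := ℝ) t).comp ((ContinuousLinearMap.proj (R := ℝ) (φ := fun i => Fin (n i) → ℝ) i).comp
      (ContinuousLinearMap.snd ℝ (Denominators n) (Denominators n)))).analyticAt p⟩
  have hden1 : ∀ i, AnalyticAt ℝ (fun p : Denominators n × Denominators n =>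
      aeval (idFun q) (denPoly (p.1 i))) p := fun i => by
    simp only [aeval_denPoly]
    exact analyticAt_const.add (Finset.analyticAt_fun_sum _ fun t _ =>
      (hcoord i t).1.smul analyticAt_const)
  have hden2 : ∀ i, AnalyticAt ℝ (fun p : Denominators n × Denominators n =>
      aeval (idFun q) (denPoly (p.2 i))) p := fun i => by
    simp only [aeval_denPoly]
    exact analyticAt_const.add (Finset.analyticAt_fun_sum _ fun t _ =>
      (hcoord i t).2.smul analyticAt_const)
  have hf : AnalyticAt ℝ (fun p : Denominators n × Denominators n =>
      transfer q (X ^ (r.2 : ℕ)) (denPoly (p.2 r.1) ^ 2)) p := by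
    refine analyticAt_transfer _ ?_ ((h2 r.1).2.pow 2)
    simp only [map_pow]
    exact (hden2 r.1).pow 2
  have hg : AnalyticAt ℝ (fun p : Denominators n × Denominators n =>
      transfer q (X ^ (s.2 : ℕ)) (denPoly (p.1 s.1) * denPoly (p.2 s.1))) p := by
    refine analyticAt_transfer _ ?_ ((h1 s.1).2.mul (h2 s.1).2)
    simp only [map_mul]
    exact (hden1 s.1).mul (hden2 s.1)
  exact AnalyticAt.comp (g := fun fg : CircleFun q × CircleFun q => β fg.1 fg.2)
    (β.analyticAt_bilinear _) (hf.prod hg)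

theorem SignalLaw.analyticOnNhd_det_crossMatrix (hμ : SignalLaw μ) (hh : 0 < h)
    (hm : ∀ i, m i ≤ n i) :
    AnalyticOnNhd ℝ (fun p => (crossMatrix μ h n m p).det) (denRegion h n ×ˢ denRegion h n) := by
  rintro p ⟨h1, h2⟩
  obtain ⟨q, hq1, hq2⟩ := ((eventually_mem_denSet h1).and (eventually_mem_denSet h2)).exists
  simp only [Matrix.det_apply]
  refine Finset.analyticAt_fun_sum _ fun σ _ => ?_
  refine AnalyticAt.const_smul (Finset.analyticAt_fun_prod _ fun r _ => ?_)
  exact hμ.analyticAt_crossMatrix hh hm hq1 hq2 _ _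

theorem SignalLaw.isOpen_goodSet (hμ : SignalLaw μ) (hh : 0 < h) (hm : ∀ i, m i ≤ n i) :
    IsOpen (goodSet μ h n m) := by
  rw [isOpen_iff_eventually]
  rintro p ⟨hp, hdet⟩
  exact (((isOpen_denRegion h n).prod (isOpen_denRegion h n)).eventually_mem hp).and
    ((hμ.analyticOnNhd_det_crossMatrix hh hm p hp).continuousAt.eventually_ne hdet)

/-! ### Nonsingularity at one point -/

/-- The coefficients of the denominator with a single multiple zero `w`. -/
def rootDen (n : ℕ) (w : ℝ) : Fin n → ℝ := fun r => (C ((-w) ^ n)⁻¹ * (X - C w) ^ n).coeff (r + 1)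

theorem denPoly_rootDen (n : ℕ) {w : ℝ} (hw : w ≠ 0) :
    denPoly (rootDen n w) = C ((-w) ^ n)⁻¹ * (X - C w) ^ n := by
  refine denPoly_coeff ((natDegree_C_mul_le _ _).trans ?_) ?_
  · rw [natDegree_pow, natDegree_X_sub_C, mul_one]
  · rw [coeff_C_mul, coeff_zero_eq_eval_zero, eval_pow, eval_sub, eval_X, eval_C, zero_sub,
      inv_mul_cancel₀ (pow_ne_zero _ (neg_ne_zero.2 hw))]

theorem rootDen_mem_denRegion (hh : 0 < h) {w : Fin K → ℝ} (hw : ∀ i, w i < 0) :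
    (fun i => rootDen (n i) (w i)) ∈ denRegion h n := by
  intro i
  have hne : C ((-w i) ^ n i)⁻¹ ≠ 0 :=
    C_ne_zero.2 (inv_ne_zero (pow_ne_zero _ (neg_ne_zero.2 (hw i).ne)))
  have hroot : ∀ z : ℂ, aeval z (denPoly (rootDen (n i) (w i))) = 0 → z = w i := by
    intro z hz
    rw [denPoly_rootDen _ (hw i).ne, map_mul] at hz
    have h1 := (mul_eq_zero.1 hz).resolve_left (by simpa using hne)
    rw [map_pow] at h1
    have := eq_zero_of_pow_eq_zero h1
    simpa [sub_eq_zero] using this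
  refine ⟨?_, fun z hz => ?_, fun z hz => ?_⟩
  · rw [denPoly_rootDen _ (hw i).ne, natDegree_C_mul_of_mul_ne_zero, natDegree_pow,
      natDegree_X_sub_C, mul_one]
    rw [((monic_X_sub_C (w i)).pow _).leadingCoeff, mul_one]
    exact C_ne_zero.1 hne
  · simpa [hroot z hz] using hw i
  · rw [hroot z hz, Complex.ofReal_im, abs_zero, mul_zero]
    exact div_pos (by positivity) hh

theorem sum_sigma_smul_transfer (q : ℕ) (D : Fin K → ℝ[X]) (c : NumIndex n m → ℝ) (i : Fin K) :
    ∑ r : Fin (n i + m i + 1), c ⟨i, r⟩ • transfer q (X ^ (r : ℕ)) (D i) =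
      transfer q (vecPoly _ fun r => c ⟨i, r⟩) (D i) := by
  rw [vecPoly_apply, transfer_sum]
  simp only [transfer_C_mul]

theorem sum_mul_filteredInput (q : ℕ) (h : ℝ) (D : Fin K → ℝ[X]) (c : NumIndex n m → ℝ)
    (x : PathSpace K) :
    ∑ s : NumIndex n m, c s * filteredInput q h s.1 (transfer q (X ^ (s.2 : ℕ)) (D s.1)) x =
      ∑ i, filteredInput q h i (transfer q (vecPoly _ fun r => c ⟨i, r⟩) (D i)) x := by
  rw [Fintype.sum_sigma]
  refine Finset.sum_congr rfl fun i _ => ?_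
  simp only [filteredInput, ← sum_sigma_smul_transfer, map_sum, map_smul, smul_eq_mul]

theorem SignalLaw.crossMatrix_mulVec (hμ : SignalLaw μ) (hh : 0 < h) (hm : ∀ i, m i ≤ n i)
    {p : Denominators n × Denominators n} (h1 : p.1 ∈ denSet q n) (h2 : p.2 ∈ denSet q n)
    (c : NumIndex n m → ℝ) (r : NumIndex n m) : (crossMatrix μ h n m p).mulVec c r =
      ∫ x, filteredInput q h r.1 (transfer q (X ^ (r.2 : ℕ)) (denPoly (p.2 r.1) ^ 2)) x *
        ∑ i, filteredInput q h i (transfer q (vecPoly _ fun r => c ⟨i, r⟩)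
          (denPoly (p.1 i) * denPoly (p.2 i))) x ∂μ := by
  simp only [← sum_mul_filteredInput q h (fun i => denPoly (p.1 i) * denPoly (p.2 i)),
    Finset.mul_sum]
  rw [integral_finsetSum]
  · simp only [Matrix.mulVec, dotProduct]
    refine Finset.sum_congr rfl fun s _ => ?_
    rw [hμ.crossMatrix_apply hh hm h1 h2, mul_comm, ← integral_const_mul]
    congr 1
    funext x
    ring
  · intro s _
    exact ((hμ.memLp_filteredInput hh _ _)).integrable_mul
      ((hμ.memLp_filteredInput hh _ _).const_mul (c s))

/-- On the diagonal the matrix is the Gram matrix of the filtered inputs. A kernel vector gives a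
combination `Y` with zero second moment, and separation forces its numerators to vanish. -/
theorem SignalLaw.exists_det_crossMatrix_ne_zero (hμ : SignalLaw μ) (hh : 0 < h)
    (hn : ∀ i, 1 ≤ n i) (hm : ∀ i, m i ≤ n i) (hset : PathMISO μ n m ∨ PathSISO μ n m) :
    ∃ a ∈ denRegion h n, (crossMatrix μ h n m (a, a)).det ≠ 0 := by
  obtain ⟨q, w, hw, hsep⟩ := hμ.exists_separated hh hn hm hset
  have hw0 : ∀ i, w i < 0 := fun i => by
    simpa using re_neg_of_mem_closedBall (Metric.ball_subset_closedBall (hw i))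
  set a : Denominators n := fun i => rootDen (n i) (w i) with ha
  have haD : a ∈ denRegion h n := rootDen_mem_denRegion hh hw0
  have hden : ∀ i, denPoly (a i) = C ((-w i) ^ n i)⁻¹ * (X - C (w i)) ^ n i := fun i =>
    denPoly_rootDen _ (hw0 i).ne
  have hne : ∀ i, ((-w i) ^ n i)⁻¹ ^ 2 ≠ 0 := fun i =>
    pow_ne_zero _ (inv_ne_zero (pow_ne_zero _ (neg_ne_zero.2 (hw0 i).ne)))
  have haq : a ∈ denSet q n := fun i => by
    refine ⟨(haD i).1, denPoly_ne_zero _, fun z hz => ?_⟩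
    rw [hden, map_mul, aeval_C] at hz
    refine (hasZerosIn_X_sub_C_pow (hw i) (n i)).2 z ((mul_eq_zero.1 hz).resolve_left ?_)
    simpa using fun h => absurd h (hw0 i).ne
  refine ⟨a, haD, fun hdet => ?_⟩
  obtain ⟨c, hc, hc0⟩ := Matrix.exists_mulVec_eq_zero_iff.2 hdet
  refine hc ?_
  set B : Fin K → ℝ[X] := fun i => vecPoly _ fun r => c ⟨i, r⟩
  have hfun : ∀ i, transfer q (B i) (denPoly (a i) * denPoly (a i)) =
      transfer q (C (((-w i) ^ n i)⁻¹ ^ 2)⁻¹ * B i) ((X - C (w i)) ^ (2 * n i)) := fun i => by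
    rw [eq_comm, ← transfer_C_mul_den (hne i), ← mul_assoc, ← C_mul, mul_inv_cancel₀ (hne i), C_1, one_mul,
      hden, C_pow]
    congr 1
    ring
  have hsum : ∀ᵐ x ∂μ,
      ∑ i, filteredInput q h i (transfer q (B i) (denPoly (a i) * denPoly (a i))) x = 0 := by
    set Y : PathSpace K → ℝ := fun x =>
      ∑ i, filteredInput q h i (transfer q (B i) (denPoly (a i) * denPoly (a i))) x with hY
    have hYm : MemLp Y 2 μ := memLp_finsetSum _ fun i _ => hμ.memLp_filteredInput hh i _
    have hYY : ∫ x, Y x * Y x ∂μ = 0 := by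
      have e : ∀ x, Y x * Y x = ∑ s : NumIndex n m, c s * (filteredInput q h s.1
          (transfer q (X ^ (s.2 : ℕ)) (denPoly (a s.1) ^ 2)) x * Y x) := fun x => by
        simp only [← mul_assoc, ← Finset.sum_mul]
        congr 1
        simp only [hY, pow_two]
        exact (sum_mul_filteredInput q h (fun i => denPoly (a i) * denPoly (a i)) c x).symm
      simp only [e]
      have hint : ∀ s : NumIndex n m, Integrable (fun x => c s * (filteredInput q h s.1
          (transfer q (X ^ (s.2 : ℕ)) (denPoly (a s.1) ^ 2)) x * Y x)) μ := fun s =>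
        ((hμ.memLp_filteredInput hh _ _).integrable_mul hYm).const_mul _
      rw [integral_finsetSum _ fun s _ => hint s]
      refine Finset.sum_eq_zero fun s _ => ?_
      rw [integral_const_mul, ← hμ.crossMatrix_mulVec hh hm (p := (a, a)) haq haq c s, hc0,
        Pi.zero_apply, mul_zero]
    rw [integral_eq_zero_iff_of_nonneg (fun x => mul_self_nonneg _) (hYm.integrable_mul hYm)] at hYY
    filter_upwards [hYY] with x hx
    simpa using hx
  simp only [hfun] at hsum
  have hB := hsep _ (fun i => (natDegree_C_mul_le _ _).trans
    (Nat.lt_succ_iff.1 ?_)) hsum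
  · funext ⟨i, r⟩
    have h1 := (mul_eq_zero.1 (hB i)).resolve_left (C_ne_zero.2 (inv_ne_zero (hne i)))
    have h2 := vecPoly_injective _ (h1.trans (map_zero _).symm)
    exact congrFun h2 r
  · by_cases h0 : B i = 0
    · simp [h0]
    · exact (natDegree_lt_iff_degree_lt h0).2 (degree_vecPoly_lt _)

theorem SignalLaw.volume_diff_goodSet (hμ : SignalLaw μ) (hh : 0 < h) (hn : ∀ i, 1 ≤ n i)
    (hm : ∀ i, m i ≤ n i) (hset : PathMISO μ n m ∨ PathSISO μ n m) :
    volume ((denRegion h n ×ˢ denRegion h n) \ goodSet μ h n m) = 0 := by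
  obtain ⟨a, ha, hdet⟩ := hμ.exists_det_crossMatrix_ne_zero hh hn hm hset
  have : (volume : Measure (Denominators n × Denominators n)).IsAddHaarMeasure :=
    Measure.prod.instIsAddHaarMeasure (volume : Measure (Denominators n))
      (volume : Measure (Denominators n))
  have := measure_zeros_eq_zero_of_analyticOnNhd (volume : Measure (Denominators n × Denominators n))
    ((isOpen_denRegion h n).prod (isOpen_denRegion h n))
    ((isPreconnected_denRegion hh n).prod (isPreconnected_denRegion hh n))
    (hμ.analyticOnNhd_det_crossMatrix hh hm) (x₁ := (a, a)) ⟨ha, ha⟩ hdet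
  convert this using 2
  ext p
  simp only [goodSet, Set.mem_sdiff, Set.mem_ofPred_eq, not_and, not_not]
  exact ⟨fun h => ⟨h.1, h.2 h.1⟩, fun h => ⟨h.1, fun _ => h.2⟩⟩

/-- The diagonal is itself a null set, so this needs its own application of analyticity. It is
available because the nonsingular point was found on the diagonal. -/
theorem SignalLaw.volume_diagonal_notMem_goodSet (hμ : SignalLaw μ) (hh : 0 < h)
    (hn : ∀ i, 1 ≤ n i) (hm : ∀ i, m i ≤ n i) (hset : PathMISO μ n m ∨ PathSISO μ n m) :
    volume {a ∈ denRegion h n | (a, a) ∉ goodSet μ h n m} = 0 := by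
  obtain ⟨a, ha, hdet⟩ := hμ.exists_det_crossMatrix_ne_zero hh hn hm hset
  have han : AnalyticOnNhd ℝ (fun a => (crossMatrix μ h n m (a, a)).det) (denRegion h n) :=
    fun b hb => AnalyticAt.comp (f := fun a : Denominators n => (a, a))
      (hμ.analyticOnNhd_det_crossMatrix hh hm (b, b) ⟨hb, hb⟩) (analyticAt_id.prod analyticAt_id)
  have := measure_zeros_eq_zero_of_analyticOnNhd (volume : Measure (Denominators n))
    (isOpen_denRegion h n) (isPreconnected_denRegion hh n) han ha hdet
  convert this using 2
  ext p
  simp only [goodSet, Set.mem_ofPred_eq, not_and, not_not, Set.mem_prod]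
  exact ⟨fun h => ⟨h.1, h.2 ⟨h.1, h.1⟩⟩, fun h => ⟨h.1, fun _ => h.2⟩⟩

end CrossMatrix

/-! ### Combinations of the gradient of a model -/

section Sylvester

variable {n m q : ℕ}

/-- The numerator, over the squared denominator, of a combination of the gradient of a model. -/
def sylvester (θ α : Param n m) : ℝ[X] :=
  -(X * vecPoly n (fun r => α (Sum.inl r)) * polyB θ) +
    vecPoly (m + 1) (fun r => α (Sum.inr r)) * polyA θ

theorem polyB_eq_vecPoly (θ : Param n m) : polyB θ = vecPoly (m + 1) fun r => θ (Sum.inr r) := by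
  rw [vecPoly_apply, polyB]

theorem natDegree_vecPoly_le (d : ℕ) (v : Fin (d + 1) → ℝ) : (vecPoly (d + 1) v).natDegree ≤ d := by
  by_cases h0 : vecPoly (d + 1) v = 0
  · simp [h0]
  · exact Nat.lt_succ_iff.1 ((natDegree_lt_iff_degree_lt h0).2 (degree_vecPoly_lt v))

theorem natDegree_polyA_le (θ : Param n m) : (polyA θ).natDegree ≤ n := natDegree_denPoly_le _

theorem natDegree_sylvester_le (θ α : Param n m) : (sylvester θ α).natDegree ≤ n + m := by
  have hB := natDegree_polyB_le θ
  have hA := natDegree_polyA_le θ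
  refine (natDegree_add_le _ _).trans (max_le ?_ ?_)
  · rw [natDegree_neg]
    rcases n with _ | n
    · have : vecPoly 0 (fun r => α (Sum.inl r)) = 0 := by simp [vecPoly_apply]
      simp [this]
    · have h1 := natDegree_vecPoly_le n fun r => α (Sum.inl r)
      refine natDegree_mul_le.trans ?_
      have := natDegree_mul_le (p := X) (q := vecPoly (n + 1) fun r => α (Sum.inl r))
      rw [natDegree_X] at this
      omega
  · have h1 := natDegree_vecPoly_le m fun r => α (Sum.inr r)
    refine natDegree_mul_le.trans ?_
    omega

theorem isCoprime_polyA_X (θ : Param n m) : IsCoprime (polyA θ) X := by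
  refine ⟨1, -∑ r : Fin n, C (den θ r) * X ^ r.val, ?_⟩
  rw [polyA, denPoly, one_mul, neg_mul, Finset.sum_mul]
  simp only [pow_succ, ← mul_assoc]
  ring

theorem degree_polyA {θ : Param n m} (h : (polyA θ).natDegree = n) : (polyA θ).degree = n := by
  rw [degree_eq_natDegree (polyA_ne_zero θ), h]

theorem IsModel.eq_zero_of_sylvester_eq_zero {θ α : Param n m} (hθ : IsModel θ)
    (h : sylvester θ α = 0) : α = 0 := by
  -- The constant coefficient one makes `A` coprime to `p` as well, hence to `p B`.
  have hcop : IsCoprime (polyA θ) (X * polyB θ) := (isCoprime_polyA_X θ).mul_right hθ.2.2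
  set a := vecPoly n fun r => α (Sum.inl r) with ha
  set b := vecPoly (m + 1) fun r => α (Sum.inr r) with hb
  have h1 : a * (X * polyB θ) = b * polyA θ := by
    rw [sylvester, neg_add_eq_zero] at h
    linear_combination h
  have ha0 : a = 0 := by
    refine eq_zero_of_dvd_of_degree_lt (hcop.dvd_of_dvd_mul_right (h1 ▸ dvd_mul_left _ _)) ?_
    rw [degree_polyA hθ.1]
    exact degree_vecPoly_lt _
  have hb0 : b = 0 := by
    rw [ha0, zero_mul] at h1
    exact (mul_eq_zero.1 h1.symm).resolve_right (polyA_ne_zero θ)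
  have e1 := vecPoly_injective n (ha0.trans (map_zero _).symm)
  have e2 := vecPoly_injective (m + 1) (hb0.trans (map_zero _).symm)
  funext s
  rcases s with r | r
  exacts [congrFun e1 r, congrFun e2 r]

/-- By Bézout's identity the denominator component can be chosen modulo `A`, with degree below `n`.
The remainder is then divisible by `A`, and counting degrees bounds the quotient by `m`. -/
theorem IsModel.exists_sylvester_eq {θ : Param n m} (hθ : IsModel θ) {P : ℝ[X]}
    (hP : P.natDegree ≤ n + m) : ∃ α, sylvester θ α = P := by
  obtain ⟨s, t, hst⟩ : IsCoprime (polyA θ) (X * polyB θ) :=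
    (isCoprime_polyA_X θ).mul_right hθ.2.2
  have hA0 := polyA_ne_zero θ
  set a := (-(P * t)) % polyA θ with ha
  have hda : a.degree < n := by
    rw [← degree_polyA hθ.1]
    exact EuclideanDomain.mod_lt _ hA0
  obtain ⟨b, hb⟩ : polyA θ ∣ P + a * (X * polyB θ) := by
    have h1 : a = -(P * t) - polyA θ * (-(P * t) / polyA θ) := by
      rw [ha, eq_sub_iff_add_eq, EuclideanDomain.mod_add_div]
    refine ⟨P * s - (-(P * t) / polyA θ) * (X * polyB θ), ?_⟩
    rw [h1]
    linear_combination (-P) * hst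
  have hdb : b.degree < (m + 1 : ℕ) := by
    by_cases hb0 : b = 0
    · rw [hb0, degree_zero]
      exact WithBot.bot_lt_coe _
    · rw [← natDegree_lt_iff_degree_lt hb0]
      have h1 : (P + a * (X * polyB θ)).natDegree ≤ n + m := by
        refine (natDegree_add_le _ _).trans (max_le hP ?_)
        by_cases ha0 : a = 0
        · simp [ha0]
        · have h2 := (natDegree_lt_iff_degree_lt ha0).2 hda
          have h3 := natDegree_polyB_le θ
          have h4 := natDegree_mul_le (p := X) (q := polyB θ)
          rw [natDegree_X] at h4
          refine natDegree_mul_le.trans ?_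
          omega
      rw [hb, natDegree_mul hA0 hb0, hθ.1] at h1
      omega
  obtain ⟨v, hv⟩ := exists_vecPoly_eq hda
  obtain ⟨w, hw⟩ := exists_vecPoly_eq hdb
  refine ⟨Sum.elim v w, ?_⟩
  simp only [sylvester, Sum.elim_inl, Sum.elim_inr]
  rw [show (fun r => v r) = v from rfl, show (fun r => w r) = w from rfl, hv, hw]
  linear_combination -hb

theorem sum_smul_gradFun {θ : Param n m} (h : HasZerosIn q (polyA θ)) (α : Param n m) :
    ∑ a, α a • gradFun q θ a = transfer q (sylvester θ α) (polyA θ ^ 2) := by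
  rw [Fintype.sum_sum_type, sylvester, transfer_add, transfer_neg, pow_two,
    transfer_mul_cancel h]
  congr 1
  · rw [mul_assoc, mul_comm X, vecPoly_apply, Finset.sum_mul, Finset.sum_mul, transfer_sum,
      ← Finset.sum_neg_distrib]
    refine Finset.sum_congr rfl fun r _ => ?_
    rw [gradFun, Sum.elim_inl, transfer_neg, smul_neg, ← transfer_C_mul, pow_two]
    congr 2
    ring
  · rw [vecPoly_apply, transfer_sum]
    simp only [gradFun, Sum.elim_inr, transfer_C_mul]

theorem polyA_injOn {θ θ' : Param n m} (hA : polyA θ = polyA θ') (hB : polyB θ = polyB θ') :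
    θ = θ' := by
  funext s
  rcases s with r | r
  · have h1 := coeff_denPoly_succ (den θ) r
    have h2 := coeff_denPoly_succ (den θ') r
    have h3 : denPoly (den θ) = denPoly (den θ') := hA
    rw [h3] at h1
    exact h1.symm.trans h2
  · rw [← coeff_polyB θ, hB, coeff_polyB]

/-- Coprimality gives that `A` divides `A'`; equal degrees make the quotient constant, and the
constant coefficient one fixes it. -/
theorem IsModel.eq_of_cross_eq {θ θ' : Param n m} (hθ : IsModel θ)
    (hd' : (polyA θ').natDegree = n) (h : polyB θ' * polyA θ = polyB θ * polyA θ') : θ = θ' := by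
  have hdvd : polyA θ ∣ polyA θ' := hθ.2.2.dvd_of_dvd_mul_left (h ▸ dvd_mul_left _ _)
  obtain ⟨c, hc⟩ := hdvd
  have hc0 : c ≠ 0 := by
    rintro rfl
    rw [mul_zero] at hc
    exact polyA_ne_zero _ hc
  have hdc : c.natDegree = 0 := by
    have := congrArg natDegree hc
    rw [natDegree_mul (polyA_ne_zero θ) hc0, hθ.1, hd'] at this
    omega
  rw [eq_C_of_natDegree_eq_zero hdc] at hc
  have h1 : c.coeff 0 = 1 := by
    have := congrArg (fun P : ℝ[X] => P.coeff 0) hc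
    simp only [mul_coeff_zero, coeff_C_zero, polyA, coeff_denPoly_zero] at this
    linarith
  rw [h1, C_1, mul_one] at hc
  rw [hc] at h
  exact polyA_injOn hc.symm (mul_right_cancel₀ (polyA_ne_zero θ) h).symm

end Sylvester

/-! ### Identifiability -/

section Identifiability

variable {K : ℕ} {μ : Measure (PathSpace K)} {h : ℝ} {n m : Fin K → ℕ} {q : ℕ}

theorem SignalLaw.eq_zero_of_det_crossMatrix_ne_zero (hμ : SignalLaw μ) (hh : 0 < h)
    (hm : ∀ i, m i ≤ n i) {p : Denominators n × Denominators n} (h1 : p.1 ∈ denSet q n)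
    (h2 : p.2 ∈ denSet q n) (hdet : (crossMatrix μ h n m p).det ≠ 0) {P : Fin K → ℝ[X]}
    (hP : ∀ i, (P i).natDegree ≤ n i + m i)
    (h0 : ∀ i, ∀ r ≤ n i + m i,
      ∫ x, filteredInput q h i (transfer q (X ^ r) (denPoly (p.2 i) ^ 2)) x *
        ∑ j, filteredInput q h j (transfer q (P j) (denPoly (p.1 j) * denPoly (p.2 j))) x ∂μ = 0)
    (i : Fin K) : P i = 0 := by
  set c : NumIndex n m → ℝ := fun s => (P s.1).coeff s.2
  have hc : ∀ i, vecPoly _ (fun r => c ⟨i, r⟩) = P i := fun i => by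
    rw [vecPoly_apply, ← eq_sum_fin_coeff (Nat.lt_succ_iff.2 (hP i))]
  have hmul : (crossMatrix μ h n m p).mulVec c = 0 := by
    funext r
    rw [hμ.crossMatrix_mulVec hh hm h1 h2]
    simp only [hc]
    exact h0 r.1 r.2 (Nat.lt_succ_iff.1 r.2.2)
  have hc0 : c = 0 := by
    by_contra hne
    exact hdet (Matrix.exists_mulVec_eq_zero_iff.1 ⟨c, hne, hmul⟩)
  rw [← hc, hc0]
  exact map_zero _

/-- Orthogonality to the gradient extends to every admissible numerator over `A ^ 2`, which is what
the rows of `crossMatrix` test. -/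
theorem SignalLaw.integral_eq_zero_of_gradFun (hμ : SignalLaw μ) (hh : 0 < h) {i : Fin K}
    {a b : ℕ} {θ : Param a b} (hθ : IsModel θ) (hz : HasZerosIn q (polyA θ)) {W : PathSpace K → ℝ}
    (hW : MemLp W 2 μ)
    (h0 : ∀ s, ∫ x, filteredInput q h i (gradFun q θ s) x * W x ∂μ = 0) {P : ℝ[X]}
    (hP : P.natDegree ≤ a + b) :
    ∫ x, filteredInput q h i (transfer q P (polyA θ ^ 2)) x * W x ∂μ = 0 := by
  obtain ⟨α, rfl⟩ := hθ.exists_sylvester_eq hP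
  rw [← sum_smul_gradFun hz]
  have e : ∀ x, filteredInput q h i (∑ s, α s • gradFun q θ s) x * W x =
      ∑ s, α s * (filteredInput q h i (gradFun q θ s) x * W x) := fun x => by
    simp only [filteredInput, map_sum, map_smul, smul_eq_mul, Finset.sum_mul, mul_assoc]
  simp only [e]
  have hint : ∀ s, Integrable
      (fun x => α s * (filteredInput q h i (gradFun q θ s) x * W x)) μ := fun s =>
    ((hμ.memLp_filteredInput hh i (gradFun q θ s)).integrable_mul hW).const_mul (α s)
  rw [integral_finsetSum _ fun s _ => hint s]
  simp only [integral_const_mul, h0, mul_zero, Finset.sum_const_zero]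

/-- The error in subsystem `j` has numerator `B* A - B A*` over `A* A`. A vanishing expected score
puts the coefficients of these numerators into the kernel of `crossMatrix`. -/
theorem SignalLaw.eq_of_integral_gradFun_mul_eq_zero (hμ : SignalLaw μ) (hh : 0 < h)
    (hm : ∀ i, m i ≤ n i) {βs β : JointParam n m} (hβs : dens βs ∈ denSet q n)
    (hβ : ∀ i, IsModel (β i)) (hβq : dens β ∈ denSet q n)
    (hdet : (crossMatrix μ h n m (dens βs, dens β)).det ≠ 0)
    (h0 : ∀ i s, ∫ x, filteredInput q h i (gradFun q (β i) s) x *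
      ∑ j, filteredInput q h j (modelFun q (βs j) - modelFun q (β j)) x ∂μ = 0) : β = βs := by
  have hfun : ∀ j, modelFun q (βs j) - modelFun q (β j) = transfer q
      (polyB (βs j) * polyA (β j) - polyB (β j) * polyA (βs j))
      (denPoly (dens βs j) * denPoly (dens β j)) := fun j =>
    transfer_sub_transfer (hβs j).2 (hβq j).2 _ _
  have hW : MemLp (fun x => ∑ j, filteredInput q h j (modelFun q (βs j) - modelFun q (β j)) x) 2 μ :=
    memLp_finsetSum _ fun j _ => hμ.memLp_filteredInput hh j _
  have key := hμ.eq_zero_of_det_crossMatrix_ne_zero hh hm (p := (dens βs, dens β)) hβs hβq hdet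
    (P := fun j => polyB (βs j) * polyA (β j) - polyB (β j) * polyA (βs j)) (fun j => ?_)
    fun i r hr => ?_
  · funext i
    exact (hβ i).eq_of_cross_eq (hβs i).1 (sub_eq_zero.1 (key i))
  · have h1 := natDegree_polyB_le (βs j)
    have h2 := natDegree_polyB_le (β j)
    have h3 := natDegree_polyA_le (βs j)
    have h4 := natDegree_polyA_le (β j)
    refine (natDegree_sub_le _ _).trans (max_le ?_ ?_)
    all_goals
      refine natDegree_mul_le.trans ?_
      omega
  · simp only [← hfun]
    exact hμ.integral_eq_zero_of_gradFun hh (hβ i) (hβq i).2 hW (h0 i)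
      (by rw [natDegree_X_pow]; exact hr)

/-- A kernel vector yields a combination of the gradient of one submodel with zero second moment.
Extended by zero to the other subsystems, it lies in the kernel of the nonsingular `crossMatrix`,
and coprimality then gives the zero vector. -/
theorem SignalLaw.det_gradFun_ne_zero (hμ : SignalLaw μ) (hh : 0 < h) (hm : ∀ i, m i ≤ n i)
    {β : JointParam n m} (hβ : ∀ i, IsModel (β i)) (hβq : dens β ∈ denSet q n)
    (hdet : (crossMatrix μ h n m (dens β, dens β)).det ≠ 0) (i : Fin K) :
    (Matrix.of fun s t => ∫ x, filteredInput q h i (gradFun q (β i) s) x *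
      filteredInput q h i (gradFun q (β i) t) x ∂μ).det ≠ 0 := by
  intro hdet0
  obtain ⟨α, hα, hα0⟩ := Matrix.exists_mulVec_eq_zero_iff.2 hdet0
  refine hα ?_
  set F := transfer q (sylvester (β i) α) (polyA (β i) ^ 2) with hF
  have hFm := hμ.memLp_filteredInput hh i F
  have h0 : ∀ s, ∫ x, filteredInput q h i (gradFun q (β i) s) x * filteredInput q h i F x ∂μ = 0 := by
    intro s
    have e : ∀ x, filteredInput q h i (gradFun q (β i) s) x * filteredInput q h i F x =
        ∑ t, (filteredInput q h i (gradFun q (β i) s) x *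
          filteredInput q h i (gradFun q (β i) t) x) * α t := fun x => by
      rw [hF, ← sum_smul_gradFun (hβq i).2]
      simp only [filteredInput, map_sum, map_smul, smul_eq_mul, Finset.mul_sum]
      exact Finset.sum_congr rfl fun t _ => by ring
    simp only [e]
    rw [integral_finsetSum _ fun t _ => (hμ.integrable_filteredInput_mul hh i i _ _).mul_const _]
    simp only [integral_mul_const]
    exact congrFun hα0 s
  have hFF := hμ.integral_eq_zero_of_gradFun hh (hβ i) (hβq i).2 hFm h0
    (natDegree_sylvester_le (β i) α)
  rw [hμ.integral_sq_filteredInput_eq_zero_iff hh] at hFF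
  have key := hμ.eq_zero_of_det_crossMatrix_ne_zero hh hm (p := (dens β, dens β)) hβq hβq hdet
    (P := fun j => if j = i then sylvester (β i) α else 0) (fun j => ?_) (fun j r _ => ?_) i
  · rw [if_pos rfl] at key
    exact (hβ i).eq_zero_of_sylvester_eq_zero key
  · split_ifs with hj
    · rw [hj]
      exact natDegree_sylvester_le _ _
    · simp
  · refine integral_eq_zero_of_ae ?_
    filter_upwards [hFF] with x hx
    rw [Finset.sum_eq_single i]
    · rw [if_pos rfl, ← pow_two]
      change _ * filteredInput q h i F x = 0
      rw [hx, mul_zero]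
    · intro j _ hj
      rw [if_neg hj, transfer_zero, filteredInput, map_zero]
    · simp

end Identifiability

/-! ### Signals of subexponential growth -/

theorem Subexp.add {w w' : ℤ → ℝ} (hw : Subexp w) (hw' : Subexp w') :
    Subexp fun k => w k + w' k := by
  intro σ h0 h1 k
  obtain ⟨c, hc⟩ := hw σ h0 h1 k
  obtain ⟨c', hc'⟩ := hw' σ h0 h1 k
  refine ⟨c + c', fun j => ?_⟩
  calc |w (k - j) + w' (k - j)| * σ ^ j ≤ (|w (k - j)| + |w' (k - j)|) * σ ^ j := by
        gcongr
        exact abs_add_le _ _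
    _ ≤ c + c' := by
        rw [add_mul]
        exact add_le_add (hc j) (hc' j)

theorem Subexp.neg {w : ℤ → ℝ} (hw : Subexp w) : Subexp fun k => -w k := by
  simpa only [Subexp, abs_neg] using hw

theorem Subexp.sub {w w' : ℤ → ℝ} (hw : Subexp w) (hw' : Subexp w') :
    Subexp fun k => w k - w' k := by
  simpa only [sub_eq_add_neg] using hw.add hw'.neg

theorem Subexp.sum {ι : Type*} (s : Finset ι) {w : ι → ℤ → ℝ} (hw : ∀ i ∈ s, Subexp (w i)) :
    Subexp fun k => ∑ i ∈ s, w i k := by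
  classical
  induction s using Finset.induction_on with
  | empty =>
    intro σ _ _ _
    exact ⟨0, by simp⟩
  | insert i s hi ih =>
    simp only [Finset.sum_insert hi]
    exact (hw i (Finset.mem_insert_self i s)).add
      (ih fun j hj => hw j (Finset.mem_insert_of_mem hj))

section Deterministic

variable {n m q : ℕ} {h : ℝ}

theorem instrument_eq_response (hm : m ≤ n) (hh : 0 < h) {θ : Param n m} (hθ : θ ∈ modelSet q n m)
    {w : ℤ → ℝ} (hw : Subexp w) (k : ℤ) (a : Fin n ⊕ Fin (m + 1)) :
    instrument h θ w k a = response q h w k (gradFun q θ a) := by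
  rcases a with r | r
  · refine filt_eq_response (hθ.2.pow 2) ?_ hh hw k
    have h1 := natDegree_polyB_le θ
    have h2 := r.2
    rw [natDegree_neg, natDegree_pow, hθ.1]
    refine natDegree_mul_le.trans ?_
    rw [natDegree_X_pow]
    omega
  · refine filt_eq_response hθ.2 ?_ hh hw k
    have h2 := r.2
    rw [natDegree_X_pow, hθ.1]
    omega

theorem modelOutput_eq_response (hm : m ≤ n) (hh : 0 < h) {θ : Param n m} (hθ : θ ∈ modelSet q n m)
    {w : ℤ → ℝ} (hw : Subexp w) (k : ℤ) :
    modelOutput h θ w k = response q h w k (modelFun q θ) :=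
  filt_eq_response hθ.2 ((natDegree_polyB_le θ).trans (hm.trans hθ.1.ge)) hh hw k

theorem filt_polyB_sq_eq_response (hm : m ≤ n) (hh : 0 < h) {θ : Param n m}
    (hθ : θ ∈ modelSet q n m) {w : ℤ → ℝ} (hw : Subexp w) (k : ℤ) :
    filt h (polyB θ) (polyA θ ^ 2) w k = response q h w k (transfer q (polyB θ) (polyA θ ^ 2)) := by
  refine filt_eq_response (hθ.2.pow 2) ?_ hh hw k
  have h1 := natDegree_polyB_le θ
  rw [natDegree_pow, hθ.1]
  omega

theorem filt_one_eq_response (hh : 0 < h) {θ : Param n m} (hθ : θ ∈ modelSet q n m) {w : ℤ → ℝ}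
    (hw : Subexp w) (k : ℤ) : filt h 1 (polyA θ) w k = response q h w k (transfer q 1 (polyA θ)) :=
  filt_eq_response hθ.2 (by rw [natDegree_one]; exact Nat.zero_le _) hh hw k

/-- The filters in the regressor acting on the residual output. -/
theorem filt_neg_X_pow_eq_response (hh : 0 < h) {θ : Param n m} (hθ : θ ∈ modelSet q n m)
    {w : ℤ → ℝ} (hw : Subexp w) (k : ℤ) (r : Fin n) :
    filt h (-(X ^ (r.val + 1))) (polyA θ) w k =
      response q h w k (transfer q (-(X ^ (r.val + 1))) (polyA θ)) := by
  refine filt_eq_response hθ.2 ?_ hh hw k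
  have h2 := r.2
  rw [natDegree_neg, natDegree_X_pow, hθ.1]
  omega

theorem response_one (hh : 0 < h) {w : ℤ → ℝ} (hw : Subexp w) (k : ℤ) :
    response q h w k (1 : CircleFun q) = w k := by
  have hz : HasZerosIn q (1 : ℝ[X]) := ⟨one_ne_zero, fun z hz => by simp at hz⟩
  have e : transfer q 1 1 = 1 := transfer_self hz
  have hc0 : coef q h 0 (1 : CircleFun q) = 1 := by
    rw [← e, (ofReal_coef_zero h hz le_rfl).2, feedthrough, coeff_zero_expansionAtInfinity]
    simp
  -- Without poles the kernels of positive index are holomorphic in the left half-plane.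
  have hcs : ∀ j, coef q h (j + 1) (1 : CircleFun q) = 0 := fun j => by
    rw [coef_apply, contour_eq_zero (F := fun z => z⁻¹ * (Complex.exp (h * z) - 1) *
      Complex.exp ((j * h : ℝ) * z)), Complex.zero_re]
    · have hinv : DifferentiableOn ℂ (fun z : ℂ => z⁻¹) {z | z.re < 0} := fun z hz =>
        (differentiableAt_inv (by rintro rfl; simp at hz)).differentiableWithinAt
      have h1 : Differentiable ℂ fun z : ℂ => Complex.exp (h * z) - 1 := by fun_prop
      have h2 : Differentiable ℂ fun z : ℂ => Complex.exp ((j * h : ℝ) * z) := by fun_prop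
      exact (hinv.mul h1.differentiableOn).mul h2.differentiableOn
    · intro z
      simp only [kern, mul_one, ContinuousMap.mul_apply, ContinuousMap.sub_apply,
        ContinuousMap.one_apply, expFun_apply]
      rfl
  have hS := hw.hasSum_response (m := q) hh k (1 : CircleFun q)
  refine hS.unique ?_
  have h1 := hasSum_single (f := fun j : ℕ => coef q h j (1 : CircleFun q) * w (k - j)) 0
    fun j hj => by
      obtain ⟨j, rfl⟩ := Nat.exists_eq_succ_of_ne_zero hj
      rw [hcs, zero_mul]
  simpa [hc0] using h1

theorem polyA_eq (θ : Param n m) : polyA θ = 1 + X * vecPoly n fun r => θ (Sum.inl r) := by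
  rw [polyA, denPoly, vecPoly_apply, Finset.mul_sum]
  congr 1
  refine Finset.sum_congr rfl fun r _ => ?_
  rw [den]
  ring

/-- Pairing the gradient with the parameters themselves gives `B / A ^ 2`, because `A` minus its
nonconstant part is one. This explains the extra term in the Gauss–Newton target. -/
theorem sylvester_self (θ : Param n m) : sylvester θ θ = polyB θ := by
  rw [sylvester, ← polyB_eq_vecPoly]
  linear_combination polyB θ * polyA_eq θ

/-- For SRIVC the identity `1 / A + (A - 1) / A = 1` restores the unfiltered residual output. Thus
the two methods have the same equations at a fixed point. -/
theorem target_sub_sum_rightFactor (meth : Method) (hm : m ≤ n) (hh : 0 < h) {θ : Param n m}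
    (hθ : θ ∈ modelSet q n m) {w yt : ℤ → ℝ} (hw : Subexp w) (hyt : Subexp yt) (k : ℤ) :
    target meth h θ w yt k - ∑ b, rightFactor meth h θ w yt k b * θ b =
      yt k - modelOutput h θ w k := by
  rcases meth with _ | _
  · have e : ∑ b, instrument h θ w k b * θ b =
        response q h w k (transfer q (polyB θ) (polyA θ ^ 2)) := by
      rw [← sylvester_self, ← sum_smul_gradFun hθ.2, map_sum]
      refine Finset.sum_congr rfl fun b _ => ?_
      rw [instrument_eq_response hm hh hθ hw, map_smul, smul_eq_mul, mul_comm]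
    simp only [target, rightFactor]
    rw [e, filt_polyB_sq_eq_response hm hh hθ hw, add_sub_cancel_right]
  · have e1 : ∑ r : Fin n, filt h (-(X ^ (r.val + 1))) (polyA θ) yt k * θ (Sum.inl r) =
        response q h yt k (transfer q 1 (polyA θ)) - yt k := by
      rw [← response_one (q := q) hh hyt k, ← map_sub, ← transfer_self hθ.2, ← transfer_sub]
      have : 1 - polyA θ = ∑ r : Fin n, C (θ (Sum.inl r)) * -(X ^ (r.val + 1)) := by
        rw [polyA, denPoly]
        simp only [den, mul_neg, Finset.sum_neg_distrib]
        ring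
      rw [this, transfer_sum, map_sum]
      refine Finset.sum_congr rfl fun r _ => ?_
      rw [filt_neg_X_pow_eq_response hh hθ hyt, transfer_C_mul, map_smul, smul_eq_mul, mul_comm]
    have e2 : ∑ r : Fin (m + 1), filt h (X ^ r.val) (polyA θ) w k * θ (Sum.inr r) =
        modelOutput h θ w k := by
      rw [modelOutput_eq_response hm hh hθ hw, modelFun, polyB, transfer_sum, map_sum]
      refine Finset.sum_congr rfl fun r _ => ?_
      have := instrument_eq_response hm hh hθ hw k (Sum.inr r)
      simp only [instrument, gradFun, Sum.elim_inr] at this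
      rw [this, transfer_C_mul, map_smul, smul_eq_mul, mul_comm]
    simp only [target, rightFactor, regressor, Fintype.sum_sum_type, Sum.elim_inl, Sum.elim_inr]
    rw [e1, e2, filt_one_eq_response hh hθ hyt]
    ring

theorem continuousAt_of_eventuallyEq_response {f : Param n m → ℝ} {F : Param n m → CircleFun q}
    {θ : Param n m} (hθ : θ ∈ modelSet q n m) {w : ℤ → ℝ} {k : ℤ}
    (he : ∀ θ ∈ modelSet q n m, f θ = response q h w k (F θ)) (hF : ContinuousAt F θ) :
    ContinuousAt f θ := by
  refine ContinuousAt.congr (f := fun θ => response q h w k (F θ))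
    ((response q h w k).continuous.continuousAt.comp hF) ?_
  filter_upwards [isOpen_modelSet.mem_nhds hθ] with θ' hθ' using (he θ' hθ').symm

theorem continuousAt_instrument (hm : m ≤ n) (hh : 0 < h) {θ : Param n m}
    (hθ : θ ∈ modelSet q n m) {w : ℤ → ℝ} (hw : Subexp w) (k : ℤ) (a : Fin n ⊕ Fin (m + 1)) :
    ContinuousAt (fun θ : Param n m => instrument h θ w k a) θ :=
  continuousAt_of_eventuallyEq_response hθ
    (fun _ hθ' => instrument_eq_response hm hh hθ' hw k a) (continuousAt_gradFun a hθ)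

theorem continuousAt_modelOutput (hm : m ≤ n) (hh : 0 < h) {θ : Param n m}
    (hθ : θ ∈ modelSet q n m) {w : ℤ → ℝ} (hw : Subexp w) (k : ℤ) :
    ContinuousAt (fun θ : Param n m => modelOutput h θ w k) θ :=
  continuousAt_of_eventuallyEq_response hθ
    (fun _ hθ' => modelOutput_eq_response hm hh hθ' hw k) (continuousAt_modelFun hθ)

theorem rightFactor_gaussNewton (θ : Param n m) (w yt : ℤ → ℝ) (k : ℤ) :
    rightFactor Method.gaussNewton h θ w yt k = instrument h θ w k := by
  rw [rightFactor]

theorem rightFactor_srivc_inl (θ : Param n m) (w yt : ℤ → ℝ) (k : ℤ) (r : Fin n) :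
    rightFactor Method.srivc h θ w yt k (Sum.inl r) =
      filt h (-(X ^ (r.val + 1))) (polyA θ) yt k := by
  rw [rightFactor, regressor, Sum.elim_inl]

theorem rightFactor_srivc_inr (θ : Param n m) (w yt : ℤ → ℝ) (k : ℤ) (r : Fin (m + 1)) :
    rightFactor Method.srivc h θ w yt k (Sum.inr r) = instrument h θ w k (Sum.inr r) := by
  rw [rightFactor, regressor, instrument, Sum.elim_inr, Sum.elim_inr]

theorem continuousAt_rightFactor (meth : Method) (hm : m ≤ n) (hh : 0 < h) {θ : Param n m}
    (hθ : θ ∈ modelSet q n m) {w yt : ℤ → ℝ} (hw : Subexp w) (hyt : Subexp yt) (k : ℤ)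
    (a : Fin n ⊕ Fin (m + 1)) :
    ContinuousAt (fun θ : Param n m => rightFactor meth h θ w yt k a) θ := by
  rcases meth with _ | _
  · have e : (fun θ : Param n m => rightFactor Method.gaussNewton h θ w yt k a) =
        fun θ => instrument h θ w k a := funext fun θ => by rw [rightFactor_gaussNewton]
    rw [e]
    exact continuousAt_instrument hm hh hθ hw k a
  rcases a with r | r
  · exact continuousAt_of_eventuallyEq_response hθ
      (fun θ' hθ' => (rightFactor_srivc_inl θ' w yt k r).trans
        (filt_neg_X_pow_eq_response hh hθ' hyt k r)) (continuousAt_transfer_polyA _ hθ)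
  · have e : (fun θ : Param n m => rightFactor Method.srivc h θ w yt k (Sum.inr r)) =
        fun θ => instrument h θ w k (Sum.inr r) := funext fun θ => rightFactor_srivc_inr θ w yt k r
    rw [e]
    exact continuousAt_instrument hm hh hθ hw k (Sum.inr r)

theorem continuousAt_target (meth : Method) (hm : m ≤ n) (hh : 0 < h) {θ : Param n m}
    (hθ : θ ∈ modelSet q n m) {w yt : ℤ → ℝ} (hw : Subexp w) (hyt : Subexp yt) (k : ℤ) :
    ContinuousAt (fun θ : Param n m => target meth h θ w yt k) θ := by
  rcases meth with _ | _
  · refine ContinuousAt.add (continuousAt_const.sub (continuousAt_modelOutput hm hh hθ hw k))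
      (continuousAt_of_eventuallyEq_response hθ
        (fun _ hθ' => filt_polyB_sq_eq_response hm hh hθ' hw k) ?_)
    simpa only [one_mul] using continuousAt_transfer_polyB_sq 1 hθ
  · exact continuousAt_of_eventuallyEq_response hθ
      (fun _ hθ' => filt_one_eq_response hh hθ' hyt k) (continuousAt_transfer_polyA _ hθ)

theorem normalVector_sub_mulVec (meth : Method) (N : ℕ) (θ ψ : Param n m) (w yt : ℤ → ℝ)
    (a : Fin n ⊕ Fin (m + 1)) :
    normalVector meth h N θ w yt a - (normalMatrix meth h N θ w yt).mulVec ψ a =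
      (1 / (N : ℝ)) * ∑ k ∈ Finset.Icc (1 : ℤ) N, instrument h θ w k a *
        (target meth h θ w yt k - ∑ b, rightFactor meth h θ w yt k b * ψ b) := by
  have e1 : normalVector meth h N θ w yt a = (1 / (N : ℝ)) * ∑ k ∈ Finset.Icc (1 : ℤ) N,
      instrument h θ w k a * target meth h θ w yt k := by
    simp [normalVector, Finset.sum_apply, mul_comm]
  have e2 : (normalMatrix meth h N θ w yt).mulVec ψ a = (1 / (N : ℝ)) *
      ∑ k ∈ Finset.Icc (1 : ℤ) N, instrument h θ w k a *
        ∑ b, rightFactor meth h θ w yt k b * ψ b := by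
    have e (b) : normalMatrix meth h N θ w yt a b = (1 / (N : ℝ)) *
        ∑ k ∈ Finset.Icc (1 : ℤ) N, instrument h θ w k a * rightFactor meth h θ w yt k b := by
      rw [normalMatrix, Matrix.smul_apply, Matrix.sum_apply, smul_eq_mul]
      rfl
    simp only [Matrix.mulVec, dotProduct, e, mul_assoc, Finset.sum_mul]
    rw [← Finset.mul_sum, Finset.sum_comm]
    simp only [Finset.mul_sum]
  rw [e1, e2, ← mul_sub, ← Finset.sum_sub_distrib]
  simp only [mul_sub]

/-- A limit of the inner iterations satisfies the normal equations. -/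
theorem sum_instrument_mul_residual_eq_zero (meth : Method) (hm : m ≤ n) (hh : 0 < h) {N : ℕ}
    {θ : Param n m} (hθ : θ ∈ modelSet q n m) {w yt : ℤ → ℝ} (hw : Subexp w) (hyt : Subexp yt)
    {θs : ℕ → Param n m} (hstep : ∀ s, θs (s + 1) = innerStep meth h N (θs s) w yt)
    (hdet : ∀ᶠ s in atTop, (normalMatrix meth h N (θs s) w yt).det ≠ 0)
    (hlim : Tendsto θs atTop (𝓝 θ)) (a : Fin n ⊕ Fin (m + 1)) :
    (1 / (N : ℝ)) * ∑ k ∈ Finset.Icc (1 : ℤ) N,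
      instrument h θ w k a * (yt k - modelOutput h θ w k) = 0 := by
  have h1 : ∀ᶠ s in atTop, (1 / (N : ℝ)) * ∑ k ∈ Finset.Icc (1 : ℤ) N, instrument h (θs s) w k a *
      (target meth h (θs s) w yt k - ∑ b, rightFactor meth h (θs s) w yt k b * θs (s + 1) b) = 0 := by
    filter_upwards [hdet] with s hs
    rw [← normalVector_sub_mulVec, hstep, innerStep, Matrix.mulVec_mulVec,
      Matrix.mul_nonsing_inv _ (isUnit_iff_ne_zero.2 hs), Matrix.one_mulVec, sub_self]
  -- Old and new iterates share their limit, so the parameters inside the filters and the vector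
  -- multiplied by the matrix become equal.
  have hlim' : Tendsto (fun s => θs (s + 1)) atTop (𝓝 θ) := hlim.comp (tendsto_add_atTop_nat 1)
  have h2 : Tendsto (fun s => (1 / (N : ℝ)) * ∑ k ∈ Finset.Icc (1 : ℤ) N,
      instrument h (θs s) w k a * (target meth h (θs s) w yt k -
        ∑ b, rightFactor meth h (θs s) w yt k b * θs (s + 1) b)) atTop
      (𝓝 ((1 / (N : ℝ)) * ∑ k ∈ Finset.Icc (1 : ℤ) N, instrument h θ w k a *
        (target meth h θ w yt k - ∑ b, rightFactor meth h θ w yt k b * θ b))) := by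
    refine Tendsto.const_mul _ (tendsto_finsetSum _ fun k _ => Tendsto.mul ?_ (Tendsto.sub ?_
      (tendsto_finsetSum _ fun b _ => Tendsto.mul ?_ ?_)))
    · exact (continuousAt_instrument hm hh hθ hw k a).tendsto.comp hlim
    · exact (continuousAt_target meth hm hh hθ hw hyt k).tendsto.comp hlim
    · exact (continuousAt_rightFactor meth hm hh hθ hw hyt k b).tendsto.comp hlim
    · exact ((continuous_apply b).tendsto θ).comp hlim'
  have h3 := tendsto_nhds_unique h2 (tendsto_const_nhds.congr' (h1.mono fun s hs => hs.symm))
  simpa only [target_sub_sum_rightFactor meth hm hh hθ hw hyt] using h3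

theorem innerStep_eq_self (meth : Method) (hm : m ≤ n) (hh : 0 < h) {N : ℕ}
    {θ : Param n m} (hθ : θ ∈ modelSet q n m) {w yt : ℤ → ℝ} (hw : Subexp w) (hyt : Subexp yt)
    (hdet : (normalMatrix meth h N θ w yt).det ≠ 0)
    (h0 : ∀ a, (1 / (N : ℝ)) * ∑ k ∈ Finset.Icc (1 : ℤ) N,
      instrument h θ w k a * (yt k - modelOutput h θ w k) = 0) :
    innerStep meth h N θ w yt = θ := by
  have h1 : normalVector meth h N θ w yt = (normalMatrix meth h N θ w yt).mulVec θ := by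
    funext a
    rw [← sub_eq_zero, normalVector_sub_mulVec, ← h0 a]
    simp only [target_sub_sum_rightFactor meth hm hh hθ hw hyt]
  rw [innerStep, h1, Matrix.mulVec_mulVec, Matrix.nonsing_inv_mul _ (isUnit_iff_ne_zero.2 hdet),
    Matrix.one_mulVec]

end Deterministic

/-! ### Descent limits are zeros of the score -/

section Score

variable {K : ℕ} {n m : Fin K → ℕ} {h : ℝ}

/-- The (scaled) gradient of the sum of squares of the prediction errors. -/
def score (h : ℝ) (N : ℕ) (u : Fin K → ℤ → ℝ) (y : ℤ → ℝ) (β : JointParam n m) (i : Fin K)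
    (a : Fin (n i) ⊕ Fin (m i + 1)) : ℝ :=
  (1 / (N : ℝ)) * ∑ k ∈ Finset.Icc (1 : ℤ) N,
    instrument h (β i) (u i) k a * (y k - ∑ j, modelOutput h (β j) (u j) k)

theorem subexp_modelOutput {p q : ℕ} (hm : q ≤ p) (hh : 0 < h) {θ : Param p q} (hθ : IsModel θ)
    {w : ℤ → ℝ} (hw : Subexp w) : Subexp (modelOutput h θ w) := by
  obtain ⟨c, hc⟩ := hθ.eventually_mem_modelSet.exists
  have e : modelOutput h θ w = fun k => response c h w k (modelFun c θ) :=
    funext fun k => modelOutput_eq_response hm hh hc hw k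
  rw [e]
  exact hw.response hh _

theorem subexp_residualOutput (hm : ∀ i, m i ≤ n i) (hh : 0 < h) {β : JointParam n m}
    (hβ : ∀ i, IsModel (β i)) (i : Fin K) {u : Fin K → ℤ → ℝ} (hu : ∀ i, Subexp (u i)) {y : ℤ → ℝ}
    (hy : Subexp y) : Subexp (residualOutput h β i u y) :=
  hy.sub (Subexp.sum _ fun j _ => subexp_modelOutput (hm j) hh (hβ j) (hu j))

theorem isModel_mixed {i : Fin K} {β β' : JointParam n m} (hβ : ∀ i, IsModel (β i))
    (hβ' : ∀ i, IsModel (β' i)) (j : Fin K) : IsModel (mixed i β β' j) := by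
  rw [mixed]
  split_ifs
  exacts [hβ j, hβ' j]

/-- Each inner limit satisfies its own normal equations. As the outer iteration proceeds, updated
and not yet updated submodels tend to the same limits, so all these equations hold jointly at `b`.
-/
theorem IsDescentLimit.score_eq_zero {meth : Method} (hm : ∀ i, m i ≤ n i) (hh : 0 < h) {N : ℕ}
    {u : Fin K → ℤ → ℝ} (hu : ∀ i, Subexp (u i)) {y : ℤ → ℝ} (hy : Subexp y) {b : JointParam n m}
    (hb : IsDescentLimit meth h N u y b) (i : Fin K) (a : Fin (n i) ⊕ Fin (m i + 1)) :
    score h N u y b i a = 0 := by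
  obtain ⟨hmodel, β, θ, hrun, hlim⟩ := hb
  have hmix : ∀ l i, IsModel (mixed i (β (l + 1)) (β l) i) := fun l i =>
    isModel_mixed (hrun.model (l + 1)) (hrun.model l) i
  have h1 : ∀ l, (1 / (N : ℝ)) * ∑ k ∈ Finset.Icc (1 : ℤ) N,
      instrument h (β (l + 1) i) (u i) k a *
        (residualOutput h (mixed i (β (l + 1)) (β l)) i u y k -
          modelOutput h (β (l + 1) i) (u i) k) = 0 := fun l => by
    obtain ⟨c, hc⟩ := (hrun.model (l + 1) i).eventually_mem_modelSet.exists
    exact sum_instrument_mul_residual_eq_zero meth (hm i) hh hc (hu i)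
      (subexp_residualOutput hm hh (isModel_mixed (hrun.model (l + 1)) (hrun.model l)) i hu hy)
      (hrun.inner_step l i) (hrun.nonsingular l i) (hrun.inner_limit l i) a
  have hl0 : ∀ j, Tendsto (fun l => β l j) atTop (𝓝 (b j)) := fun j =>
    ((continuous_apply j).tendsto b).comp hlim
  have hl1 : ∀ j, Tendsto (fun l => β (l + 1) j) atTop (𝓝 (b j)) := fun j =>
    (hl0 j).comp (tendsto_add_atTop_nat 1)
  have hlm : ∀ j, Tendsto (fun l => mixed i (β (l + 1)) (β l) j) atTop (𝓝 (b j)) := fun j => by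
    simp only [mixed]
    split_ifs
    exacts [hl1 j, hl0 j]
  have hout : ∀ (j : Fin K) (k : ℤ), ContinuousAt
      (fun θ : Param (n j) (m j) => modelOutput h θ (u j) k) (b j) := fun j k => by
    obtain ⟨c, hc⟩ := (hmodel j).eventually_mem_modelSet.exists
    exact continuousAt_modelOutput (hm j) hh hc (hu j) k
  have h2 : Tendsto (fun l => (1 / (N : ℝ)) * ∑ k ∈ Finset.Icc (1 : ℤ) N,
      instrument h (β (l + 1) i) (u i) k a *
        (residualOutput h (mixed i (β (l + 1)) (β l)) i u y k -
          modelOutput h (β (l + 1) i) (u i) k)) atTop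
      (𝓝 ((1 / (N : ℝ)) * ∑ k ∈ Finset.Icc (1 : ℤ) N, instrument h (b i) (u i) k a *
        ((y k - ∑ j ∈ Finset.univ.erase i, modelOutput h (b j) (u j) k) -
          modelOutput h (b i) (u i) k))) := by
    refine Tendsto.const_mul _ (tendsto_finsetSum _ fun k _ => Tendsto.mul ?_
      (Tendsto.sub (tendsto_const_nhds.sub (tendsto_finsetSum _ fun j _ => ?_)) ?_))
    · obtain ⟨c, hc⟩ := (hmodel i).eventually_mem_modelSet.exists
      exact (continuousAt_instrument (hm i) hh hc (hu i) k a).tendsto.comp (hl1 i)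
    · exact (hout j k).tendsto.comp (hlm j)
    · exact (hout i k).tendsto.comp (hl1 i)
  simp only [h1] at h2
  have h3 := tendsto_nhds_unique h2 tendsto_const_nhds
  rw [score, ← h3]
  congr 1
  refine Finset.sum_congr rfl fun k _ => ?_
  rw [sub_sub, Finset.sum_erase_add _ _ (Finset.mem_univ i)]

theorem isDescentLimit_of_score_eq_zero {meth : Method} (hm : ∀ i, m i ≤ n i) (hh : 0 < h) {N : ℕ}
    {u : Fin K → ℤ → ℝ} (hu : ∀ i, Subexp (u i)) {y : ℤ → ℝ} (hy : Subexp y) {b : JointParam n m}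
    (hb : ∀ i, IsModel (b i)) (h0 : ∀ i a, score h N u y b i a = 0)
    (hdet : ∀ i, (normalMatrix meth h N (b i) (u i) (residualOutput h b i u y)).det ≠ 0) :
    IsDescentLimit meth h N u y b := by
  have hmix : ∀ i, mixed i b b = b := fun i => funext fun j => by
    rw [mixed, ite_self]
  refine ⟨hb, fun _ => b, fun _ i _ => b i, ⟨fun _ => hb, fun _ i _ => hb i, fun _ i _ => ?_,
    fun _ i => ?_, fun _ _ => tendsto_const_nhds⟩, tendsto_const_nhds⟩
  · obtain ⟨c, hc⟩ := (hb i).eventually_mem_modelSet.exists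
    rw [hmix]
    refine (innerStep_eq_self meth (hm i) hh hc (hu i) (subexp_residualOutput hm hh hb i hu hy)
      (hdet i) fun a => ?_).symm
    rw [← h0 i a, score]
    congr 1
    refine Finset.sum_congr rfl fun k _ => ?_
    rw [residualOutput, sub_sub, Finset.sum_erase_add _ _ (Finset.mem_univ i)]
  · rw [hmix]
    exact Eventually.of_forall fun _ => hdet i

end Score

/-! ### Prediction errors and laws of large numbers -/

section PredictionError

variable {K : ℕ} {n m : Fin K → ℕ} {h : ℝ} {q : ℕ}

theorem continuous_dens : Continuous (dens : JointParam n m → Denominators n) :=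
  continuous_pi fun i => continuous_den.comp (continuous_apply i)

theorem isOpen_preimage_denSet : IsOpen {β : JointParam n m | dens β ∈ denSet q n} :=
  isOpen_denSet.preimage continuous_dens

/-- The prediction error at time `0` of the model `β`, when the true system is `βs`. -/
def predError (q : ℕ) (h : ℝ) (βs β : JointParam n m) (x : PathSpace K) : ℝ :=
  ∑ j, filteredInput q h j (modelFun q (βs j) - modelFun q (β j)) x + noisePath x 0

/-- The residual output of submodel `i` at time `0`. -/
def residualSignal (q : ℕ) (h : ℝ) (βs β : JointParam n m) (i : Fin K) (x : PathSpace K) : ℝ :=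
  predError q h βs β x + filteredInput q h i (modelFun q (β i)) x

/-- The right factor of the normal matrix at time `0`. -/
def rightSignal (meth : Method) (q : ℕ) (h : ℝ) (βs β : JointParam n m) (i : Fin K)
    (x : PathSpace K) (b : Fin (n i) ⊕ Fin (m i + 1)) : ℝ :=
  match meth, b with
  | Method.srivc, Sum.inl r => ∑' j : ℕ, coef q h j (transfer q (-(X ^ (r.val + 1))) (polyA (β i))) *
      residualSignal q h βs β i (shift (-j) x)
  | _, b => filteredInput q h i (gradFun q (β i) b) x

section Pathwise

variable {x : PathSpace K} {βs β : JointParam n m}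

theorem instrument_inputPath (hm : ∀ i, m i ≤ n i) (hh : 0 < h) (hx : ∀ i, Subexp (inputPath i x))
    (hβ : dens β ∈ denSet q n) (i : Fin K) (a : Fin (n i) ⊕ Fin (m i + 1)) (k : ℤ) :
    instrument h (β i) (inputPath i x) k a =
      filteredInput q h i (gradFun q (β i) a) (shift k x) := by
  rw [filteredInput_shift, instrument_eq_response (hm i) hh (hβ i) (hx i)]

theorem output_sub_sum_modelOutput (hm : ∀ i, m i ≤ n i) (hh : 0 < h)
    (hx : ∀ i, Subexp (inputPath i x)) (hβs : dens βs ∈ denSet q n) (hβ : dens β ∈ denSet q n)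
    (k : ℤ) : output h βs (fun i => inputPath i x) (noisePath x) k -
      ∑ j, modelOutput h (β j) (inputPath j x) k = predError q h βs β (shift k x) := by
  have e : ∀ {β : JointParam n m}, dens β ∈ denSet q n → ∀ j,
      modelOutput h (β j) (inputPath j x) k = response q h (inputPath j x) k (modelFun q (β j)) :=
    fun hβ j => modelOutput_eq_response (hm j) hh (hβ j) (hx j) k
  simp only [output, predError, filteredInput_shift, e hβs, e hβ, map_sub, Finset.sum_sub_distrib,
    noisePath_shift, zero_add]
  ring

theorem residualOutput_output (hm : ∀ i, m i ≤ n i) (hh : 0 < h)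
    (hx : ∀ i, Subexp (inputPath i x)) (hβs : dens βs ∈ denSet q n) (hβ : dens β ∈ denSet q n)
    (i : Fin K) (k : ℤ) :
    residualOutput h β i (fun i => inputPath i x)
      (output h βs (fun i => inputPath i x) (noisePath x)) k =
      residualSignal q h βs β i (shift k x) := by
  rw [residualSignal, ← output_sub_sum_modelOutput hm hh hx hβs hβ, filteredInput_shift,
    ← modelOutput_eq_response (hm i) hh (hβ i) (hx i), residualOutput,
    ← Finset.sum_erase_add _ _ (Finset.mem_univ i)]
  ring

theorem subexp_output (hm : ∀ i, m i ≤ n i) (hh : 0 < h) (hβs : ∀ i, IsModel (βs i))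
    (hx : ∀ i, Subexp (inputPath i x)) (hv : Subexp (noisePath x)) :
    Subexp (output h βs (fun i => inputPath i x) (noisePath x)) :=
  (Subexp.sum _ fun j _ => subexp_modelOutput (hm j) hh (hβs j) (hx j)).add hv

theorem rightFactor_residualOutput (meth : Method) (hm : ∀ i, m i ≤ n i) (hh : 0 < h)
    (hx : ∀ i, Subexp (inputPath i x))
    (hβs : dens βs ∈ denSet q n) (hβ : dens β ∈ denSet q n) (i : Fin K)
    (hres : Subexp (residualOutput h β i (fun i => inputPath i x)
      (output h βs (fun i => inputPath i x) (noisePath x))))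
    (b : Fin (n i) ⊕ Fin (m i + 1)) (k : ℤ) :
    rightFactor meth h (β i) (inputPath i x) (residualOutput h β i (fun i => inputPath i x)
      (output h βs (fun i => inputPath i x) (noisePath x))) k b =
      rightSignal meth q h βs β i (shift k x) b := by
  rcases meth with _ | _
  · rw [rightFactor_gaussNewton, instrument_inputPath hm hh hx hβ, rightSignal]
    simp
  rcases b with r | r
  · rw [rightFactor_srivc_inl, filt_neg_X_pow_eq_response hh (hβ i) hres,
      ← (hres.hasSum_response hh k _).tsum_eq, rightSignal]
    refine tsum_congr fun j => ?_
    rw [residualOutput_output hm hh hx hβs hβ, shift_shift]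
    congr 3
    ring
  · rw [rightFactor_srivc_inr, instrument_inputPath hm hh hx hβ, rightSignal]
    simp

end Pathwise

variable {μ : Measure (PathSpace K)} {βs : JointParam n m}

theorem SignalLaw.dominated_gradFun (hμ : SignalLaw μ) (hh : 0 < h) (i : Fin K)
    (a : Fin (n i) ⊕ Fin (m i + 1)) :
    Dominated μ fun (β : {β : JointParam n m // dens β ∈ denSet q n}) x =>
      filteredInput q h i (gradFun q (β.1 i) a) x :=
  hμ.dominated_filteredInput hh i (continuous_iff_continuousAt.2 fun β =>
    (continuousAt_gradFun a (β.2 i)).comp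
      ((continuous_apply i).comp continuous_subtype_val).continuousAt)

theorem continuous_modelFun_subtype (i : Fin K) :
    Continuous fun β : {β : JointParam n m // dens β ∈ denSet q n} => modelFun q (β.1 i) :=
  continuous_iff_continuousAt.2 fun β =>
    (continuousAt_modelFun (β.2 i)).comp
      ((continuous_apply i).comp continuous_subtype_val).continuousAt

theorem SignalLaw.dominated_predError (hμ : SignalLaw μ) (hh : 0 < h) (βs : JointParam n m) :
    Dominated μ fun (β : {β : JointParam n m // dens β ∈ denSet q n}) x =>
      predError q h βs β.1 x :=
  (Dominated.sum _ fun i _ => hμ.dominated_filteredInput hh i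
    (f := fun β : {β : JointParam n m // dens β ∈ denSet q n} =>
      modelFun q (βs i) - modelFun q (β.1 i))
    (continuous_const.sub (continuous_modelFun_subtype i))).add (dominated_const hμ.memLp_noise)

theorem SignalLaw.dominated_rightSignal (hμ : SignalLaw μ) (hh : 0 < h) (meth : Method)
    (βs : JointParam n m) (i : Fin K) (b : Fin (n i) ⊕ Fin (m i + 1)) :
    Dominated μ fun (β : {β : JointParam n m // dens β ∈ denSet q n}) x =>
      rightSignal meth q h βs β.1 i x b := by
  rcases meth with _ | _
  · simpa only [rightSignal] using hμ.dominated_gradFun hh i b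
  rcases b with r | r
  · simp only [rightSignal]
    refine Dominated.filter hμ.ergodic ((hμ.dominated_predError hh βs).add
      (hμ.dominated_filteredInput hh i (continuous_modelFun_subtype i))) hh
      (continuous_iff_continuousAt.2 fun β => ?_)
    exact ContinuousAt.comp (f := fun β : {β : JointParam n m // dens β ∈ denSet q n} => β.1 i)
      (g := fun θ : Param (n i) (m i) => transfer q (-(X ^ (r.val + 1))) (polyA θ))
      (continuousAt_transfer_polyA _ (β.2 i)) ((continuous_apply i).comp continuous_subtype_val).continuousAt
  · simpa only [rightSignal] using hμ.dominated_gradFun hh i (Sum.inr r)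

/-- The product filter states the local uniformity jointly in the sample size and the parameter,
ready for composition with `N ↦ (N, bN N)`. -/
theorem SignalLaw.ae_average_mul_near [IsProbabilityMeasure μ] (hμ : SignalLaw μ)
    {P Q : JointParam n m → PathSpace K → ℝ}
    (hP : Dominated μ fun (β : {β : JointParam n m // dens β ∈ denSet q n}) x => P β.1 x)
    (hQ : Dominated μ fun (β : {β : JointParam n m // dens β ∈ denSet q n}) x => Q β.1 x) :
    ∀ᵐ x ∂μ, ∀ β₀, dens β₀ ∈ denSet q n → ∀ ε > 0,
      ∀ᶠ p : ℕ × JointParam n m in atTop ×ˢ 𝓝 β₀,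
      |(1 / (p.1 : ℝ)) * ∑ k ∈ Finset.Icc (1 : ℤ) p.1, P p.2 (shift k x) * Q p.2 (shift k x) -
        ∫ y, P β₀ y * Q β₀ y ∂μ| < ε := by
  filter_upwards [hP.ae_eventually_average_mul_near hμ.ergodic hQ] with x hx β₀ hβ₀ ε hε
  obtain ⟨U, hU, hUN⟩ := hx ⟨β₀, hβ₀⟩ ε hε
  rw [nhds_subtype_eq_comap] at hU
  obtain ⟨W, hW, hWU⟩ := hU
  filter_upwards [hUN.prod_mk (inter_mem hW (isOpen_preimage_denSet.mem_nhds hβ₀))] with p hp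
  exact hp.1 ⟨p.2, hp.2.2⟩ (hWU hp.2.1)

/-- Uniform laws of large numbers for the score, the loss and the normal matrices. -/
structure TypicalPath (μ : Measure (PathSpace K)) (h : ℝ) (βs : JointParam n m)
    (x : PathSpace K) : Prop where
  subexp_input : ∀ i, Subexp (inputPath i x)
  subexp_noise : Subexp (noisePath x)
  average_score : ∀ q, ∀ i a β₀, dens β₀ ∈ denSet q n → ∀ ε > 0,
    ∀ᶠ p : ℕ × JointParam n m in atTop ×ˢ 𝓝 β₀,
      |(1 / (p.1 : ℝ)) * ∑ k ∈ Finset.Icc (1 : ℤ) p.1,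
          filteredInput q h i (gradFun q (p.2 i) a) (shift k x) * predError q h βs p.2 (shift k x) -
        ∫ y, filteredInput q h i (gradFun q (β₀ i) a) y * predError q h βs β₀ y ∂μ| < ε
  average_loss : ∀ q, ∀ β₀, dens β₀ ∈ denSet q n → ∀ ε > 0,
    ∀ᶠ p : ℕ × JointParam n m in atTop ×ˢ 𝓝 β₀,
      |(1 / (p.1 : ℝ)) * ∑ k ∈ Finset.Icc (1 : ℤ) p.1,
          predError q h βs p.2 (shift k x) * predError q h βs p.2 (shift k x) -
        ∫ y, predError q h βs β₀ y * predError q h βs β₀ y ∂μ| < ε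
  average_normal : ∀ q, ∀ meth i a b β₀, dens β₀ ∈ denSet q n → ∀ ε > 0,
    ∀ᶠ p : ℕ × JointParam n m in atTop ×ˢ 𝓝 β₀,
      |(1 / (p.1 : ℝ)) * ∑ k ∈ Finset.Icc (1 : ℤ) p.1,
          filteredInput q h i (gradFun q (p.2 i) a) (shift k x) *
            rightSignal meth q h βs p.2 i (shift k x) b -
        ∫ y, filteredInput q h i (gradFun q (β₀ i) a) y *
          rightSignal meth q h βs β₀ i y b ∂μ| < ε

theorem SignalLaw.ae_typicalPath [IsProbabilityMeasure μ] (hμ : SignalLaw μ) (hh : 0 < h)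
    (βs : JointParam n m) : ∀ᵐ x ∂μ, TypicalPath μ h βs x := by
  have h1 : ∀ᵐ x ∂μ, ∀ q, ∀ i a β₀, dens β₀ ∈ denSet q n → ∀ ε > 0,
      ∀ᶠ p : ℕ × JointParam n m in atTop ×ˢ 𝓝 β₀,
      |(1 / (p.1 : ℝ)) * ∑ k ∈ Finset.Icc (1 : ℤ) p.1,
          filteredInput q h i (gradFun q (p.2 i) a) (shift k x) * predError q h βs p.2 (shift k x) -
        ∫ y, filteredInput q h i (gradFun q (β₀ i) a) y * predError q h βs β₀ y ∂μ| < ε :=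
    ae_all_iff.2 fun q => ae_all_iff.2 fun i => ae_all_iff.2 fun a =>
      hμ.ae_average_mul_near (P := fun β => filteredInput q h i (gradFun q (β i) a))
        (Q := predError q h βs) (hμ.dominated_gradFun hh i a) (hμ.dominated_predError hh βs)
  have h2 : ∀ᵐ x ∂μ, ∀ q, ∀ β₀, dens β₀ ∈ denSet q n → ∀ ε > 0,
      ∀ᶠ p : ℕ × JointParam n m in atTop ×ˢ 𝓝 β₀,
      |(1 / (p.1 : ℝ)) * ∑ k ∈ Finset.Icc (1 : ℤ) p.1,
          predError q h βs p.2 (shift k x) * predError q h βs p.2 (shift k x) -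
        ∫ y, predError q h βs β₀ y * predError q h βs β₀ y ∂μ| < ε :=
    ae_all_iff.2 fun q => hμ.ae_average_mul_near (P := predError q h βs) (Q := predError q h βs)
      (hμ.dominated_predError hh βs) (hμ.dominated_predError hh βs)
  have h3 : ∀ meth, ∀ᵐ x ∂μ, ∀ q, ∀ i a b β₀, dens β₀ ∈ denSet q n → ∀ ε > 0,
      ∀ᶠ p : ℕ × JointParam n m in atTop ×ˢ 𝓝 β₀,
      |(1 / (p.1 : ℝ)) * ∑ k ∈ Finset.Icc (1 : ℤ) p.1,
          filteredInput q h i (gradFun q (p.2 i) a) (shift k x) *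
            rightSignal meth q h βs p.2 i (shift k x) b -
        ∫ y, filteredInput q h i (gradFun q (β₀ i) a) y *
          rightSignal meth q h βs β₀ i y b ∂μ| < ε := fun meth =>
    ae_all_iff.2 fun q => ae_all_iff.2 fun i => ae_all_iff.2 fun a => ae_all_iff.2 fun b =>
      hμ.ae_average_mul_near (P := fun β => filteredInput q h i (gradFun q (β i) a))
        (Q := fun β x => rightSignal meth q h βs β i x b) (hμ.dominated_gradFun hh i a)
        (hμ.dominated_rightSignal hh meth βs i b)
  filter_upwards [hμ.ae_subexp_input, hμ.ae_subexp_noise, h1, h2, h3 Method.gaussNewton,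
    h3 Method.srivc] with x hu hv hs hl hg hr
  exact ⟨hu, hv, hs, hl, fun q meth => by cases meth; exacts [hg q, hr q]⟩

theorem SignalLaw.memLp_sum_filteredInput (hμ : SignalLaw μ) (hh : 0 < h)
    (f : Fin K → CircleFun q) : MemLp (fun x => ∑ j, filteredInput q h j (f j) x) 2 μ :=
  memLp_finsetSum _ fun j _ => hμ.memLp_filteredInput hh j (f j)

theorem SignalLaw.integral_filteredInput_mul_predError (hμ : SignalLaw μ) (hh : 0 < h)
    (βs β : JointParam n m) (i : Fin K) (f : CircleFun q) :
    ∫ x, filteredInput q h i f x * predError q h βs β x ∂μ = ∫ x, filteredInput q h i f x *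
      ∑ j, filteredInput q h j (modelFun q (βs j) - modelFun q (β j)) x ∂μ := by
  simp only [predError, mul_add]
  have h1 : Integrable (fun x => filteredInput q h i f x *
      ∑ j, filteredInput q h j (modelFun q (βs j) - modelFun q (β j)) x) μ :=
    (hμ.memLp_filteredInput hh i f).integrable_mul
      (hμ.memLp_sum_filteredInput hh fun j => modelFun q (βs j) - modelFun q (β j))
  have h2 : Integrable (fun x => filteredInput q h i f x * noisePath x 0) μ :=
    (hμ.memLp_filteredInput hh i f).integrable_mul hμ.memLp_noise
  rw [integral_add h1 h2, hμ.integral_filteredInput_mul_noise hh, add_zero]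

/-- The empirical score is exactly zero at the approximating estimates, so its locally uniform
limit, the expected score, vanishes at `β`. -/
theorem TypicalPath.eq_of_isConvergingPoint (hμ : SignalLaw μ) (hh : 0 < h)
    (hm : ∀ i, m i ≤ n i) (hβs : ∀ i, IsModel (βs i)) (hβsD : dens βs ∈ denRegion h n)
    {x : PathSpace K} (hx : TypicalPath μ h βs x) {meth : Method} {β : JointParam n m}
    (hβ : ∀ i, IsModel (β i)) (hgood : (dens βs, dens β) ∈ goodSet μ h n m)
    (hconv : IsConvergingPoint meth h (fun i => inputPath i x)
      (output h βs (fun i => inputPath i x) (noisePath x)) β) : β = βs := by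
  obtain ⟨q, hsq, hq⟩ := ((eventually_mem_denSet hβsD).and (eventually_mem_denSet hgood.1.2)).exists
  obtain ⟨bN, hlim, hb⟩ := hconv
  refine hμ.eq_of_integral_gradFun_mul_eq_zero hh hm hsq hβ hq hgood.2 fun i a => ?_
  rw [← hμ.integral_filteredInput_mul_predError hh]
  refine abs_eq_zero.1 (le_antisymm (le_of_forall_pos_lt_add fun ε hε => ?_) (abs_nonneg _))
  have hpair : Tendsto (fun N => (N, bN N)) atTop (atTop ×ˢ 𝓝 β) := tendsto_id.prodMk hb
  obtain ⟨N, h1, h2, h3⟩ := ((hpair.eventually (hx.average_score q i a β hq ε hε)).and (hlim.and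
    (hb.eventually (isOpen_preimage_denSet.mem_nhds hq)))).exists
  have h4 := h2.score_eq_zero hm hh hx.subexp_input
    (subexp_output hm hh hβs hx.subexp_input hx.subexp_noise) i a
  simp only [score, output_sub_sum_modelOutput hm hh hx.subexp_input hsq h3,
    instrument_inputPath hm hh hx.subexp_input h3] at h4
  simp only [h4, zero_sub, abs_neg] at h1
  simpa using h1

end PredictionError

/-! ### Consistency of the minimizers of the loss -/

section Consistency

variable {K : ℕ} {n m : Fin K → ℕ} {h : ℝ} {q : ℕ} {βs β : JointParam n m}

theorem predError_self (q : ℕ) (h : ℝ) (βs : JointParam n m) (x : PathSpace K) :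
    predError q h βs βs x = noisePath x 0 := by
  simp [predError, filteredInput]

theorem predError_update (q : ℕ) (h : ℝ) (βs β : JointParam n m) (i : Fin K)
    (θ : Param (n i) (m i)) (x : PathSpace K) :
    predError q h βs (Function.update β i θ) x = predError q h βs β x +
      filteredInput q h i (modelFun q (β i)) x - filteredInput q h i (modelFun q θ) x := by
  simp only [predError]
  rw [← Finset.sum_erase_add _ _ (Finset.mem_univ i), ← Finset.sum_erase_add _ _ (Finset.mem_univ i),
    Finset.sum_congr rfl fun j hj => by rw [Function.update_of_ne (Finset.ne_of_mem_erase hj)],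
    Function.update_self]
  simp only [filteredInput, map_sub]
  ring

theorem continuousAt_predError (hβ : dens β ∈ denSet q n) (x : PathSpace K) :
    ContinuousAt (fun β : JointParam n m => predError q h βs β x) β := by
  refine ContinuousAt.add (tendsto_finsetSum _ fun j _ => ?_) continuousAt_const
  have h1 : ContinuousAt (fun β : JointParam n m => modelFun q (β j)) β :=
    ContinuousAt.comp (f := fun β : JointParam n m => β j) (continuousAt_modelFun (hβ j))
      (continuous_apply j).continuousAt
  have h2 : ContinuousAt (fun β : JointParam n m => filteredInput q h j (modelFun q (βs j)) x -
      filteredInput q h j (modelFun q (β j)) x) β :=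
    continuousAt_const.sub
      ((response q h (inputPath j x) 0).continuous.continuousAt.comp h1)
  have e : (fun β : JointParam n m => filteredInput q h j (modelFun q (βs j) - modelFun q (β j)) x) =
      fun β => filteredInput q h j (modelFun q (βs j)) x -
        filteredInput q h j (modelFun q (β j)) x := by
    funext β
    simp only [filteredInput, map_sub]
  change ContinuousAt (fun β : JointParam n m =>
    filteredInput q h j (modelFun q (βs j) - modelFun q (β j)) x) β
  rw [e]
  exact h2

theorem hasDerivAt_predError_update (hβ : dens β ∈ denSet q n) (i : Fin K)
    (a : Fin (n i) ⊕ Fin (m i + 1)) (x : PathSpace K) :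
    HasDerivAt (fun t : ℝ =>
      predError q h βs (Function.update β i (β i + t • (Pi.single a 1 : Param (n i) (m i)))) x)
      (-filteredInput q h i (gradFun q (β i) a) x) 0 := by
  simp only [predError_update]
  exact ((response q h (inputPath i x) 0).hasFDerivAt.comp_hasDerivAt (0 : ℝ)
    (hasDerivAt_modelFun a (hβ i))).const_sub _

/-- The loss function of the first `N` samples. -/
def loss (q : ℕ) (h : ℝ) (βs : JointParam n m) (x : PathSpace K) (N : ℕ) (β : JointParam n m) : ℝ :=
  (1 / (N : ℝ)) * ∑ k ∈ Finset.Icc (1 : ℤ) N,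
    predError q h βs β (shift k x) * predError q h βs β (shift k x)

theorem continuousAt_loss (hβ : dens β ∈ denSet q n) (x : PathSpace K) (N : ℕ) :
    ContinuousAt (loss q h βs x N) β :=
  continuousAt_const.mul (tendsto_finsetSum _ fun k _ =>
    (continuousAt_predError hβ (shift k x)).mul (continuousAt_predError hβ (shift k x)))

theorem sum_gradFun_mul_predError_eq_zero_of_isLocalMin (hβ : dens β ∈ denSet q n) {x : PathSpace K}
    {N : ℕ} (hmin : IsLocalMin (loss q h βs x N) β) (i : Fin K) (a : Fin (n i) ⊕ Fin (m i + 1)) :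
    (1 / (N : ℝ)) * ∑ k ∈ Finset.Icc (1 : ℤ) N, filteredInput q h i (gradFun q (β i) a) (shift k x) *
      predError q h βs β (shift k x) = 0 := by
  set c : ℝ → JointParam n m := fun t =>
    Function.update β i (β i + t • (Pi.single a 1 : Param (n i) (m i))) with hc
  have hc0 : c 0 = β := by simp [hc]
  have hcc : Continuous c := by
    refine continuous_const.update i ?_
    fun_prop
  have hmin' : IsLocalMin (fun t => loss q h βs x N (c t)) 0 := by
    have h1 : Tendsto c (𝓝 0) (𝓝 β) := by
      simpa [hc0] using hcc.tendsto 0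
    change ∀ᶠ t in 𝓝 0, loss q h βs x N (c 0) ≤ loss q h βs x N (c t)
    rw [hc0]
    exact h1.eventually hmin
  have hd : HasDerivAt (fun t => loss q h βs x N (c t)) ((1 / (N : ℝ)) *
      ∑ k ∈ Finset.Icc (1 : ℤ) N,
        (-filteredInput q h i (gradFun q (β i) a) (shift k x) * predError q h βs (c 0) (shift k x) +
          predError q h βs (c 0) (shift k x) *
            -filteredInput q h i (gradFun q (β i) a) (shift k x))) 0 :=
    (HasDerivAt.fun_sum fun k _ => (hasDerivAt_predError_update hβ i a (shift k x)).mul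
      (hasDerivAt_predError_update hβ i a (shift k x))).const_mul _
  have h0 := hmin'.hasDerivAt_eq_zero hd
  rw [hc0] at h0
  have e : ∀ k, -filteredInput q h i (gradFun q (β i) a) (shift k x) *
      predError q h βs β (shift k x) + predError q h βs β (shift k x) *
        -filteredInput q h i (gradFun q (β i) a) (shift k x) =
      -2 * (filteredInput q h i (gradFun q (β i) a) (shift k x) *
        predError q h βs β (shift k x)) := fun k => by ring
  simp only [e, ← Finset.mul_sum] at h0
  linarith

variable {μ : Measure (PathSpace K)}

/-- The cross term vanishes since the noise is orthogonal to all filtered inputs. -/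
theorem SignalLaw.integral_sq_predError (hμ : SignalLaw μ) (hh : 0 < h) (βs β : JointParam n m) :
    ∫ x, predError q h βs β x * predError q h βs β x ∂μ =
      ∫ x, (∑ j, filteredInput q h j (modelFun q (βs j) - modelFun q (β j)) x) *
        (∑ j, filteredInput q h j (modelFun q (βs j) - modelFun q (β j)) x) ∂μ +
      ∫ x, noisePath x 0 * noisePath x 0 ∂μ := by
  set D := fun x => ∑ j, filteredInput q h j (modelFun q (βs j) - modelFun q (β j)) x with hD
  have hDm : MemLp D 2 μ := hμ.memLp_sum_filteredInput hh _
  have h1 : Integrable (fun x => D x * D x) μ := hDm.integrable_mul hDm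
  have h2 : Integrable (fun x => D x * noisePath x 0) μ := hDm.integrable_mul hμ.memLp_noise
  have h3 : Integrable (fun x => noisePath x 0 * noisePath x 0) μ :=
    hμ.memLp_noise.integrable_mul hμ.memLp_noise
  have h4 : ∫ x, D x * noisePath x 0 ∂μ = 0 := by
    have hint : ∀ j, Integrable (fun x => filteredInput q h j (modelFun q (βs j) -
        modelFun q (β j)) x * noisePath x 0) μ := fun j =>
      (hμ.memLp_filteredInput hh j _).integrable_mul hμ.memLp_noise
    simp only [hD, Finset.sum_mul]
    rw [integral_finsetSum _ fun j _ => hint j]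
    exact Finset.sum_eq_zero fun j _ => hμ.integral_filteredInput_mul_noise hh j _
  have e : ∀ x, predError q h βs β x * predError q h βs β x =
      D x * D x + 2 * (D x * noisePath x 0) + noisePath x 0 * noisePath x 0 := fun x => by
    rw [predError]
    ring
  simp only [e]
  have h12 : Integrable (fun x => D x * D x + 2 * (D x * noisePath x 0)) μ := h1.add (h2.const_mul 2)
  rw [integral_add h12 h3, integral_add h1 (h2.const_mul 2),
    integral_const_mul, h4, mul_zero, add_zero]

/-- The expected loss has a strict minimum at the true parameters. -/
theorem SignalLaw.eq_of_integral_sq_predError_le (hμ : SignalLaw μ) (hh : 0 < h)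
    (hm : ∀ i, m i ≤ n i) (hβs : dens βs ∈ denSet q n) (hβ : ∀ i, IsModel (β i))
    (hβq : dens β ∈ denSet q n) (hdet : (crossMatrix μ h n m (dens βs, dens β)).det ≠ 0)
    (hle : ∫ x, predError q h βs β x * predError q h βs β x ∂μ ≤
      ∫ x, predError q h βs βs x * predError q h βs βs x ∂μ) : β = βs := by
  refine hμ.eq_of_integral_gradFun_mul_eq_zero hh hm hβs hβ hβq hdet fun i a => ?_
  rw [hμ.integral_sq_predError hh] at hle
  simp only [predError_self, add_le_iff_nonpos_left] at hle
  have hDm := hμ.memLp_sum_filteredInput hh fun j => modelFun q (βs j) - modelFun q (β j)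
  have h0 := (integral_eq_zero_iff_of_nonneg (fun x => mul_self_nonneg _)
    (hDm.integrable_mul hDm)).1 (le_antisymm hle (integral_nonneg fun x => mul_self_nonneg _))
  refine integral_eq_zero_of_ae ?_
  filter_upwards [h0] with x hx
  rw [mul_self_eq_zero.1 hx, mul_zero]
  rfl

theorem SignalLaw.expectedNormalMatrix_eq (hμ : SignalLaw μ) (hh : 0 < h) (hm : ∀ i, m i ≤ n i)
    (meth : Method) (hβs : ∀ i, IsModel (βs i)) (hβq : dens βs ∈ denSet q n) (i : Fin K) :
    expectedNormalMatrix μ meth h (fun i k x => inputPath i x k) (fun k x => noisePath x k) βs i =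
      Matrix.of fun a b => ∫ x, filteredInput q h i (gradFun q (βs i) a) x *
        rightSignal meth q h βs βs i x b ∂μ := by
  ext a b
  refine integral_congr_ae ?_
  filter_upwards [hμ.ae_subexp_input, hμ.ae_subexp_noise] with x hx hv
  have h1 := instrument_inputPath hm hh hx hβq i a 0
  have h2 := rightFactor_residualOutput meth hm hh hx hβq hβq i (subexp_residualOutput hm hh hβs i hx
    (subexp_output hm hh hβs hx hv)) b 0
  rw [shift_zero] at h1 h2
  rw [← h1, ← h2]

theorem normalMatrix_apply {p r : ℕ} (meth : Method) (N : ℕ) (θ : Param p r) (w yt : ℤ → ℝ)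
    (a b : Fin p ⊕ Fin (r + 1)) : normalMatrix meth h N θ w yt a b = (1 / (N : ℝ)) *
      ∑ k ∈ Finset.Icc (1 : ℤ) N, instrument h θ w k a * rightFactor meth h θ w yt k b := by
  rw [normalMatrix, Matrix.smul_apply, Matrix.sum_apply, smul_eq_mul]
  rfl

theorem TypicalPath.tendsto_normalMatrix (hh : 0 < h) (hm : ∀ i, m i ≤ n i)
    (hβs : ∀ i, IsModel (βs i)) (hsq : dens βs ∈ denSet q n) {x : PathSpace K}
    (hx : TypicalPath μ h βs x) (meth : Method) {bN : ℕ → JointParam n m}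
    (hb : Tendsto bN atTop (𝓝 βs)) (hmodel : ∀ᶠ N in atTop, ∀ i, IsModel (bN N i)) (i : Fin K) :
    Tendsto (fun N => normalMatrix meth h N (bN N i) (inputPath i x)
      (residualOutput h (bN N) i (fun i => inputPath i x)
        (output h βs (fun i => inputPath i x) (noisePath x)))) atTop
      (𝓝 (Matrix.of fun a b => ∫ x, filteredInput q h i (gradFun q (βs i) a) x *
        rightSignal meth q h βs βs i x b ∂μ)) := by
  refine tendsto_pi_nhds.2 fun a => tendsto_pi_nhds.2 fun b => ?_
  have hpair : Tendsto (fun N => (N, bN N)) atTop (atTop ×ˢ 𝓝 βs) := tendsto_id.prodMk hb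
  rw [Metric.tendsto_nhds]
  intro ε hε
  filter_upwards [hpair.eventually (hx.average_normal q meth i a b βs hsq ε hε), hmodel,
    hb.eventually (isOpen_preimage_denSet.mem_nhds hsq)] with N h1 h2 h3
  have hres := subexp_residualOutput hm hh h2 i hx.subexp_input
    (subexp_output hm hh hβs hx.subexp_input hx.subexp_noise)
  rw [Real.dist_eq, normalMatrix_apply]
  simp only [instrument_inputPath hm hh hx.subexp_input h3,
    rightFactor_residualOutput meth hm hh hx.subexp_input hsq h3 i hres]
  exact h1

/-- The minimizers of the loss on a small ball around the true parameters are consistent. -/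
theorem TypicalPath.tendsto_of_isMinOn (hμ : SignalLaw μ) (hh : 0 < h) (hm : ∀ i, m i ≤ n i)
    (hsq : dens βs ∈ denSet q n) {x : PathSpace K} (hx : TypicalPath μ h βs x)
    {s : Set (JointParam n m)} (hs : IsCompact s) (hss : βs ∈ s)
    (hsm : ∀ β ∈ s, (∀ i, IsModel (β i)) ∧ dens β ∈ denSet q n ∧
      (dens βs, dens β) ∈ goodSet μ h n m) {bN : ℕ → JointParam n m} (hbs : ∀ N, bN N ∈ s)
    (hmin : ∀ N, IsMinOn (loss q h βs x N) s (bN N)) : Tendsto bN atTop (𝓝 βs) := by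
  -- By compactness only cluster points need to be identified. At such a point the expected loss
  -- does not exceed that of the true parameters, since each minimizer beats `βs` empirically.
  refine hs.tendsto_nhds_of_unique_mapClusterPt (Eventually.of_forall hbs) fun b hb hcl => ?_
  obtain ⟨hbm, hbq, hbg⟩ := hsm b hb
  refine hμ.eq_of_integral_sq_predError_le hh hm hsq hbm hbq hbg.2
    (le_of_forall_pos_le_add fun ε hε => ?_)
  obtain ⟨pa, hpa, pb, hpb, hab⟩ :=
    eventually_prod_iff.1 (hx.average_loss q b hbq (ε / 2) (half_pos hε))
  have hs0 := (tendsto_id.prodMk (tendsto_const_nhds (x := βs))).eventually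
    (hx.average_loss q βs hsq (ε / 2) (half_pos hε))
  obtain ⟨N, hN, hNa, hNs⟩ :=
    ((mapClusterPt_iff_frequently.1 hcl _ hpb).and_eventually (hpa.and hs0)).exists
  have h1 := (abs_lt.1 (hab hNa hN)).1
  have h2 := (abs_lt.1 hNs).2
  have h3 : loss q h βs x N (bN N) ≤ loss q h βs x N βs := hmin N hss
  simp only [loss] at h3
  simp only [id] at h1 h2
  linarith

theorem TypicalPath.isConvergingPoint (hμ : SignalLaw μ) (hh : 0 < h) (hm : ∀ i, m i ≤ n i)
    (hopen : IsOpen (goodSet μ h n m)) (hβs : ∀ i, IsModel (βs i)) (hβsD : dens βs ∈ denRegion h n)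
    (hgood : (dens βs, dens βs) ∈ goodSet μ h n m) {x : PathSpace K} (hx : TypicalPath μ h βs x)
    {meth : Method} (hdet : meth = Method.srivc → ∀ i, (expectedNormalMatrix μ meth h
      (fun i k x => inputPath i x k) (fun k x => noisePath x k) βs i).det ≠ 0) :
    IsConvergingPoint meth h (fun i => inputPath i x)
      (output h βs (fun i => inputPath i x) (noisePath x)) βs := by
  obtain ⟨q, hsq⟩ := (eventually_mem_denSet hβsD).exists
  have hnhds : {β : JointParam n m | (∀ i, IsModel (β i)) ∧ dens β ∈ denSet q n ∧
      (dens βs, dens β) ∈ goodSet μ h n m} ∈ 𝓝 βs := by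
    refine inter_mem ?_ (inter_mem (isOpen_preimage_denSet.mem_nhds hsq) ?_)
    · exact eventually_all.2 fun i =>
        (continuous_apply i).continuousAt.eventually (isOpen_isModel.mem_nhds (hβs i))
    · exact (hopen.preimage (continuous_const.prodMk continuous_dens)).mem_nhds hgood
  obtain ⟨r, hr, hball⟩ := Metric.nhds_basis_closedBall.mem_iff.1 hnhds
  have hcompact : IsCompact (Metric.closedBall βs r) := isCompact_closedBall _ _
  have hself : βs ∈ Metric.closedBall βs r := Metric.mem_closedBall_self hr.le
  have hex : ∀ N, ∃ b ∈ Metric.closedBall βs r,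
      IsMinOn (loss q h βs x N) (Metric.closedBall βs r) b := fun N =>
    hcompact.exists_isMinOn ⟨βs, hself⟩ fun b hb =>
      (continuousAt_loss (hball hb).2.1 x N).continuousWithinAt
  choose bN hbN hmin using hex
  have hlim := hx.tendsto_of_isMinOn hμ hh hm hsq hcompact hself (fun β hβ => hball hβ) hbN hmin
  -- For Gauss–Newton the limit matrix is the Gram matrix of the gradient, nonsingular by the choice
  -- of the good set; for SRIVC nonsingularity is the assumption `hdet`.
  have hE : ∀ i, (Matrix.of fun a b => ∫ x, filteredInput q h i (gradFun q (βs i) a) x *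
      rightSignal meth q h βs βs i x b ∂μ).det ≠ 0 := fun i => by
    rcases meth with _ | _
    · simpa only [rightSignal] using hμ.det_gradFun_ne_zero hh hm hβs hsq hgood.2 i
    · rw [← hμ.expectedNormalMatrix_eq hh hm _ hβs hsq]
      exact hdet rfl i
  have hnorm : ∀ᶠ N in atTop, ∀ i, (normalMatrix meth h N (bN N i) (inputPath i x)
      (residualOutput h (bN N) i (fun i => inputPath i x)
        (output h βs (fun i => inputPath i x) (noisePath x)))).det ≠ 0 :=
    eventually_all.2 fun i => ((continuous_id.matrix_det.tendsto _).comp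
      (hx.tendsto_normalMatrix hh hm hβs hsq meth hlim
        (Eventually.of_forall fun N => (hball (hbN N)).1) i)).eventually_ne (hE i)
  refine ⟨bN, ?_, hlim⟩
  filter_upwards [hnorm, hlim.eventually (Metric.ball_mem_nhds βs hr)] with N hN hNb
  obtain ⟨h1, h2, -⟩ := hball (hbN N)
  refine isDescentLimit_of_score_eq_zero hm hh hx.subexp_input
    (subexp_output hm hh hβs hx.subexp_input hx.subexp_noise) h1 (fun i a => ?_) hN
  -- Consistency moves the minimizer into the open ball, so it satisfies the first order condition.
  have hloc : IsLocalMin (loss q h βs x N) (bN N) :=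
    (hmin N).isLocalMin (mem_of_superset (Metric.isOpen_ball.mem_nhds hNb)
      Metric.ball_subset_closedBall)
  rw [← sum_gradFun_mul_predError_eq_zero_of_isLocalMin h2 hloc i a, score]
  simp only [output_sub_sum_modelOutput hm hh hx.subexp_input hsq h2,
    instrument_inputPath hm hh hx.subexp_input h2]

end Consistency

/-! ### From the probability space to the path space -/

section Transfer

variable {Ω : Type*} [MeasurableSpace Ω] {P : Measure Ω} {K : ℕ} {n m : Fin K → ℕ} {h : ℝ}
  {u : Fin K → ℤ → Ω → ℝ} {v : ℤ → Ω → ℝ}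

theorem aemeasurable_path (hu : ∀ i k, AEMeasurable (u i k) P) (hv : ∀ k, AEMeasurable (v k) P) :
    AEMeasurable (path u v) P :=
  aemeasurable_pi_iff.2 fun k => (aemeasurable_pi_iff.2 fun i => hu i k).prodMk (hv k)

theorem measurable_inputPath (i : Fin K) (k : ℤ) :
    Measurable fun x : PathSpace K => inputPath i x k :=
  (measurable_pi_apply i).comp (measurable_fst.comp (measurable_pi_apply k))

theorem measurable_noisePath (k : ℤ) : Measurable fun x : PathSpace K => noisePath x k :=
  measurable_snd.comp (measurable_pi_apply k)

/-- The law of the sample path of the signals. -/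
theorem signalLaw_map_path (hu : ∀ i k, MemLp (u i k) 2 P)
    (hv : ∀ k, MemLp (v k) 2 P) (hstat : IsStationaryErgodic P u v)
    (hv0 : ∀ k, ∫ ω, v k ω ∂P = 0) (hind : ∀ i k s, IndepFun (u i k) (v s) P) :
    SignalLaw (P.map (path u v)) := by
  have hpath := aemeasurable_path (fun i k => (hu i k).1.aemeasurable)
    fun k => (hv k).1.aemeasurable
  refine ⟨hstat, fun i => ?_, ?_, fun i k => ?_⟩
  · exact (memLp_map_measure_iff (measurable_inputPath i 0).aestronglyMeasurable hpath).2 (hu i 0)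
  · exact (memLp_map_measure_iff (measurable_noisePath 0).aestronglyMeasurable hpath).2 (hv 0)
  · have := (hind i k 0).integral_fun_mul_eq_mul_integral (hu i k).1 (hv 0).1
    rw [hv0, mul_zero] at this
    exact (integral_map hpath
      ((measurable_inputPath i k).mul (measurable_noisePath 0)).aestronglyMeasurable).trans this

theorem integral_inputPath_mul_map_path (hpath : AEMeasurable (path u v) P) (i j : Fin K) (k l : ℤ) :
    ∫ x, inputPath i x k * inputPath j x l ∂(P.map (path u v)) = ∫ ω, u i k ω * u j l ω ∂P :=
  integral_map hpath ((measurable_inputPath i k).mul (measurable_inputPath j l)).aestronglyMeasurable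

theorem SignalLaw.exciting_map_path (hμ : SignalLaw (P.map (path u v)))
    (hpath : AEMeasurable (path u v) P) {i : Fin K} {r : ℕ} (hr : IsPersistentlyExciting P (u i) r) :
    Exciting (P.map (path u v)) i r := by
  refine hμ.exciting ?_
  rw [IsPersistentlyExciting] at hr ⊢
  simpa only [integral_inputPath_mul_map_path hpath] using hr

theorem SignalLaw.pathMISO_map_path (hμ : SignalLaw (P.map (path u v)))
    (hpath : AEMeasurable (path u v) P) (hset : IsMISO P n m u) :
    PathMISO (P.map (path u v)) n m :=
  ⟨fun i j hij k l => by rw [integral_inputPath_mul_map_path hpath, hset.1 i j hij],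
    fun i => hμ.exciting_map_path hpath (hset.2 i)⟩

theorem SignalLaw.pathSISO_map_path (hμ : SignalLaw (P.map (path u v)))
    (hpath : AEMeasurable (path u v) P) (hset : IsAdditiveSISO P n m u) :
    PathSISO (P.map (path u v)) n m := by
  refine ⟨?_, hset.2.1, fun i => hμ.exciting_map_path hpath (hset.2.2 i)⟩
  refine ae_all_iff.2 fun i => ae_all_iff.2 fun j => ?_
  have hmeas : MeasurableSet {x : PathSpace K | inputPath i x = inputPath j x} :=
    measurableSet_eq_fun (measurable_pi_lambda _ fun k => measurable_inputPath i k)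
      (measurable_pi_lambda _ fun k => measurable_inputPath j k)
  refine (ae_map_iff hpath hmeas).2 (Eventually.of_forall fun ω => funext fun k => ?_)
  exact congrFun (hset.1 i j k) ω

theorem SignalLaw.expectedNormalMatrix_map_path (hμ : SignalLaw (P.map (path u v)))
    (hpath : AEMeasurable (path u v) P) (hh : 0 < h) (hm : ∀ i, m i ≤ n i) {βs : JointParam n m}
    (hβs : ∀ i, IsModel (βs i)) (hβsD : dens βs ∈ denRegion h n) (meth : Method) (i : Fin K) :
    expectedNormalMatrix (P.map (path u v)) meth h (fun i k x => inputPath i x k)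
      (fun k x => noisePath x k) βs i = expectedNormalMatrix P meth h u v βs i := by
  obtain ⟨q, hsq⟩ := (eventually_mem_denSet hβsD).exists
  ext a b
  -- The integrand is defined pathwise by an improper filter integral; its measurability is obtained
  -- from the almost surely equal series representation.
  refine integral_map hpath (AEStronglyMeasurable.congr (f := fun x =>
    filteredInput q h i (gradFun q (βs i) a) x * rightSignal meth q h βs βs i x b) ?_ ?_)
  · exact (hμ.memLp_filteredInput hh i _).1.mul
      ((hμ.dominated_rightSignal hh meth βs i b).memLp ⟨βs, hsq⟩).1
  · filter_upwards [hμ.ae_subexp_input, hμ.ae_subexp_noise] with x hx hv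
    have h1 := instrument_inputPath hm hh hx hsq i a 0
    have h2 := rightFactor_residualOutput meth hm hh hx hsq hsq i
      (subexp_residualOutput hm hh hβs i hx (subexp_output hm hh hβs hx hv)) b 0
    rw [shift_zero] at h1 h2
    rw [← h1, ← h2]

end Transfer

end BlockDescent

end

open BlockDescent in
theorem theorem3 {K : ℕ} (n m : Fin K → ℕ) (hn : ∀ i, 1 ≤ n i) (hm : ∀ i, m i ≤ n i)
    (h : ℝ) (hh : 0 < h)
    {Ω : Type*} [MeasurableSpace Ω] (P : Measure Ω) [IsProbabilityMeasure P]
    (u : Fin K → ℤ → Ω → ℝ) (v : ℤ → Ω → ℝ)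
    (hu : ∀ i k, MemLp (u i k) 2 P) (hv : ∀ k, MemLp (v k) 2 P)
    (hstat : IsStationaryErgodic P u v)
    (hv0 : ∀ k, ∫ ω, v k ω ∂P = 0)
    (hind : ∀ i k s, IndepFun (u i k) (v s) P)
    (hsetup : IsMISO P n m u ∨ IsAdditiveSISO P n m u) :
    -- the generic set of pairs (system denominators, model denominators)
    ∃ 𝒢 : Set (Denominators n × Denominators n),
      IsOpen 𝒢 ∧
      volume ((denRegion h n ×ˢ denRegion h n) \ 𝒢) = 0 ∧
      volume {a ∈ denRegion h n | (a, a) ∉ 𝒢} = 0 ∧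
      ∀ βs : JointParam n m, (∀ i, IsModel (βs i)) → dens βs ∈ denRegion h n →
        ∀ meth : Method, ∀ᵐ ω ∂P,
          (∀ βbar : JointParam n m, (∀ i, IsModel (βbar i)) → dens βbar ∈ denRegion h n →
            (dens βs, dens βbar) ∈ 𝒢 →
            IsConvergingPoint meth h (fun i k => u i k ω)
              (output h βs (fun i k => u i k ω) fun k => v k ω) βbar →
            βbar = βs) ∧
          ((dens βs, dens βs) ∈ 𝒢 →
            (meth = Method.srivc → ∀ i, (expectedNormalMatrix P meth h u v βs i).det ≠ 0) →
            IsConvergingPoint meth h (fun i k => u i k ω)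
              (output h βs (fun i k => u i k ω) fun k => v k ω) βs) := by
  have hpath := aemeasurable_path (fun i k => (hu i k).1.aemeasurable)
    fun k => (hv k).1.aemeasurable
  have hμ := signalLaw_map_path hu hv hstat hv0 hind
  have : IsProbabilityMeasure (P.map (path u v)) := Measure.isProbabilityMeasure_map hpath
  have hset : PathMISO (P.map (path u v)) n m ∨ PathSISO (P.map (path u v)) n m :=
    hsetup.imp (hμ.pathMISO_map_path hpath) (hμ.pathSISO_map_path hpath)
  refine ⟨goodSet (P.map (path u v)) h n m, hμ.isOpen_goodSet hh hm,
    hμ.volume_diff_goodSet hh hn hm hset, hμ.volume_diagonal_notMem_goodSet hh hn hm hset,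
    fun βs hβs hβsD meth => ?_⟩
  -- A single typical path serves all candidate limits at once, because the laws of large numbers
  -- hold simultaneously at every parameter.
  filter_upwards [ae_of_ae_map hpath (hμ.ae_typicalPath hh βs)] with ω hω
  refine ⟨fun βbar hβ _ hgood hconv => ?_, fun hgood hdet => ?_⟩
  · exact hω.eq_of_isConvergingPoint hμ hh hm hβs hβsD hβ hgood hconv
  · refine hω.isConvergingPoint hμ hh hm (hμ.isOpen_goodSet hh hm) hβs hβsD hgood fun hmeth i => ?_
    rw [hμ.expectedNormalMatrix_map_path hpath hh hm hβs hβsD]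
    exact hdet hmeth i
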